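/- Let $w:\mathbb Z\to[0,\infty)$ be non-decreasing and non-constant, with $w(0)>0$. Let $(X(n))_{n\ge0}$ be the nearest neighbour random walk on $\mathbb Z$ with $X(0)=0$ which is governed by its local times on oriented edges as follows. Put $$\ell^{\pm}(n,k):=\#\{0\le j\le n-1:\ X(j)=k,\ X(j+1)=k\pm1\},\qquad n\ge 0,\ k\in\mathbb Z,$$ let $\mathcal F_n$ be the $\sigma$-algebra generated by $X(0),\dots,X(n)$, put $d_n:=\ell^+(n,X(n))-\ell^-(n,X(n))$, and suppose that for every $n\ge0$ $$\mathbf P\big(X(n+1)=X(n)\pm1\,\big|\,\mathcal F_n\big)=\frac{w(\mp d_n)}{w(d_n)+w(-d_n)}\qquad\text{a.s.}$$ For $j,k\in\mathbb Z$ and $r\in\{0,1,2,\dots\}$ let $$T^{\pm}_{j,r}:=\min\{n\ge0:\ \ell^{\pm}(n,j)\ge r\},\qquad \Lambda^{\pm}_{j,r}(k):=\ell^+(T^{\pm}_{j,r},k)+\ell^-(T^{\pm}_{j,r},k+1),$$ $$\lambda^{\pm}_{j,r}:=\inf\{k\in\mathbb Z:\ \Lambda^{\pm}_{j,r}(k)>0\},\qquad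 \rho^{\pm}_{j,r}:=\sup\{k\in\mathbb Z:\ \Lambda^{\pm}_{j,r}(k)>0\}.$$ Let $x\in\mathbb R$ and $h>0$ be fixed. Then, for either choice of the sign $\pm$, the times $T^{\pm}_{\lfloor Ax\rfloor,\lfloor Ah\rfloor}$, $A>0$, are almost surely finite, and as $A\to\infty$ (over the reals) $$A^{-1}\lambda^{\pm}_{\lfloor Ax\rfloor,\lfloor Ah\rfloor}\to-|x|-2h,\qquad A^{-1}\rho^{\pm}_{\lfloor Ax\rfloor,\lfloor Ah\rfloor}\to|x|+2h,$$ $$\sup_{y\in\mathbb R}\Big|A^{-1}\Lambda^{\pm}_{\lfloor Ax\rfloor,\lfloor Ah\rfloor}(\lfloor Ay\rfloor)-\big(|x|-|y|+2h\big)_+\Big|\to0,$$ all three in probability. -/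

import Mathlib

open MeasureTheory ProbabilityTheory Filter Topology

/-- Local time on oriented edges. For a path `x` and a sign `s = ±1`, this is `ℓ^±(n, k)`, the number
of jumps from `k` to `k ± 1` among the first `n` steps. -/
def orientedLocalTime (s : ℤˣ) (x : ℕ → ℤ) (n : ℕ) (k : ℤ) : ℕ :=
  ((Finset.range n).filter (fun j => x j = k ∧ x (j + 1) = k + (s : ℤ))).card

/-- Local time `ℓ(n, k) = ℓ⁺(n, k) + ℓ⁻(n, k + 1)` on the unoriented edge `⟨k, k + 1⟩`. -/
def edgeLocalTime (x : ℕ → ℤ) (n : ℕ) (k : ℤ) : ℕ :=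
  orientedLocalTime 1 x n k + orientedLocalTime (-1) x n (k + 1)

/-- Inverse local time `T^±_{j,r} = min {n ≥ 0 : ℓ^±(n, j) ≥ r}`
(with value `0` if there is no such `n`). -/
noncomputable def inverseLocalTime (s : ℤˣ) (x : ℕ → ℤ) (j : ℤ) (r : ℕ) : ℕ :=
  sInf {n : ℕ | r ≤ orientedLocalTime s x n j}

/-- `Λ^±_{j,r}(k)`: unoriented edge local times at the inverse local time `T^±_{j,r}`. -/
noncomputable def stoppedLocalTime (s : ℤˣ) (x : ℕ → ℤ) (j : ℤ) (r : ℕ) (k : ℤ) : ℕ :=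
  edgeLocalTime x (inverseLocalTime s x j r) k

/-- `λ^±_{j,r}`: the leftmost edge visited before `T^±_{j,r}`. -/
noncomputable def leftmostEdge (s : ℤˣ) (x : ℕ → ℤ) (j : ℤ) (r : ℕ) : ℤ :=
  sInf {k : ℤ | 0 < stoppedLocalTime s x j r k}

/-- `ρ^±_{j,r}`: the rightmost edge visited before `T^±_{j,r}`. -/
noncomputable def rightmostEdge (s : ℤˣ) (x : ℕ → ℤ) (j : ℤ) (r : ℕ) : ℤ :=
  sSup {k : ℤ | 0 < stoppedLocalTime s x j r k}

/-- Difference `ℓ⁺(n, x n) - ℓ⁻(n, x n)` of the numbers of past jumps to the right and to the left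
from the site occupied at time `n`. -/
def localTimeDiff (x : ℕ → ℤ) (n : ℕ) : ℤ :=
  (orientedLocalTime 1 x n (x n) : ℤ) - (orientedLocalTime (-1) x n (x n) : ℤ)

/-- Under `P`, the process `X` is the self-repelling walk on `ℤ` with weight function `w`, driven by
local times on oriented edges: it starts from `0`, and given the past `X 0, …, X n` it jumps to
`X n ± 1` with probability `w (∓ d) / (w d + w (- d))`, `d = ℓ⁺(n, X n) - ℓ⁻(n, X n)`. -/
structure IsSelfRepellingWalk {Ω : Type*} [MeasurableSpace Ω] (P : Measure Ω) (w : ℤ → ℝ)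
    (X : ℕ → Ω → ℤ) : Prop where
  measurable : ∀ n, Measurable (X n)
  start : ∀ᵐ ω ∂P, X 0 ω = 0
  step : ∀ (n : ℕ) (s : ℤˣ),
    P⟦{ω | X (n + 1) ω = X n ω + (s : ℤ)} |
        Filtration.natural X (fun i => (measurable i).stronglyMeasurable) n⟧
      =ᵐ[P] fun ω =>
        w (-(s : ℤ) * localTimeDiff (fun i => X i ω) n) /
          (w (localTimeDiff (fun i => X i ω) n) + w (-localTimeDiff (fun i => X i ω) n))

/-!
# Local times of a self-repelling walk on `ℤ`

The proof is a law of large numbers of Ray–Knight type. Give each site `k` its own sequence of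
signs, and let the walk take the `t`-th of them after its `t`-th visit to `k` (`stackWalk`). If the
signs at a site come from the symmetric chain `siteDiff`, which steps up from `d` with probability
`p d = w (-d) / (w d + w (-d))` and is therefore pushed back towards `0`, and if different sites use
independent variables, then this walk has the law of the given one: a law on path space is
determined by its transition rule (`HasStepLaw.unique`, `map_eq_map_stackWalk`). The theorem then
becomes a statement about independent sequences of signs.

Stop the walk at an inverse local time. Conservation of flow through edges shows that, on each side
of the walker, the number of jumps across consecutive edges is a Markov chain `edgeChain` along the
sites (`FollowsStacks.stoppedLocalTime_eq`): the value `z` at one edge is replaced by the number of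
signs `σ` which precede the `z`-th sign `-σ` at the next site, plus one between the target site
and the origin.

One step of this chain displaces a high level `z` by a variable with exponential tails and mean
close to `-1/2`. For the tails, `lam ^ |d|` is a Lyapunov function of `siteDiff`
(`exists_absTail_le`). For the mean, write it as `-1/2` plus a sum of differences
`P(|d_t| ≥ j) - P(|d_s| ≥ j)` with `s ≤ t` of the same parity. These probabilities increase in time,
because two copies of `|d|` of equal parity cannot cross (`stepOp_iterate_le_add_two`). So the
differences are nonnegative and tend to `0`, and dominated convergence applies (`meanExcess_nonneg`,
`tendsto_meanExcess`). No invariant measure or mixing estimate is needed.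

Hence the chain has slope `1/2` between the target site and the origin and slope `-1/2` beyond.
Exponential Chebyshev bounds make this precise down to level `δ A`; near level `0` the chain is
absorbed in a time of the order of its size, by the Lyapunov function `extinctionPotential`, which
uses that a step goes down with probability exactly `1/2`. Together this gives
`exists_drivingLaw_not_followsProfile_le`. The chains count the jumps in one direction only, which
is half of the local time of an edge up to `1`, so the local times form the triangle
`|j| - |e| + 2 r` with high probability (`HasTriangularProfile`), from which the three limits follow
by rounding. The inverse local times are finite because a walk that crosses some oriented edge only
finitely often would, by the extinction of the chains on both sides, take finitely many steps in
all (`FollowsStacks.exists_le_orientedLocalTime`).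
-/

namespace SelfRepellingWalk

/-! ### The birth-and-death chain at a single site -/

/-- The up-probability `p d` of a symmetric nearest neighbour chain on `ℤ` that is pushed back
towards the origin, uniformly outside a bounded interval. -/
structure IsRestoring (p : ℤ → ℝ) : Prop where
  nonneg : ∀ d, 0 ≤ p d
  symm : ∀ d, p (-d) = 1 - p d
  tail : ∃ q < (1 / 2 : ℝ), ∃ M : ℕ, ∀ d : ℤ, (M : ℤ) ≤ d → p d ≤ q

namespace IsRestoring

variable {p : ℤ → ℝ}

lemma le_one (hp : IsRestoring p) (d : ℤ) : p d ≤ 1 := by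
  have := hp.nonneg (-d)
  rw [hp.symm] at this
  linarith

end IsRestoring

/-- The transition operator of the chain on `ℤ` that steps from `d` to `d + 1` with probability
`p d` and to `d - 1` otherwise. -/
def stepOp (p : ℤ → ℝ) (f : ℤ → ℝ) (d : ℤ) : ℝ := p d * f (d + 1) + (1 - p d) * f (d - 1)

section Operator

variable {p : ℤ → ℝ}

lemma stepOp_mono (hp : IsRestoring p) {f g : ℤ → ℝ} (hfg : ∀ d, f d ≤ g d) (d : ℤ) :
    stepOp p f d ≤ stepOp p g d := by
  have h1 := mul_le_mul_of_nonneg_left (hfg (d + 1)) (hp.nonneg d)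
  have h2 := mul_le_mul_of_nonneg_left (hfg (d - 1)) (sub_nonneg.2 (hp.le_one d))
  unfold stepOp
  linarith

lemma stepOp_iterate_mono (hp : IsRestoring p) {f g : ℤ → ℝ} (hfg : ∀ d, f d ≤ g d) (t : ℕ) :
    ∀ d, (stepOp p)^[t] f d ≤ (stepOp p)^[t] g d := by
  induction t with
  | zero => exact hfg
  | succ t ih =>
    intro d
    rw [Function.iterate_succ_apply', Function.iterate_succ_apply']
    exact stepOp_mono hp ih d

lemma stepOp_iterate_affine (c b : ℝ) (f : ℤ → ℝ) (t : ℕ) :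
    ∀ d, (stepOp p)^[t] (fun e => c * f e + b) d = c * (stepOp p)^[t] f d + b := by
  induction t with
  | zero => intro d; rfl
  | succ t ih =>
    intro d
    rw [Function.iterate_succ_apply', Function.iterate_succ_apply']
    simp only [stepOp, ih]
    ring

lemma stepOp_iterate_even (hp : IsRestoring p) {f : ℤ → ℝ} (hf : ∀ d, f (-d) = f d) (t : ℕ) :
    ∀ d, (stepOp p)^[t] f (-d) = (stepOp p)^[t] f d := by
  induction t with
  | zero => exact hf
  | succ t ih =>
    intro d
    rw [Function.iterate_succ_apply']
    simp only [stepOp]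
    rw [hp.symm, show -d + 1 = -(d - 1) by ring, show -d - 1 = -(d + 1) by ring, ih, ih]
    ring

lemma stepOp_iterate_add_reflect (hp : IsRestoring p) (f : ℤ → ℝ) (t : ℕ) :
    ∀ d, (stepOp p)^[t] (fun e => f e + f (-e)) d =
      (stepOp p)^[t] f d + (stepOp p)^[t] f (-d) := by
  induction t with
  | zero => intro d; rfl
  | succ t ih =>
    intro d
    simp only [Function.iterate_succ_apply', stepOp, ih]
    rw [hp.symm, show -(d + 1) = -d - 1 by ring, show -(d - 1) = -d + 1 by ring]
    ring

/-- Reflected to `|d|`, two copies of the chain of the same parity cannot cross, so the chain is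
stochastically monotone on each parity class. -/
lemma stepOp_iterate_le_add_two (hp : IsRestoring p) {f : ℤ → ℝ} (hf : ∀ d, f (-d) = f d)
    (hmono : ∀ d, 0 ≤ d → f d ≤ f (d + 2)) (t : ℕ) :
    ∀ d, 0 ≤ d → (stepOp p)^[t] f d ≤ (stepOp p)^[t] f (d + 2) := by
  induction t with
  | zero => exact hmono
  | succ t ih =>
    intro d hd
    rw [Function.iterate_succ_apply']
    have hev := stepOp_iterate_even hp hf t
    set g := (stepOp p)^[t] f
    have h1 : g (d - 1) ≤ g (d + 1) := by
      rcases eq_or_lt_of_le hd with h | h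
      · subst h; simpa using (hev 1).le
      · simpa [show d - 1 + 2 = d + 1 by ring] using ih (d - 1) (by omega)
    have h2 : g (d + 1) ≤ g (d + 3) := by
      simpa [show d + 1 + 2 = d + 3 by ring] using ih (d + 1) (by omega)
    simp only [stepOp]
    rw [show d + 2 + 1 = d + 3 by ring, show d + 2 - 1 = d + 1 by ring]
    have h3 := mul_le_mul_of_nonneg_left h1 (sub_nonneg.2 (hp.le_one d))
    have h4 := mul_le_mul_of_nonneg_left h2 (hp.nonneg (d + 2))
    linarith

/-- `P(|d_t| ≥ j)` for the chain started from `0`. -/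
noncomputable def absTail (p : ℤ → ℝ) (t : ℕ) (j : ℕ) : ℝ :=
  (stepOp p)^[t] (fun d => if (j : ℤ) ≤ |d| then 1 else 0) 0

lemma absTail_le_add_two (hp : IsRestoring p) (t j : ℕ) :
    absTail p t j ≤ absTail p (t + 2) j := by
  unfold absTail
  set f : ℤ → ℝ := fun d => if (j : ℤ) ≤ |d| then 1 else 0
  have hf : ∀ d, f (-d) = f d := fun d => by simp [f]
  have hm : ∀ d, 0 ≤ d → f d ≤ f (d + 2) := by
    intro d hd
    simp only [f]
    rw [abs_of_nonneg hd, abs_of_nonneg (by omega : (0 : ℤ) ≤ d + 2)]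
    split_ifs <;> first | omega | norm_num
  have hev := stepOp_iterate_even hp hf
  have hev1 := hev (t + 1) 1
  have h2 := stepOp_iterate_le_add_two hp hf hm t 0 le_rfl
  rw [show t + 2 = (t + 1) + 1 by ring, Function.iterate_succ_apply']
  simp only [stepOp, zero_add, zero_sub]
  rw [hev1, Function.iterate_succ_apply']
  simp only [stepOp]
  norm_num at h2 ⊢
  have h3 := mul_le_mul_of_nonneg_left h2 (hp.nonneg 1)
  linarith

lemma absTail_le_add_two_mul (hp : IsRestoring p) (t j k : ℕ) :
    absTail p t j ≤ absTail p (t + 2 * k) j := by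
  induction k with
  | zero => simp
  | succ k ih => exact ih.trans (absTail_le_add_two hp _ _)

lemma absTail_nonneg (hp : IsRestoring p) (t j : ℕ) : 0 ≤ absTail p t j := by
  have h := stepOp_iterate_mono hp (f := fun d => 0 * (if (j : ℤ) ≤ |d| then 1 else 0) + 0)
    (g := fun d => if (j : ℤ) ≤ |d| then 1 else 0)
    (fun d => by split_ifs <;> norm_num) t 0
  rw [stepOp_iterate_affine] at h
  simpa [absTail] using h

lemma absTail_eq_zero {t j : ℕ} (h : t < j) : absTail p t j = 0 := by
  have key : ∀ t : ℕ, ∀ d : ℤ, |d| + t < j →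
      (stepOp p)^[t] (fun d => if (j : ℤ) ≤ |d| then (1 : ℝ) else 0) d = 0 := by
    intro t
    induction t with
    | zero => intro d hd; simp at hd ⊢; exact hd
    | succ t ih =>
      intro d hd
      rw [Function.iterate_succ_apply']
      push_cast at hd
      simp only [stepOp]
      rw [ih (d + 1) (by have := abs_add_le d 1; norm_num at this; omega),
        ih (d - 1) (by have := abs_sub d 1; norm_num at this; omega)]
      simp
  exact key t 0 (by simpa using h)

lemma absTail_one_of_odd {t : ℕ} (h : Odd t) : absTail p t 1 = 1 := by
  have key : ∀ t : ℕ, ∀ d : ℤ, Odd (d + t) →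
      (stepOp p)^[t] (fun d => if ((1 : ℕ) : ℤ) ≤ |d| then (1 : ℝ) else 0) d = 1 := by
    intro t
    induction t with
    | zero =>
      intro d hd
      have : d ≠ 0 := by rintro rfl; simp at hd
      simpa using this
    | succ t ih =>
      intro d hd
      rw [Function.iterate_succ_apply']
      push_cast at hd
      simp only [stepOp]
      rw [ih (d + 1) (by rwa [add_right_comm, add_assoc]),
        ih (d - 1) (by
          have := hd.sub_even (by decide : Even (2 : ℤ))
          rwa [show d + ((t : ℤ) + 1) - 2 = d - 1 + t by ring] at this)]
      norm_num
  exact key t 0 (by simpa using h)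

/-- The Lyapunov function `lam ^ |d|` gives exponential tails for the chain, uniformly in time. -/
lemma exists_absTail_le (hp : IsRestoring p) :
    ∃ lam > (1 : ℝ), ∃ C > (0 : ℝ), ∀ t j, absTail p t j ≤ C * lam⁻¹ ^ j := by
  obtain ⟨q₀, hq₀, M, hM⟩ := hp.tail
  obtain ⟨q, hq, hq4, hqM⟩ : ∃ q < (1 / 2 : ℝ), 1 / 4 ≤ q ∧ ∀ d : ℤ, (M : ℤ) ≤ d → p d ≤ q :=
    ⟨max q₀ (1 / 4), max_lt hq₀ (by norm_num), le_max_right _ _,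
      fun d hd => (hM d hd).trans (le_max_left _ _)⟩
  -- any `lam` strictly between `1` and `(1 - q) / q` contracts
  set lam : ℝ := 1 / (2 * q) with hlam
  have hq0 : 0 < q := by linarith
  have hlam1 : 1 < lam := by rw [hlam, lt_div_iff₀ (by linarith)]; linarith
  have hlam0 : 0 < lam := by linarith
  have hlamq : q * lam = 1 / 2 := by rw [hlam]; field_simp
  set γ : ℝ := 1 / 2 + (1 - q) * lam⁻¹ with hγ
  have hinv : lam⁻¹ = 2 * q := by rw [hlam]; simp
  have hγ1 : γ < 1 := by rw [hγ, hinv]; nlinarith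
  have hγ0 : 0 < γ := by rw [hγ, hinv]; nlinarith
  set V : ℤ → ℝ := fun d => lam ^ d.natAbs with hV
  have hVpos : ∀ d, 0 < V d := fun d => pow_pos hlam0 _
  have hVeven : ∀ d, V (-d) = V d := fun d => by simp [hV]
  set B : ℝ := lam ^ (M + 2) with hB
  have hBpos : 0 < B := pow_pos hlam0 _
  have hdrift0 : ∀ n : ℕ, stepOp p V n ≤ γ * V n + B := by
    intro n
    have e1 : V ((n : ℤ) + 1) = lam ^ (n + 1) := by
      simp only [hV]; congr 1
    rcases lt_or_ge n (M + 1) with h | h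
    · have h1 : V ((n : ℤ) + 1) ≤ B := by
        rw [e1]; exact pow_le_pow_right₀ hlam1.le (by omega)
      have h2 : V ((n : ℤ) - 1) ≤ B := by
        simp only [hV]; exact pow_le_pow_right₀ hlam1.le (by omega)
      have h3 := mul_le_mul_of_nonneg_left h1 (hp.nonneg n)
      have h4 := mul_le_mul_of_nonneg_left h2 (sub_nonneg.2 (hp.le_one n))
      have h5 := mul_pos hγ0 (hVpos n)
      simp only [stepOp]
      linarith
    · obtain ⟨k, rfl⟩ : ∃ k, n = k + 1 := ⟨n - 1, by omega⟩
      have e2 : V (((k + 1 : ℕ) : ℤ) - 1) = lam ^ k := by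
        simp only [hV]; congr 1; omega
      have e3 : V ((k + 1 : ℕ) : ℤ) = lam ^ (k + 1) := by simp only [hV]; congr 1
      have hpq := hqM ((k + 1 : ℕ) : ℤ) (by omega)
      simp only [stepOp]
      rw [e1, e2, e3]
      have hk : 0 < lam ^ k := pow_pos hlam0 k
      have h6 : lam ^ k ≤ lam ^ (k + 1 + 1) := pow_le_pow_right₀ hlam1.le (by omega)
      have h7 : γ * lam ^ (k + 1) = q * lam ^ (k + 1 + 1) + (1 - q) * lam ^ k := by
        rw [hγ, ← hlamq]
        field_simp
        ring
      rw [h7]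
      nlinarith
  have hdrift : ∀ d, stepOp p V d ≤ γ * V d + B := by
    intro d
    have hev := stepOp_iterate_even hp hVeven 1 d
    simp only [Function.iterate_one] at hev
    rcases Int.natAbs_eq d with h | h
    · rw [h]; exact hdrift0 _
    · rw [← hev, ← hVeven d, show -d = (d.natAbs : ℤ) by omega]; exact hdrift0 _
  have hbound : ∀ t, (stepOp p)^[t] V 0 ≤ 1 + B / (1 - γ) := by
    intro t
    induction t with
    | zero => simpa [hV] using div_nonneg hBpos.le (sub_pos.2 hγ1).le
    | succ t ih =>
      have h1 := stepOp_iterate_mono hp hdrift t 0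
      rw [stepOp_iterate_affine] at h1
      rw [Function.iterate_succ_apply]
      have h2 : B / (1 - γ) * (1 - γ) = B := div_mul_cancel₀ _ (sub_pos.2 hγ1).ne'
      nlinarith
  refine ⟨lam, hlam1, 1 + B / (1 - γ), by have := div_pos hBpos (sub_pos.2 hγ1); linarith, ?_⟩
  intro t j
  have h1 : ∀ d : ℤ, (if (j : ℤ) ≤ |d| then (1 : ℝ) else 0) ≤ lam⁻¹ ^ j * V d + 0 := by
    intro d
    rw [Int.abs_eq_natAbs, add_zero]
    split_ifs with h
    · have : lam ^ j ≤ V d := pow_le_pow_right₀ hlam1.le (by omega)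
      rw [inv_pow, inv_mul_eq_div, one_le_div (pow_pos hlam0 j)]
      exact this
    · exact mul_nonneg (by positivity) (hVpos d).le
  have h2 := stepOp_iterate_mono hp h1 t 0
  rw [stepOp_iterate_affine, add_zero] at h2
  calc absTail p t j ≤ lam⁻¹ ^ j * (stepOp p)^[t] V 0 := h2
    _ ≤ lam⁻¹ ^ j * (1 + B / (1 - γ)) := by gcongr; exact hbound t
    _ = _ := mul_comm _ _

/-- The excess over `m - 1/2` of the mean number of up-steps that the chain takes before its `m`-th
down-step; see `integral_oppositeBefore`. -/
noncomputable def meanExcess (p : ℤ → ℝ) (m : ℕ) : ℝ :=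
  ∑' j : ℕ, (absTail p (2 * m + j) (j + 2) - absTail p (2 * m - 2 - j) (j + 2)) / 2

lemma meanExcess_term_nonneg (hp : IsRestoring p) (m j : ℕ) :
    0 ≤ (absTail p (2 * m + j) (j + 2) - absTail p (2 * m - 2 - j) (j + 2)) / 2 := by
  rcases lt_or_ge (2 * m - 2 - j) (j + 2) with h | h
  · rw [absTail_eq_zero h]
    have := absTail_nonneg hp (2 * m + j) (j + 2)
    linarith
  · have := absTail_le_add_two_mul hp (2 * m - 2 - j) (j + 2) (j + 1)
    rw [show 2 * m - 2 - j + 2 * (j + 1) = 2 * m + j by omega] at this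
    linarith

lemma meanExcess_nonneg (hp : IsRestoring p) (m : ℕ) : 0 ≤ meanExcess p m :=
  tsum_nonneg (meanExcess_term_nonneg hp m)

lemma tendsto_meanExcess (hp : IsRestoring p) : Tendsto (meanExcess p) atTop (𝓝 0) := by
  obtain ⟨lam, hlam, C, hC, hb⟩ := exists_absTail_le hp
  have hs : Summable fun j : ℕ => C * lam⁻¹ ^ (j + 2) := by
    refine Summable.mul_left _ ?_
    exact (summable_nat_add_iff 2).2
      (summable_geometric_of_lt_one (by positivity) (inv_lt_one_of_one_lt₀ hlam))
  have key : Tendsto (meanExcess p) atTop (𝓝 (∑' _ : ℕ, (0 : ℝ))) := by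
    refine tendsto_tsum_of_dominated_convergence hs (fun j => ?_)
      (Eventually.of_forall fun m j => ?_)
    · -- both probabilities run through the same bounded monotone sequence
      have hmono : Monotone fun m : ℕ => absTail p (j + 2 * m) (j + 2) :=
        monotone_nat_of_le_succ fun m => absTail_le_add_two hp _ _
      obtain ⟨l, hl⟩ : ∃ l, Tendsto (fun m : ℕ => absTail p (j + 2 * m) (j + 2)) atTop (𝓝 l) :=
        ⟨_, tendsto_atTop_ciSup hmono ⟨C * lam⁻¹ ^ (j + 2), by rintro _ ⟨m, rfl⟩; exact hb _ _⟩⟩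
      have h1 : Tendsto (fun m : ℕ => absTail p (2 * m + j) (j + 2)) atTop (𝓝 l) := by
        simpa only [add_comm] using hl
      have h2 : Tendsto (fun m : ℕ => absTail p (2 * m - 2 - j) (j + 2)) atTop (𝓝 l) := by
        have := hl.comp (tendsto_sub_atTop_nat (1 + j))
        refine this.congr' ?_
        filter_upwards [eventually_ge_atTop (1 + j)] with m hm
        simp only [Function.comp_apply]
        congr 1
        omega
      simpa using (h1.sub h2).div_const 2
    · rw [Real.norm_of_nonneg (meanExcess_term_nonneg hp m j)]
      have h1 := hb (2 * m + j) (j + 2)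
      have h2 := absTail_nonneg hp (2 * m - 2 - j) (j + 2)
      have h3 : 0 ≤ C * lam⁻¹ ^ (j + 2) := by positivity
      linarith
  simpa using key

end Operator

/-! ### Sequences of signs -/

/-- The number of entries equal to `σ` among the first `t` entries of a sequence of signs. -/
def signCount (ζ : ℕ → ℤˣ) (σ : ℤˣ) (t : ℕ) : ℕ :=
  ((Finset.range t).filter (fun i => ζ i = σ)).card

/-- The number of entries `-σ` that precede the `m`-th entry `σ` of a sequence of signs (`0` if
there are fewer than `m` entries `σ`): the least `l` such that the first `m + l` entries contain
`m` times the sign `σ`. -/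
noncomputable def oppositeBefore (ζ : ℕ → ℤˣ) (σ : ℤˣ) (m : ℕ) : ℕ :=
  sInf {l | m ≤ signCount ζ σ (m + l)}

lemma signCount_zero (ζ : ℕ → ℤˣ) (σ : ℤˣ) : signCount ζ σ 0 = 0 := by simp [signCount]

lemma signCount_succ (ζ : ℕ → ℤˣ) (σ : ℤˣ) (t : ℕ) :
    signCount ζ σ (t + 1) = signCount ζ σ t + if ζ t = σ then 1 else 0 := by
  unfold signCount
  rw [Finset.range_add_one, Finset.filter_insert]
  split_ifs with h
  · rw [Finset.card_insert_of_notMem (by simp)]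
  · simp

lemma signCount_mono (ζ : ℕ → ℤˣ) (σ : ℤˣ) : Monotone (signCount ζ σ) :=
  monotone_nat_of_le_succ fun t => by rw [signCount_succ]; omega

lemma units_ne_iff_eq_neg {a b : ℤˣ} : a ≠ b ↔ a = -b := by
  rcases Int.units_eq_one_or a with rfl | rfl <;> rcases Int.units_eq_one_or b with rfl | rfl <;>
    decide

lemma signCount_add_neg (ζ : ℕ → ℤˣ) (σ : ℤˣ) (t : ℕ) :
    signCount ζ σ t + signCount ζ (-σ) t = t := by
  induction t with
  | zero => simp [signCount_zero]
  | succ t ih =>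
    rw [signCount_succ, signCount_succ]
    by_cases h : ζ t = σ
    · have : ζ t ≠ -σ := by rw [h]; exact (units_ne_iff_eq_neg.2 (neg_neg σ).symm)
      rw [if_pos h, if_neg this]; omega
    · rw [if_neg h, if_pos (units_ne_iff_eq_neg.1 h)]; omega

lemma oppositeBefore_zero (ζ : ℕ → ℤˣ) (σ : ℤˣ) : oppositeBefore ζ σ 0 = 0 := by
  simp [oppositeBefore]

/-- A sequence of signs is recurrent if both signs occur infinitely often. -/
def IsRecurrent (ζ : ℕ → ℤˣ) : Prop := ∀ σ m, ∃ t, m ≤ signCount ζ σ t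

lemma lt_oppositeBefore_iff {ζ : ℕ → ℤˣ} (hζ : IsRecurrent ζ) (σ : ℤˣ) (m l : ℕ) :
    l < oppositeBefore ζ σ m ↔ signCount ζ σ (m + l) < m := by
  have hne : {l | m ≤ signCount ζ σ (m + l)}.Nonempty := by
    obtain ⟨t, ht⟩ := hζ σ m
    exact ⟨t, ht.trans (signCount_mono ζ σ (by omega))⟩
  constructor
  · intro h
    exact not_le.1 fun hle => Nat.notMem_of_lt_sInf (s := {l | m ≤ signCount ζ σ (m + l)}) h hle
  · intro h
    by_contra! hle
    have h1 : m ≤ signCount ζ σ (m + oppositeBefore ζ σ m) := Nat.sInf_mem hne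
    exact absurd (h1.trans (signCount_mono ζ σ (by omega))) (not_le.2 h)

lemma oppositeBefore_mono {ζ : ℕ → ℤˣ} (hζ : IsRecurrent ζ) (σ : ℤˣ) :
    Monotone (oppositeBefore ζ σ) := by
  refine monotone_nat_of_le_succ fun m => ?_
  by_contra! h
  have h1 := (lt_oppositeBefore_iff hζ σ m _).1 h
  have h2 := mt (lt_oppositeBefore_iff hζ σ (m + 1) _).2 (lt_irrefl (oppositeBefore ζ σ (m + 1)))
  rw [show m + 1 + oppositeBefore ζ σ (m + 1) = m + oppositeBefore ζ σ (m + 1) + 1 by ring,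
    signCount_succ] at h2
  split_ifs at h2 <;> omega

lemma signCount_neg_le_oppositeBefore {ζ : ℕ → ℤˣ} (hζ : IsRecurrent ζ) (σ : ℤˣ) (t : ℕ) :
    signCount ζ (-σ) t ≤ oppositeBefore ζ σ (signCount ζ σ t + 1) := by
  have h := signCount_add_neg ζ σ t
  rcases Nat.eq_zero_or_pos (signCount ζ (-σ) t) with h0 | h0
  · omega
  · have := (lt_oppositeBefore_iff hζ σ (signCount ζ σ t + 1) (signCount ζ (-σ) t - 1)).2 (by
      rw [show signCount ζ σ t + 1 + (signCount ζ (-σ) t - 1) = t by omega]; omega)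
    omega

/-- If the next entry is `σ`, the entries `-σ` seen so far are those before the next `σ`. -/
lemma oppositeBefore_of_next {ζ : ℕ → ℤˣ} {σ : ℤˣ} {t : ℕ} (h : ζ t = σ) :
    oppositeBefore ζ σ (signCount ζ σ t + 1) = signCount ζ (-σ) t := by
  have hadd := signCount_add_neg ζ σ t
  refine IsLeast.csInf_eq ⟨?_, fun l hl => ?_⟩
  · show _ ≤ signCount ζ σ _
    rw [show signCount ζ σ t + 1 + signCount ζ (-σ) t = t + 1 by omega, signCount_succ, if_pos h]
  · by_contra! hlt
    have h1 : signCount ζ σ t + 1 ≤ signCount ζ σ (signCount ζ σ t + 1 + l) := hl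
    have h2 := signCount_mono ζ σ (show signCount ζ σ t + 1 + l ≤ t by omega)
    omega

/-- If the last entry was `σ`, the entries `-σ` seen so far are those before that `σ`. -/
lemma oppositeBefore_of_last {ζ : ℕ → ℤˣ} {σ : ℤˣ} {t : ℕ} (h : t = 0 ∨ ζ (t - 1) = σ) :
    oppositeBefore ζ σ (signCount ζ σ t) = signCount ζ (-σ) t := by
  rcases t with _ | t
  · simp [signCount_zero, oppositeBefore_zero]
  · have h' : ζ t = σ := by simpa using h
    have : ζ t ≠ -σ := by rw [h']; exact (units_ne_iff_eq_neg.2 (neg_neg σ).symm)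
    rw [signCount_succ, signCount_succ, if_pos h', if_neg this]
    exact oppositeBefore_of_next h'

/-! ### The signs drawn at a single site -/

/-- Position after `t` steps of the chain from `0` that steps up with probability `p d`, driven by
the numbers `v i ∈ [0, 1]`. -/
noncomputable def siteDiff (p : ℤ → ℝ) (v : ℕ → unitInterval) : ℕ → ℤ
  | 0 => 0
  | t + 1 => if (v t : ℝ) < p (siteDiff p v t) then siteDiff p v t + 1 else siteDiff p v t - 1

/-- The steps of `siteDiff`. -/
noncomputable def siteStep (p : ℤ → ℝ) (v : ℕ → unitInterval) (t : ℕ) : ℤˣ :=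
  if (v t : ℝ) < p (siteDiff p v t) then 1 else -1

lemma siteDiff_succ (p : ℤ → ℝ) (v : ℕ → unitInterval) (t : ℕ) :
    siteDiff p v (t + 1) = siteDiff p v t + (siteStep p v t : ℤ) := by
  rw [siteDiff, siteStep]
  split_ifs <;> simp [sub_eq_add_neg]

lemma two_mul_signCount_siteStep (p : ℤ → ℝ) (v : ℕ → unitInterval) (σ : ℤˣ) (t : ℕ) :
    2 * (signCount (siteStep p v) σ t : ℤ) = t + σ * siteDiff p v t := by
  induction t with
  | zero => simp [signCount_zero, siteDiff]
  | succ t ih =>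
    rw [signCount_succ, siteDiff_succ]
    generalize siteStep p v t = a at *
    rcases Int.units_eq_one_or σ with rfl | rfl <;> rcases Int.units_eq_one_or a with rfl | rfl <;>
      simp at ih ⊢ <;> linarith

lemma siteDiff_eq_signCount_sub (p : ℤ → ℝ) (v : ℕ → unitInterval) (t : ℕ) :
    siteDiff p v t = (signCount (siteStep p v) 1 t : ℤ) - signCount (siteStep p v) (-1) t := by
  have h1 := two_mul_signCount_siteStep p v 1 t
  have h2 := two_mul_signCount_siteStep p v (-1) t
  simp at h1 h2
  linarith

section Measurability

instance : MeasurableSingletonClass ℤˣ where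
  measurableSet_singleton a := by
    have : ({a} : Set ℤˣ) = Units.val ⁻¹' {(a : ℤ)} := by ext b; simp [Units.ext_iff]
    rw [this]
    exact ⟨_, measurableSet_singleton _, rfl⟩

variable {Ω : Type*} [MeasurableSpace Ω] {p : ℤ → ℝ} {v : Ω → ℕ → unitInterval}

lemma measurable_siteDiff {t : ℕ} (hv : ∀ i < t, Measurable fun ω => v ω i) :
    Measurable fun ω => siteDiff p (v ω) t := by
  induction t with
  | zero => exact measurable_const
  | succ t ih =>
    have h1 := ih fun i hi => hv i (by omega)
    have h2 := hv t (by omega)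
    simp only [siteDiff]
    refine Measurable.ite ?_ (h1.add_const 1) (h1.sub_const 1)
    exact measurableSet_lt h2.subtype_val ((measurable_of_countable p).comp h1)

lemma measurable_siteStep {t : ℕ} (hv : ∀ i ≤ t, Measurable fun ω => v ω i) :
    Measurable fun ω => siteStep p (v ω) t := by
  have h1 := measurable_siteDiff (p := p) (t := t) fun i hi => hv i hi.le
  refine Measurable.ite ?_ measurable_const measurable_const
  exact measurableSet_lt (hv t le_rfl).subtype_val ((measurable_of_countable p).comp h1)

lemma measurable_signCount {ζ : Ω → ℕ → ℤˣ} {σ : ℤˣ} {t : ℕ}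
    (hζ : ∀ i < t, Measurable fun ω => ζ ω i) : Measurable fun ω => signCount (ζ ω) σ t := by
  induction t with
  | zero => simp only [signCount_zero]; exact measurable_const
  | succ t ih =>
    simp only [signCount_succ]
    refine (ih fun i hi => hζ i (by omega)).add (Measurable.ite ?_ measurable_const measurable_const)
    exact hζ t (by omega) (measurableSet_singleton σ)

lemma measurable_sInf_nat {q : ℕ → Ω → Prop} (hq : ∀ l, MeasurableSet {ω | q l ω}) :
    Measurable fun ω => sInf {l | q l ω} := by
  refine measurable_to_countable' fun n => ?_
  have : (fun ω => sInf {l | q l ω}) ⁻¹' {n} =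
      ({ω | q n ω} ∩ ⋂ l, ⋂ (_ : l < n), {ω | q l ω}ᶜ) ∪
        ({_ω | n = 0} ∩ ⋂ l, {ω | q l ω}ᶜ) := by
    ext ω
    simp only [Set.mem_preimage, Set.mem_singleton_iff, Set.mem_union, Set.mem_inter_iff,
      Set.mem_iInter, Set.mem_compl_iff, Set.mem_ofPred_eq]
    constructor
    · rintro rfl
      by_cases h : {l | q l ω}.Nonempty
      · exact Or.inl ⟨Nat.sInf_mem h, fun l hl => Nat.notMem_of_lt_sInf hl⟩
      · rw [Set.not_nonempty_iff_eq_empty] at h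
        exact Or.inr ⟨by rw [h]; simp, fun l hl => by
          have : l ∈ {l | q l ω} := hl
          rw [h] at this; exact this⟩
    · rintro (⟨h1, h2⟩ | ⟨rfl, h⟩)
      · exact IsLeast.csInf_eq ⟨h1, fun l hl => not_lt.1 fun hlt => h2 l hlt hl⟩
      · have : {l | q l ω} = ∅ := by ext l; simpa using h l
        rw [this]; simp
  rw [this]
  exact ((hq n).inter (MeasurableSet.iInter fun l => MeasurableSet.iInter fun _ =>
    (hq l).compl)).union ((MeasurableSet.const _).inter (MeasurableSet.iInter fun l =>
      (hq l).compl))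

lemma measurable_oppositeBefore {ζ : Ω → ℕ → ℤˣ} (hζ : ∀ i, Measurable fun ω => ζ ω i)
    (σ : ℤˣ) (m : ℕ) : Measurable fun ω => oppositeBefore (ζ ω) σ m :=
  measurable_sInf_nat fun _ => measurable_signCount (fun i _ => hζ i) (measurableSet_Ici (a := m))

end Measurability

/-! ### Independent uniform variables -/

/-- The space of driving variables: one number in `[0, 1]` for each site and each visit to it. -/
abbrev Driving : Type := ℤ × ℕ → unitInterval

/-- The law under which the driving variables are independent and uniform. -/
noncomputable def drivingLaw : Measure Driving :=
  Measure.infinitePi fun _ => (volume : Measure unitInterval)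

instance : IsProbabilityMeasure drivingLaw := by unfold drivingLaw; infer_instance

/-- The `σ`-algebra generated by the driving variables with index in `S`. -/
@[reducible] def coordAlg (S : Set (ℤ × ℕ)) : MeasurableSpace Driving :=
  ⨆ i ∈ S, MeasurableSpace.comap (fun u : Driving => u i) inferInstance

lemma coordAlg_mono {S T : Set (ℤ × ℕ)} (h : S ⊆ T) : coordAlg S ≤ coordAlg T :=
  biSup_mono h

lemma coordAlg_le (S : Set (ℤ × ℕ)) : coordAlg S ≤ MeasurableSpace.pi :=
  iSup₂_le fun i _ => (measurable_pi_apply i).comap_le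

lemma measurable_coord {S : Set (ℤ × ℕ)} {i : ℤ × ℕ} (hi : i ∈ S) :
    Measurable[coordAlg S] fun u : Driving => u i :=
  Measurable.mono (comap_measurable _)
    (le_iSup₂ (f := fun i (_ : i ∈ S) =>
      MeasurableSpace.comap (fun u : Driving => u i) inferInstance) i hi) le_rfl

lemma indep_coordAlg {S T : Set (ℤ × ℕ)} (h : Disjoint S T) :
    Indep (coordAlg S) (coordAlg T) drivingLaw := by
  have hi : iIndepFun (fun (i : ℤ × ℕ) (u : Driving) => u i) drivingLaw :=
    iIndepFun_infinitePi (X := fun _ x => x) (fun _ => measurable_id)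
  exact indep_iSup_of_disjoint (fun i => (measurable_pi_apply i).comap_le) hi h

lemma indepFun_of_coordAlg {β γ : Type*} [MeasurableSpace β] [MeasurableSpace γ]
    {S T : Set (ℤ × ℕ)} (h : Disjoint S T) {Y : Driving → β} {V : Driving → γ}
    (hY : Measurable[coordAlg S] Y) (hV : Measurable[coordAlg T] V) :
    IndepFun Y V drivingLaw := by
  rw [IndepFun_iff_Indep]
  exact indep_of_indep_of_le_right (indep_of_indep_of_le_left (indep_coordAlg h) hY.comap_le)
    hV.comap_le

lemma drivingLaw_lt (i : ℤ × ℕ) {a : ℝ} (h0 : 0 ≤ a) (h1 : a ≤ 1) :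
    drivingLaw {u | (u i : ℝ) < a} = ENNReal.ofReal a := by
  have := Measure.infinitePi_map_eval (fun _ : ℤ × ℕ => (volume : Measure unitInterval)) i
  have h2 : {u : Driving | (u i : ℝ) < a} =
      (fun u : Driving => u i) ⁻¹' (Set.Iio (⟨a, h0, h1⟩ : unitInterval)) := by
    ext u; simp [← Subtype.coe_lt_coe]
  rw [h2, ← Measure.map_apply (measurable_pi_apply i) measurableSet_Iio]
  unfold drivingLaw
  rw [this, unitInterval.volume_Iio]

lemma lintegral_indepFun {Ω β γ : Type*} [MeasurableSpace Ω] {μ : Measure Ω}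
    [IsProbabilityMeasure μ] [Countable β] [MeasurableSpace β] [MeasurableSingletonClass β]
    [MeasurableSpace γ] {Y : Ω → β} {V : Ω → γ} (hY : Measurable Y) (hV : Measurable V)
    (h : IndepFun Y V μ) {Φ : β → γ → ENNReal} (hΦ : ∀ b, Measurable (Φ b)) :
    ∫⁻ ω, Φ (Y ω) (V ω) ∂μ = ∫⁻ ω, ∫⁻ ω', Φ (Y ω) (V ω') ∂μ ∂μ := by
  have hm : Measurable (Function.uncurry Φ) := measurable_from_prod_countable_right hΦ
  have hmap := (indepFun_iff_map_prod_eq_prod_map_map hY.aemeasurable hV.aemeasurable).1 h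
  have := Measure.isProbabilityMeasure_map hV.aemeasurable (μ := μ)
  have := Measure.isProbabilityMeasure_map hY.aemeasurable (μ := μ)
  calc ∫⁻ ω, Φ (Y ω) (V ω) ∂μ
      = ∫⁻ z, Function.uncurry Φ z ∂(μ.map fun ω => (Y ω, V ω)) :=
        (lintegral_map hm (hY.prodMk hV)).symm
    _ = ∫⁻ y, ∫⁻ z, Φ y z ∂(μ.map V) ∂(μ.map Y) := by
        rw [hmap, lintegral_prod (f := Function.uncurry Φ) hm.aemeasurable]; rfl
    _ = _ := by
        rw [lintegral_map (f := fun y => ∫⁻ z, Φ y z ∂(μ.map V)) (measurable_of_countable _) hY]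
        exact lintegral_congr fun ω => lintegral_map (hΦ _) hV

/-! ### The number of opposite steps before the `m`-th step in a given direction -/

/-- The sequence of steps drawn at the site `k`. -/
noncomputable abbrev siteSteps (p : ℤ → ℝ) (u : Driving) (k : ℤ) : ℕ → ℤˣ :=
  siteStep p fun t => u (k, t)

section SiteLaw

variable {p : ℤ → ℝ}

lemma lintegral_siteDiff (hp : IsRestoring p) (k : ℤ) (t : ℕ) :
    ∀ f : ℤ → ℝ, (∀ d, 0 ≤ f d) →
      ∫⁻ u : Driving, ENNReal.ofReal (f (siteDiff p (fun t => u (k, t)) t)) ∂drivingLaw =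
        ENNReal.ofReal ((stepOp p)^[t] f 0) := by
  induction t with
  | zero => intro f _; simp [siteDiff]
  | succ t ih =>
    intro f hf
    have hK : ∀ d, 0 ≤ stepOp p f d := fun d => add_nonneg (mul_nonneg (hp.nonneg d) (hf _))
      (mul_nonneg (sub_nonneg.2 (hp.le_one d)) (hf _))
    rw [Function.iterate_succ_apply, ← ih _ hK]
    have hYc : Measurable[coordAlg {i | i.1 = k ∧ i.2 < t}]
        fun u : Driving => siteDiff p (fun t => u (k, t)) t :=
      @measurable_siteDiff Driving (coordAlg _) p (fun u t => u (k, t)) t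
        fun i hi => measurable_coord ⟨rfl, hi⟩
    have hVc : Measurable[coordAlg {(k, t)}] fun u : Driving => u (k, t) :=
      measurable_coord rfl
    have hind := indepFun_of_coordAlg (by
      rw [Set.disjoint_singleton_right]; rintro ⟨-, h⟩; exact lt_irrefl _ h) hYc hVc
    have hY := hYc.mono (coordAlg_le _) le_rfl
    have hV := hVc.mono (coordAlg_le _) le_rfl
    have hset : ∀ d : ℤ, MeasurableSet {a : unitInterval | (a : ℝ) < p d} := fun d =>
      measurableSet_lt measurable_subtype_coe measurable_const
    have hΦ : ∀ d : ℤ, Measurable fun a : unitInterval =>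
        ENNReal.ofReal (f (if (a : ℝ) < p d then d + 1 else d - 1)) := fun d =>
      ENNReal.measurable_ofReal.comp ((measurable_of_countable f).comp
        (Measurable.ite (hset d) measurable_const measurable_const))
    have := lintegral_indepFun hY hV hind hΦ
    simp only [siteDiff]
    rw [this]
    refine lintegral_congr fun u => ?_
    generalize siteDiff p (fun t => u (k, t)) t = d
    have hms : MeasurableSet {u : Driving | (u (k, t) : ℝ) < p d} := measurableSet_preimage hV (hset d)
    have h1 : ∀ u : Driving, ENNReal.ofReal (f (if (u (k, t) : ℝ) < p d then d + 1 else d - 1)) =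
        {u : Driving | (u (k, t) : ℝ) < p d}.indicator (fun _ => ENNReal.ofReal (f (d + 1))) u +
        {u : Driving | (u (k, t) : ℝ) < p d}ᶜ.indicator
          (fun _ => ENNReal.ofReal (f (d - 1))) u := by
      intro u
      by_cases h : (u (k, t) : ℝ) < p d <;> simp [Set.indicator, h]
    simp_rw [h1]
    rw [lintegral_add_left (measurable_const.indicator hms), lintegral_indicator_const hms,
      lintegral_indicator_const hms.compl, prob_compl_eq_one_sub hms,
      drivingLaw_lt _ (hp.nonneg d) (hp.le_one d), ← ENNReal.ofReal_one,
      ← ENNReal.ofReal_sub _ (hp.nonneg d), ← ENNReal.ofReal_mul (hf _),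
      ← ENNReal.ofReal_mul (hf _), ← ENNReal.ofReal_add
        (mul_nonneg (hf _) (hp.nonneg d)) (mul_nonneg (hf _) (sub_nonneg.2 (hp.le_one d)))]
    congr 1
    simp only [stepOp]
    ring

lemma measurable_siteDiff_driving (k : ℤ) (t : ℕ) :
    Measurable fun u : Driving => siteDiff p (fun t => u (k, t)) t :=
  measurable_siteDiff fun _ _ => measurable_pi_apply _

lemma measurable_siteSteps (k : ℤ) (t : ℕ) :
    Measurable fun u : Driving => siteSteps p u k t :=
  measurable_siteStep fun _ _ => measurable_pi_apply _

lemma measurable_oppositeBefore_siteSteps (k : ℤ) (σ : ℤˣ) (m : ℕ) :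
    Measurable fun u : Driving => oppositeBefore (siteSteps p u k) σ m :=
  measurable_oppositeBefore (fun _ => measurable_siteSteps _ _) _ _

/-- By symmetry, `σ d_t ≥ j` has half the probability of `|d_t| ≥ j`. -/
lemma drivingLaw_le_siteDiff (hp : IsRestoring p) (k : ℤ) (σ : ℤˣ) (t : ℕ) {j : ℕ} (hj : 1 ≤ j) :
    drivingLaw {u | (j : ℤ) ≤ σ * siteDiff p (fun t => u (k, t)) t} =
      ENNReal.ofReal (absTail p t j / 2) := by
  set f : ℤ → ℝ := fun d => if (j : ℤ) ≤ σ * d then 1 else 0 with hf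
  have h0 : ∀ d, 0 ≤ f d := fun d => by simp only [hf]; split_ifs <;> norm_num
  have h1 : (fun d => f d + f (-d)) = fun d => if (j : ℤ) ≤ |d| then (1 : ℝ) else 0 := by
    funext d
    simp only [hf]
    rcases Int.units_eq_one_or σ with rfl | rfl <;> rcases abs_cases d with ⟨h, h'⟩ | ⟨h, h'⟩ <;>
      rw [h] <;> simp only [Units.val_one, Units.val_neg, one_mul, neg_mul, neg_neg] <;>
      split_ifs <;> first | omega | norm_num
  have h2 := stepOp_iterate_add_reflect hp f t 0
  rw [h1, neg_zero] at h2
  have h3 : (stepOp p)^[t] f 0 = absTail p t j / 2 := by rw [absTail, h2]; ring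
  rw [← h3, ← lintegral_siteDiff hp k t f h0]
  have hms : MeasurableSet {u : Driving | (j : ℤ) ≤ σ * siteDiff p (fun t => u (k, t)) t} :=
    measurable_siteDiff_driving (p := p) k t
      (MeasurableSet.of_discrete (s := {d : ℤ | (j : ℤ) ≤ σ * d}))
  rw [← lintegral_indicator_one hms]
  refine lintegral_congr fun u => ?_
  by_cases h : (j : ℤ) ≤ σ * siteDiff p (fun t => u (k, t)) t <;> simp [Set.indicator, hf, h]

/-- `P(R > l)`, where `R` is the number of steps `-σ` before the `m`-th step `σ` at a site. -/
noncomputable def oppositeTail (p : ℤ → ℝ) (m l : ℕ) : ℝ :=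
  if l < m then 1 - absTail p (m + l) (m - l) / 2 else absTail p (m + l) (l - m + 2) / 2

lemma drivingLaw_signCount_lt (hp : IsRestoring p) (k : ℤ) (σ : ℤˣ) (m l : ℕ) :
    drivingLaw {u | signCount (siteSteps p u k) σ (m + l) < m} =
      ENNReal.ofReal (oppositeTail p m l) := by
  unfold oppositeTail
  split_ifs with h
  · have h1 : {u : Driving | signCount (siteSteps p u k) σ (m + l) < m} =
        {u : Driving | ((m - l : ℕ) : ℤ) ≤ σ * siteDiff p (fun t => u (k, t)) (m + l)}ᶜ := by
      ext u
      have := two_mul_signCount_siteStep p (fun t => u (k, t)) σ (m + l)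
      simp only [Set.mem_ofPred_eq, Set.mem_compl_iff, siteSteps]
      push_cast at this
      omega
    rw [h1, prob_compl_eq_one_sub, drivingLaw_le_siteDiff hp k σ (m + l) (by omega),
      ← ENNReal.ofReal_one, ← ENNReal.ofReal_sub]
    · exact div_nonneg (absTail_nonneg hp _ _) (by norm_num)
    · exact measurable_siteDiff_driving (p := p) k _
        (MeasurableSet.of_discrete (s := {d : ℤ | ((m - l : ℕ) : ℤ) ≤ σ * d}))
  · rw [← drivingLaw_le_siteDiff hp k (-σ) (m + l) (by omega)]
    congr 1
    ext u
    -- `d` has the parity of `m + l`, so `-σ d > l - m` improves to `-σ d ≥ l - m + 2`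
    have := two_mul_signCount_siteStep p (fun t => u (k, t)) σ (m + l)
    simp only [Set.mem_ofPred_eq, siteSteps, Units.val_neg, neg_mul]
    push_cast at this ⊢
    omega

lemma ae_isRecurrent (hp : IsRestoring p) :
    ∀ᵐ u ∂drivingLaw, ∀ k, IsRecurrent (siteSteps p u k) := by
  refine ae_all_iff.2 fun k => ?_
  have : ∀ᵐ u ∂drivingLaw, ∀ σ : ℤˣ, ∀ m, ∃ t, m ≤ signCount (siteSteps p u k) σ t := by
    refine ae_all_iff.2 fun σ => ae_all_iff.2 fun m => ?_
    rw [ae_iff]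
    obtain ⟨lam, hlam, C, hC, hb⟩ := exists_absTail_le hp
    have h1 : ∀ j : ℕ, drivingLaw {u | ¬ ∃ t, m ≤ signCount (siteSteps p u k) σ t} ≤
        ENNReal.ofReal (C * lam⁻¹ ^ (j + 2)) := by
      intro j
      calc _ ≤ drivingLaw {u | signCount (siteSteps p u k) σ (m + (m + j)) < m} := by
            refine measure_mono fun u hu => ?_
            simp only [Set.mem_ofPred_eq, not_exists, not_le] at hu
            exact hu _
        _ = _ := drivingLaw_signCount_lt hp k σ m (m + j)
        _ ≤ _ := by
            refine ENNReal.ofReal_le_ofReal ?_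
            unfold oppositeTail
            rw [if_neg (by omega), show m + j - m + 2 = j + 2 by omega]
            have h2 := hb (m + (m + j)) (j + 2)
            have h3 := absTail_nonneg hp (m + (m + j)) (j + 2)
            linarith
    have h2 : Tendsto (fun j : ℕ => ENNReal.ofReal (C * lam⁻¹ ^ (j + 2))) atTop (𝓝 0) := by
      have h3 := tendsto_pow_atTop_nhds_zero_of_lt_one (r := lam⁻¹) (by positivity)
        (inv_lt_one_of_one_lt₀ hlam)
      have h4 := ((tendsto_add_atTop_iff_nat 2).2 h3).const_mul C
      rw [mul_zero] at h4
      simpa using ENNReal.tendsto_ofReal h4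
    exact le_antisymm (ge_of_tendsto' h2 h1) zero_le
  exact this

lemma drivingLaw_lt_oppositeBefore (hp : IsRestoring p) (k : ℤ) (σ : ℤˣ) (m l : ℕ) :
    drivingLaw {u | l < oppositeBefore (siteSteps p u k) σ m} =
      ENNReal.ofReal (oppositeTail p m l) := by
  rw [← drivingLaw_signCount_lt hp k σ m l]
  refine measure_congr ?_
  filter_upwards [ae_isRecurrent hp] with u hu
  exact propext (lt_oppositeBefore_iff (hu k) σ m l)

lemma oppositeTail_nonneg (hp : IsRestoring p) (m l : ℕ) : 0 ≤ oppositeTail p m l := by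
  unfold oppositeTail
  split_ifs with h
  · have := drivingLaw_le_siteDiff hp 0 1 (m + l) (j := m - l) (by omega)
    have h1 : ENNReal.ofReal (absTail p (m + l) (m - l) / 2) ≤ ENNReal.ofReal 1 := by
      rw [← this, ENNReal.ofReal_one]; exact prob_le_one
    rw [ENNReal.ofReal_le_ofReal_iff zero_le_one] at h1
    linarith
  · exact div_nonneg (absTail_nonneg hp _ _) (by norm_num)

/-- Among the first `2 m - 1` steps at a site, the majority has sign `σ` with probability `1/2`, by
symmetry. -/
lemma drivingLaw_oppositeBefore_lt (hp : IsRestoring p) (k : ℤ) (σ : ℤˣ) {m : ℕ}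
    (hm : 1 ≤ m) :
    drivingLaw {u | oppositeBefore (siteSteps p u k) σ m < m} = ENNReal.ofReal (1 / 2) := by
  have h1 : {u : Driving | oppositeBefore (siteSteps p u k) σ m < m} =
      {u | m - 1 < oppositeBefore (siteSteps p u k) σ m}ᶜ := by
    ext u; simp only [Set.mem_ofPred_eq, Set.mem_compl_iff]; omega
  rw [h1, prob_compl_eq_one_sub, drivingLaw_lt_oppositeBefore hp, oppositeTail,
    if_pos (by omega), show m - (m - 1) = 1 by omega,
    absTail_one_of_odd ⟨m - 1, by omega⟩, ← ENNReal.ofReal_one, ← ENNReal.ofReal_sub _ (by norm_num)]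
  · norm_num
  · exact measurableSet_preimage (measurable_oppositeBefore_siteSteps k σ m)
      (MeasurableSet.of_discrete (s := Set.Ioi (m - 1)))

lemma lintegral_natCast {Ω : Type*} [MeasurableSpace Ω] (μ : Measure Ω) {N : Ω → ℕ}
    (hN : Measurable N) : ∫⁻ ω, (N ω : ENNReal) ∂μ = ∑' l, μ {ω | l < N ω} := by
  have h1 : ∀ ω, (N ω : ENNReal) = ∑' l, {ω | l < N ω}.indicator (1 : Ω → ENNReal) ω := by
    intro ω
    rw [tsum_eq_sum (s := Finset.range (N ω))]
    · rw [Finset.sum_congr rfl (g := fun _ => (1 : ENNReal))]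
      · simp
      · intro l hl
        simp at hl
        simp [Set.indicator, hl]
    · intro l hl
      simp at hl
      simp [Set.indicator, hl]
  have hms : ∀ l, MeasurableSet {ω | l < N ω} := fun l => hN measurableSet_Ioi
  simp_rw [h1]
  rw [lintegral_tsum fun l => (measurable_one.indicator (hms l)).aemeasurable]
  exact tsum_congr fun l => lintegral_indicator_one (hms l)

lemma hasSum_oppositeTail (hp : IsRestoring p) {m : ℕ} (hm : 1 ≤ m) :
    HasSum (oppositeTail p m) (m - 1 / 2 + meanExcess p m) := by
  obtain ⟨lam, hlam, C, hC, hb⟩ := exists_absTail_le hp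
  have hs0 : Summable fun j : ℕ => C * lam⁻¹ ^ (j + 2) := by
    refine Summable.mul_left _ ?_
    exact (summable_nat_add_iff 2).2
      (summable_geometric_of_lt_one (by positivity) (inv_lt_one_of_one_lt₀ hlam))
  have hs1 : Summable fun j : ℕ => absTail p (2 * m + j) (j + 2) :=
    Summable.of_nonneg_of_le (fun j => absTail_nonneg hp _ _) (fun j => hb _ _) hs0
  have hz : ∀ j ∉ Finset.range (m - 1), absTail p (2 * m - 2 - j) (j + 2) = 0 := by
    intro j hj
    simp at hj
    exact absTail_eq_zero (by omega)
  have h2 : HasSum (fun j : ℕ => absTail p (2 * m - 2 - j) (j + 2))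
      (∑ j ∈ Finset.range (m - 1), absTail p (2 * m - 2 - j) (j + 2)) :=
    hasSum_sum_of_ne_finset_zero hz
  have hexc : meanExcess p m = (∑' j, absTail p (2 * m + j) (j + 2)) / 2 -
      (∑ j ∈ Finset.range (m - 1), absTail p (2 * m - 2 - j) (j + 2)) / 2 := by
    rw [← sub_div, ← ((hs1.hasSum.sub h2).div_const 2).tsum_eq]
    rfl
  rw [← hasSum_nat_add_iff' m]
  have hsum : ∑ l ∈ Finset.range m, oppositeTail p m l =
      m - 1 / 2 - (∑ j ∈ Finset.range (m - 1), absTail p (2 * m - 2 - j) (j + 2)) / 2 := by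
    obtain ⟨n, rfl⟩ : ∃ n, m = n + 1 := ⟨m - 1, by omega⟩
    rw [← Finset.sum_range_reflect, Finset.sum_range_succ']
    have h3 : oppositeTail p (n + 1) (n + 1 - 1 - 0) = 1 / 2 := by
      rw [oppositeTail, if_pos (by omega), show n + 1 - (n + 1 - 1 - 0) = 1 by omega,
        absTail_one_of_odd ⟨n, by omega⟩]
      norm_num
    rw [h3, Finset.sum_congr rfl (g := fun j => 1 - absTail p (2 * (n + 1) - 2 - j) (j + 2) / 2)]
    · rw [Finset.sum_sub_distrib, ← Finset.sum_div]
      simp only [Finset.sum_const, Finset.card_range, nsmul_eq_mul, Nat.add_sub_cancel]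
      push_cast
      ring
    · intro j hj
      simp at hj
      rw [oppositeTail, if_pos (by omega)]
      congr 3 <;> omega
  rw [hsum, hexc]
  have hterm : (fun j => oppositeTail p m (j + m)) =
      fun j => absTail p (2 * m + j) (j + 2) / 2 := by
    funext j
    rw [oppositeTail, if_neg (by omega)]
    congr 2 <;> omega
  rw [hterm]
  rw [show ∀ a b c : ℝ, a + (b - c) - (a - c) = b from fun a b c => by ring]
  exact hs1.hasSum.div_const 2

/-- The mean number of steps `-σ` before the `m`-th step `σ`. -/
lemma lintegral_oppositeBefore (hp : IsRestoring p) (k : ℤ) (σ : ℤˣ) {m : ℕ} (hm : 1 ≤ m) :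
    ∫⁻ u, (oppositeBefore (siteSteps p u k) σ m : ENNReal) ∂drivingLaw =
      ENNReal.ofReal (m - 1 / 2 + meanExcess p m) := by
  have h := hasSum_oppositeTail hp hm
  rw [lintegral_natCast _ (measurable_oppositeBefore_siteSteps k σ m), ← h.tsum_eq,
    ENNReal.ofReal_tsum_of_nonneg (oppositeTail_nonneg hp m) h.summable]
  exact tsum_congr fun l => drivingLaw_lt_oppositeBefore hp k σ m l

lemma integrable_oppositeBefore (hp : IsRestoring p) (k : ℤ) (σ : ℤˣ) (m : ℕ) :
    Integrable (fun u => (oppositeBefore (siteSteps p u k) σ m : ℝ)) drivingLaw := by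
  rcases Nat.eq_zero_or_pos m with rfl | hm
  · simp [oppositeBefore_zero]
  · refine ⟨((measurable_of_countable _).comp
      (measurable_oppositeBefore_siteSteps k σ m)).aestronglyMeasurable, ?_⟩
    rw [hasFiniteIntegral_iff_ofReal (Eventually.of_forall fun u => by simp)]
    simp only [ENNReal.ofReal_natCast]
    rw [lintegral_oppositeBefore hp k σ hm]
    exact ENNReal.ofReal_lt_top

lemma integral_oppositeBefore (hp : IsRestoring p) (k : ℤ) (σ : ℤˣ) {m : ℕ} (hm : 1 ≤ m) :
    ∫ u, (oppositeBefore (siteSteps p u k) σ m : ℝ) ∂drivingLaw =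
      m - 1 / 2 + meanExcess p m := by
  rw [integral_eq_lintegral_of_nonneg_ae (Eventually.of_forall fun u => by simp)
    (integrable_oppositeBefore hp k σ m).1]
  simp only [ENNReal.ofReal_natCast]
  rw [lintegral_oppositeBefore hp k σ hm, ENNReal.toReal_ofReal]
  have := meanExcess_nonneg hp m
  have : (1 : ℝ) ≤ m := by exact_mod_cast hm
  linarith

end SiteLaw

/-! ### Exponential moments at a single site -/

section Moments

variable {p : ℤ → ℝ}

/-- The displacement has exponential tails, uniformly in the level `m`. -/
lemma exists_drivingLaw_le_abs (hp : IsRestoring p) :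
    ∃ lam > (1 : ℝ), ∃ C > (0 : ℝ), ∀ (k : ℤ) (σ : ℤˣ) (m j : ℕ),
      drivingLaw {u | (j : ℤ) ≤ |(oppositeBefore (siteSteps p u k) σ m : ℤ) - m|} ≤
        ENNReal.ofReal (C * lam⁻¹ ^ j) := by
  obtain ⟨lam, hlam, C, hC, hb⟩ := exists_absTail_le hp
  refine ⟨lam, hlam, max C 1, lt_max_of_lt_left hC, fun k σ m j => ?_⟩
  have hlam0 : 0 < lam := by linarith
  rcases Nat.eq_zero_or_pos j with rfl | hj
  · calc _ ≤ (1 : ENNReal) := prob_le_one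
      _ ≤ _ := by
        rw [← ENNReal.ofReal_one]
        exact ENNReal.ofReal_le_ofReal (by simp)
  · have hpow : lam⁻¹ ^ (j + 1) ≤ lam⁻¹ ^ j :=
      pow_le_pow_of_le_one (by positivity) (inv_le_one_of_one_le₀ hlam.le) (by omega)
    have hup : drivingLaw {u | m + j - 1 < oppositeBefore (siteSteps p u k) σ m} ≤
        ENNReal.ofReal (C * lam⁻¹ ^ j / 2) := by
      rw [drivingLaw_lt_oppositeBefore hp, oppositeTail, if_neg (by omega)]
      refine ENNReal.ofReal_le_ofReal ?_
      rw [show m + j - 1 - m + 2 = j + 1 by omega]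
      have := hb (m + (m + j - 1)) (j + 1)
      have := mul_le_mul_of_nonneg_left hpow hC.le
      linarith
    have hlow : drivingLaw {u | j ≤ m ∧ oppositeBefore (siteSteps p u k) σ m ≤ m - j} ≤
        ENNReal.ofReal (C * lam⁻¹ ^ j / 2) := by
      by_cases hjm : j ≤ m
      · have h1 : {u : Driving | j ≤ m ∧ oppositeBefore (siteSteps p u k) σ m ≤ m - j} =
            {u | m - j < oppositeBefore (siteSteps p u k) σ m}ᶜ := by
          ext u; simp only [Set.mem_ofPred_eq, Set.mem_compl_iff]; omega
        rw [h1, prob_compl_eq_one_sub, drivingLaw_lt_oppositeBefore hp, ← ENNReal.ofReal_one,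
          ← ENNReal.ofReal_sub _ (oppositeTail_nonneg hp _ _), oppositeTail, if_pos (by omega)]
        · refine ENNReal.ofReal_le_ofReal ?_
          rw [show m - (m - j) = j by omega]
          have := hb (m + (m - j)) j
          linarith
        · exact measurable_oppositeBefore_siteSteps (p := p) k σ m
            (MeasurableSet.of_discrete (s := Set.Ioi (m - j)))
      · simp [hjm]
    calc _ ≤ drivingLaw ({u | m + j - 1 < oppositeBefore (siteSteps p u k) σ m} ∪
          {u | j ≤ m ∧ oppositeBefore (siteSteps p u k) σ m ≤ m - j}) := by
          refine measure_mono fun u hu => ?_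
          simp only [Set.mem_ofPred_eq, Set.mem_union] at hu ⊢
          rcases le_abs.1 hu with h | h <;> omega
      _ ≤ _ := measure_union_le _ _
      _ ≤ _ := add_le_add hup hlow
      _ = ENNReal.ofReal (C * lam⁻¹ ^ j) := by
          rw [← ENNReal.ofReal_add (by positivity) (by positivity)]; congr 1; ring
      _ ≤ _ := ENNReal.ofReal_le_ofReal (by gcongr; exact le_max_left _ _)

lemma exists_lintegral_exp_abs_le (hp : IsRestoring p) :
    ∃ β > (0 : ℝ), ∃ C > (0 : ℝ), ∀ (k : ℤ) (σ : ℤˣ) (m : ℕ),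
      ∫⁻ u, ENNReal.ofReal (Real.exp
        (β * |(oppositeBefore (siteSteps p u k) σ m : ℝ) - m|)) ∂drivingLaw ≤
          ENNReal.ofReal C := by
  obtain ⟨lam, hlam, C, hC, hb⟩ := exists_drivingLaw_le_abs hp
  have hlam0 : 0 < lam := by linarith
  set β : ℝ := Real.log lam / 2 with hβ
  have hβ0 : 0 < β := by have := Real.log_pos hlam; positivity
  set r : ℝ := Real.exp (-β) with hr
  have hr1 : r < 1 := by rw [hr]; exact Real.exp_lt_one_iff.2 (by linarith)
  have hr0 : 0 < r := Real.exp_pos _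
  have hmulr : ∀ j : ℕ, Real.exp (β * j) * (C * lam⁻¹ ^ j) = C * r ^ j := by
    intro j
    have h1 : lam⁻¹ = r * r := by
      rw [hr, ← Real.exp_add, show -β + -β = -Real.log lam by rw [hβ]; ring, Real.exp_neg,
        Real.exp_log hlam0]
    have h2 : Real.exp (β * j) = (r ^ j)⁻¹ := by
      rw [hr, ← Real.exp_nat_mul, ← Real.exp_neg]; congr 1; ring
    rw [h1, h2, mul_pow]
    field_simp
  refine ⟨β, hβ0, C * (1 - r)⁻¹, mul_pos hC (inv_pos.2 (by linarith)), fun k σ m => ?_⟩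
  set η : Driving → ℤ := fun u => (oppositeBefore (siteSteps p u k) σ m : ℤ) - m with hη
  have hηm : Measurable η := by
    have := measurable_oppositeBefore_siteSteps (p := p) k σ m
    exact (measurable_of_countable (fun n : ℕ => (n : ℤ) - m)).comp this
  have hms : ∀ j : ℕ, MeasurableSet {u | (j : ℤ) ≤ |η u|} := fun j =>
    hηm (MeasurableSet.of_discrete (s := {d : ℤ | (j : ℤ) ≤ |d|}))
  calc _ ≤ ∫⁻ u, ∑' j : ℕ, {u | (j : ℤ) ≤ |η u|}.indicator
        (fun _ => ENNReal.ofReal (Real.exp (β * j))) u ∂drivingLaw := by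
        refine lintegral_mono fun u => ?_
        refine le_trans ?_ (ENNReal.le_tsum (η u).natAbs)
        have h1 : |(oppositeBefore (siteSteps p u k) σ m : ℝ) - m| = ((η u).natAbs : ℝ) := by
          rw [Nat.cast_natAbs, hη]; push_cast; rfl
        rw [Set.indicator_of_mem (by simp), h1]
    _ = ∑' j : ℕ, ENNReal.ofReal (Real.exp (β * j)) * drivingLaw {u | (j : ℤ) ≤ |η u|} := by
        rw [lintegral_tsum fun j => (measurable_const.indicator (hms j)).aemeasurable]
        exact tsum_congr fun j => lintegral_indicator_const (hms j) _
    _ ≤ ∑' j : ℕ, ENNReal.ofReal (C * r ^ j) := by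
        refine ENNReal.tsum_le_tsum fun j => ?_
        rw [← hmulr, ENNReal.ofReal_mul (Real.exp_pos _).le]
        gcongr
        exact hb k σ m j
    _ = _ := by
        rw [← ENNReal.ofReal_tsum_of_nonneg (fun j => by positivity)
          ((summable_geometric_of_lt_one hr0.le hr1).mul_left C), tsum_mul_left,
          tsum_geometric_of_lt_one hr0.le hr1]

lemma exp_le_one_add_add_sq (x : ℝ) : Real.exp x ≤ 1 + x + x ^ 2 * Real.exp |x| := by
  rcases le_or_gt (-1) x with h | h
  · have h1 := Real.add_one_le_exp (-x)
    have h2 : Real.exp x * Real.exp (-x) = 1 := by rw [← Real.exp_add]; simp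
    have h3 : Real.exp x ≤ Real.exp |x| := Real.exp_le_exp.2 (le_abs_self x)
    have h4 := Real.exp_pos x
    have h5 : Real.exp x * (1 - x ^ 2) ≤ 1 + x := by
      have h6 : (1 + x) * (Real.exp x * (1 - x)) ≤ (1 + x) * 1 := by
        refine mul_le_mul_of_nonneg_left ?_ (by linarith)
        nlinarith
      nlinarith
    nlinarith [sq_nonneg x]
  · have h1 : Real.exp x ≤ 1 := Real.exp_le_one_iff.2 (by linarith)
    have h2 : 1 ≤ Real.exp |x| := Real.one_le_exp (abs_nonneg x)
    nlinarith [sq_nonneg x]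

/-- The exponential moments of the centred count expand to second order, uniformly. -/
lemma exists_lintegral_exp_le (hp : IsRestoring p) :
    ∃ β > (0 : ℝ), ∃ C > (0 : ℝ), ∀ (k : ℤ) (σ : ℤˣ) (m : ℕ) (θ : ℝ), |θ| ≤ β →
      ∫⁻ u, ENNReal.ofReal (Real.exp
        (θ * ((oppositeBefore (siteSteps p u k) σ m : ℝ) - m))) ∂drivingLaw ≤
          ENNReal.ofReal (1 + θ * ((∫ u, (oppositeBefore (siteSteps p u k) σ m : ℝ) ∂drivingLaw) - m)
            + C * θ ^ 2) := by
  obtain ⟨b, hb, C, hC, hint⟩ := exists_lintegral_exp_abs_le hp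
  refine ⟨b / 2, by positivity, 8 / b ^ 2 * C, by positivity, fun k σ m θ hθ => ?_⟩
  set N : Driving → ℝ := fun u => (oppositeBefore (siteSteps p u k) σ m : ℝ) with hN
  have hNi : Integrable N drivingLaw := integrable_oppositeBefore hp k σ m
  have hE0 : ∀ u, 0 ≤ Real.exp (b * |N u - m|) := fun u => (Real.exp_pos _).le
  have hEm : Measurable fun u => Real.exp (b * |N u - m|) :=
    (measurable_of_countable fun n : ℕ => Real.exp (b * |(n : ℝ) - m|)).comp
      (measurable_oppositeBefore_siteSteps (p := p) k σ m)
  have hEi : Integrable (fun u => Real.exp (b * |N u - m|)) drivingLaw := by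
    refine ⟨hEm.aestronglyMeasurable, ?_⟩
    rw [hasFiniteIntegral_iff_ofReal (Eventually.of_forall hE0)]
    exact (hint k σ m).trans_lt ENNReal.ofReal_lt_top
  have hEle : ∫ u, Real.exp (b * |N u - m|) ∂drivingLaw ≤ C := by
    rw [integral_eq_lintegral_of_nonneg_ae (Eventually.of_forall hE0) hEi.1]
    exact ENNReal.toReal_le_of_le_ofReal hC.le (hint k σ m)
  have hpt : ∀ y : ℝ, Real.exp (θ * y) ≤
      1 + θ * y + 8 / b ^ 2 * θ ^ 2 * Real.exp (b * |y|) := by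
    intro y
    refine (exp_le_one_add_add_sq (θ * y)).trans ?_
    have h1 : Real.exp |θ * y| ≤ Real.exp (b / 2 * |y|) := by
      rw [abs_mul]; exact Real.exp_le_exp.2 (mul_le_mul_of_nonneg_right hθ (abs_nonneg y))
    have h2 : y ^ 2 ≤ 8 / b ^ 2 * Real.exp (b / 2 * |y|) := by
      have h3 := Real.quadratic_le_exp_of_nonneg (x := b / 2 * |y|) (by positivity)
      have h5 : 0 ≤ b / 2 * |y| := by positivity
      have h4 : (b / 2 * |y|) ^ 2 / 2 ≤ Real.exp (b / 2 * |y|) := by linarith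
      rw [mul_pow, sq_abs] at h4
      rw [div_mul_eq_mul_div, le_div_iff₀ (by positivity)]
      nlinarith
    have h3 : Real.exp (b * |y|) = Real.exp (b / 2 * |y|) * Real.exp (b / 2 * |y|) := by
      rw [← Real.exp_add]; congr 1; ring
    have h4 : (θ * y) ^ 2 * Real.exp |θ * y| ≤
        θ ^ 2 * (8 / b ^ 2 * Real.exp (b / 2 * |y|)) * Real.exp (b / 2 * |y|) := by
      rw [mul_pow]; gcongr
    rw [h3]
    linarith
  have hsi : Integrable (fun u => θ * (N u - m)) drivingLaw :=
    (hNi.sub (integrable_const _)).const_mul θ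
  have hti : Integrable (fun u => 1 + θ * (N u - m)) drivingLaw := (integrable_const 1).add hsi
  have hgi : Integrable (fun u => 1 + θ * (N u - m) + 8 / b ^ 2 * θ ^ 2 *
      Real.exp (b * |N u - m|)) drivingLaw :=
    hti.add (hEi.const_mul _)
  calc _ ≤ ∫⁻ u, ENNReal.ofReal (1 + θ * (N u - m) + 8 / b ^ 2 * θ ^ 2 *
        Real.exp (b * |N u - m|)) ∂drivingLaw :=
        lintegral_mono fun u => ENNReal.ofReal_le_ofReal (hpt _)
    _ = ENNReal.ofReal (∫ u, 1 + θ * (N u - m) + 8 / b ^ 2 * θ ^ 2 *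
        Real.exp (b * |N u - m|) ∂drivingLaw) :=
        (ofReal_integral_eq_lintegral_ofReal hgi
          (Eventually.of_forall fun u => (Real.exp_pos _).le.trans (hpt _))).symm
    _ ≤ _ := by
        refine ENNReal.ofReal_le_ofReal ?_
        rw [integral_add hti (hEi.const_mul _), integral_add (integrable_const 1) hsi,
          integral_const_mul, integral_const_mul,
          integral_sub hNi (integrable_const _)]
        simp only [integral_const, probReal_univ, smul_eq_mul, one_mul]
        have : 8 / b ^ 2 * θ ^ 2 * ∫ u, Real.exp (b * |N u - m|) ∂drivingLaw ≤
            8 / b ^ 2 * θ ^ 2 * C := by gcongr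
        linarith

/-- Downward deviations: the displacement has mean at least `-1/2`. -/
lemma exists_lintegral_exp_neg_le (hp : IsRestoring p) {δ : ℝ} (hδ : 0 < δ) :
    ∃ θ > (0 : ℝ), ∀ (k : ℤ) (σ : ℤˣ) (m : ℕ),
      ∫⁻ u, ENNReal.ofReal (Real.exp
        (-θ * (oppositeBefore (siteSteps p u k) σ m : ℝ))) ∂drivingLaw ≤
          ENNReal.ofReal (Real.exp (-θ * (m - 1 / 2 - δ))) := by
  obtain ⟨β, hβ, C, hC, h⟩ := exists_lintegral_exp_le hp
  set θ := min β (δ / C) with hθ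
  have hθ0 : 0 < θ := lt_min hβ (by positivity)
  have hθC : C * θ ≤ δ := by
    have := min_le_right β (δ / C)
    rw [← hθ, le_div_iff₀ hC] at this
    linarith
  refine ⟨θ, hθ0, fun k σ m => ?_⟩
  have hmean : (m : ℝ) - 1 / 2 ≤ ∫ u, (oppositeBefore (siteSteps p u k) σ m : ℝ) ∂drivingLaw := by
    rcases Nat.eq_zero_or_pos m with rfl | hm
    · simp [oppositeBefore_zero]
    · rw [integral_oppositeBefore hp k σ hm]
      have := meanExcess_nonneg hp m
      linarith
  have h1 := h k σ m (-θ) (by rw [abs_neg, abs_of_pos hθ0]; exact min_le_left _ _)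
  set E := ∫ u, (oppositeBefore (siteSteps p u k) σ m : ℝ) ∂drivingLaw
  have h2 : ∀ u : Driving, ENNReal.ofReal (Real.exp
        (-θ * (oppositeBefore (siteSteps p u k) σ m : ℝ))) =
      ENNReal.ofReal (Real.exp (-θ * m)) * ENNReal.ofReal (Real.exp
        (-θ * ((oppositeBefore (siteSteps p u k) σ m : ℝ) - m))) := by
    intro u
    rw [← ENNReal.ofReal_mul (Real.exp_pos _).le, ← Real.exp_add]
    congr 2; ring
  simp_rw [h2]
  rw [lintegral_const_mul' _ _ ENNReal.ofReal_ne_top]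
  refine (mul_le_mul_right h1 _).trans ?_
  rw [← ENNReal.ofReal_mul (Real.exp_pos _).le]
  refine ENNReal.ofReal_le_ofReal ?_
  have h3 : 1 + -θ * (E - m) + C * (-θ) ^ 2 ≤ Real.exp (θ * (1 / 2 + δ)) := by
    have := Real.add_one_le_exp (θ * (1 / 2 + δ))
    nlinarith
  calc _ ≤ Real.exp (-θ * m) * Real.exp (θ * (1 / 2 + δ)) := by gcongr
    _ = _ := by rw [← Real.exp_add]; congr 1; ring

/-- Upward deviations: from high levels the displacement has mean close to `-1/2`; from low levels
it is bounded in exponential moment. -/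
lemma exists_lintegral_exp_pos_le (hp : IsRestoring p) {δ : ℝ} (hδ : 0 < δ) :
    ∃ θ > (0 : ℝ), ∃ B ≥ (0 : ℝ), ∀ (k : ℤ) (σ : ℤˣ) (m : ℕ),
      ∫⁻ u, ENNReal.ofReal (Real.exp
        (θ * (oppositeBefore (siteSteps p u k) σ m : ℝ))) ∂drivingLaw ≤
          ENNReal.ofReal (Real.exp (θ * (m - 1 / 2 + δ)) + B) := by
  obtain ⟨β, hβ, C, hC, h⟩ := exists_lintegral_exp_le hp
  obtain ⟨b, hb, C', hC', h'⟩ := exists_lintegral_exp_abs_le hp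
  obtain ⟨m₀, hm₀⟩ := eventually_atTop.1
    ((tendsto_meanExcess hp).eventually (ge_mem_nhds (half_pos hδ)))
  set θ := min (min β b) (δ / 2 / C) with hθ
  have hθ0 : 0 < θ := lt_min (lt_min hβ hb) (by positivity)
  have hθC : C * θ ≤ δ / 2 := by
    have := min_le_right (min β b) (δ / 2 / C)
    rw [← hθ, le_div_iff₀ hC] at this
    linarith
  have hθβ : θ ≤ β := (min_le_left _ _).trans (min_le_left _ _)
  have hθb : θ ≤ b := (min_le_left _ _).trans (min_le_right _ _)
  refine ⟨θ, hθ0, Real.exp (θ * m₀) * C', by positivity, fun k σ m => ?_⟩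
  have h2 : ∀ u : Driving, ENNReal.ofReal (Real.exp
        (θ * (oppositeBefore (siteSteps p u k) σ m : ℝ))) =
      ENNReal.ofReal (Real.exp (θ * m)) * ENNReal.ofReal (Real.exp
        (θ * ((oppositeBefore (siteSteps p u k) σ m : ℝ) - m))) := by
    intro u
    rw [← ENNReal.ofReal_mul (Real.exp_pos _).le, ← Real.exp_add]
    congr 2; ring
  simp_rw [h2]
  rw [lintegral_const_mul' _ _ ENNReal.ofReal_ne_top]
  rcases lt_or_ge m (m₀ + 1) with hm | hm
  · have h1 : ∫⁻ u, ENNReal.ofReal (Real.exp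
        (θ * ((oppositeBefore (siteSteps p u k) σ m : ℝ) - m))) ∂drivingLaw ≤
        ENNReal.ofReal C' := by
      refine le_trans (lintegral_mono fun u => ENNReal.ofReal_le_ofReal ?_) (h' k σ m)
      refine Real.exp_le_exp.2 ?_
      calc _ ≤ θ * |(oppositeBefore (siteSteps p u k) σ m : ℝ) - m| := by
            gcongr; exact le_abs_self _
        _ ≤ _ := by gcongr
    refine (mul_le_mul_right h1 _).trans ?_
    rw [← ENNReal.ofReal_mul (Real.exp_pos _).le]
    refine ENNReal.ofReal_le_ofReal ?_
    have h3 : Real.exp (θ * m) ≤ Real.exp (θ * m₀) := by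
      have : (m : ℝ) ≤ m₀ := by exact_mod_cast Nat.lt_succ_iff.1 hm
      gcongr
    have h4 := Real.exp_pos (θ * (m - 1 / 2 + δ))
    have h5 := mul_le_mul_of_nonneg_right h3 hC'.le
    linarith
  · have h1 := h k σ m θ (by rw [abs_of_pos hθ0]; exact hθβ)
    rw [integral_oppositeBefore hp k σ (by omega)] at h1
    refine (mul_le_mul_right h1 _).trans ?_
    rw [← ENNReal.ofReal_mul (Real.exp_pos _).le]
    refine ENNReal.ofReal_le_ofReal ?_
    have h3 : 1 + θ * ((m : ℝ) - 1 / 2 + meanExcess p m - m) + C * θ ^ 2 ≤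
        Real.exp (θ * (-1 / 2 + δ)) := by
      have h4 := Real.add_one_le_exp (θ * (-1 / 2 + δ))
      have h5 := hm₀ m (by omega)
      nlinarith
    have h6 : Real.exp (θ * m) * Real.exp (θ * (-1 / 2 + δ)) =
        Real.exp (θ * (m - 1 / 2 + δ)) := by
      rw [← Real.exp_add]; congr 1; ring
    have h7 := mul_le_mul_of_nonneg_left h3 (Real.exp_pos (θ * m)).le
    have h8 : 0 ≤ Real.exp (θ * m₀) * C' := by positivity
    linarith

/-- A Lyapunov function for extinction: `4 z` decreases at high levels, and the bounded concave
correction makes up for low levels, where the chain moves down with probability `1/2`. -/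
noncomputable def extinctionPotential (D : ℝ) (z : ℕ) : ℝ := 4 * z + D * (1 - (4⁻¹ : ℝ) ^ z)

lemma extinctionPotential_nonneg {D : ℝ} (hD : 0 ≤ D) (z : ℕ) : 0 ≤ extinctionPotential D z := by
  have : (4⁻¹ : ℝ) ^ z ≤ 1 := pow_le_one₀ (by norm_num) (by norm_num)
  exact add_nonneg (by positivity) (mul_nonneg hD (by linarith))

lemma extinctionPotential_le {D : ℝ} (hD : 0 ≤ D) (z : ℕ) :
    extinctionPotential D z ≤ (4 + D) * z := by
  have h1 : 1 - (4⁻¹ : ℝ) ^ z ≤ z := by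
    rcases Nat.eq_zero_or_pos z with rfl | hz
    · simp
    · have : (1 : ℝ) ≤ z := by exact_mod_cast hz
      have : (0 : ℝ) < 4⁻¹ ^ z := by positivity
      linarith
  have := mul_le_mul_of_nonneg_left h1 hD
  unfold extinctionPotential
  linarith

/-- Below the level `m₀` the mean displacement may be positive, but `4⁻¹ ^ z` grows in mean by a
factor `2` at least, as the chain moves down with probability `1/2`. -/
lemma exists_extinctionPotential (hp : IsRestoring p) :
    ∃ D ≥ (0 : ℝ), ∀ (k : ℤ) (σ : ℤˣ) (m : ℕ), 1 ≤ m →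
      ∫⁻ u, ENNReal.ofReal (extinctionPotential D
        (oppositeBefore (siteSteps p u k) σ m)) ∂drivingLaw + 1 ≤
          ENNReal.ofReal (extinctionPotential D m) := by
  obtain ⟨m₀, hm₀⟩ := eventually_atTop.1
    ((tendsto_meanExcess hp).eventually (ge_mem_nhds (show (0 : ℝ) < 1 / 4 by norm_num)))
  obtain ⟨K, hK⟩ := (tendsto_meanExcess hp).bddAbove_range
  have hK' : ∀ m, meanExcess p m ≤ K := fun m => hK ⟨m, rfl⟩
  have hK0 : 0 ≤ K := (meanExcess_nonneg hp 0).trans (hK' 0)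
  -- `K` bounds the excess of the mean; `D` compensates for it at the levels below `m₀`
  set D : ℝ := 4 * K * 4 ^ m₀ with hD
  have hD0 : 0 ≤ D := by positivity
  refine ⟨D, hD0, fun k σ m hm => ?_⟩
  set N : Driving → ℕ := fun u => oppositeBefore (siteSteps p u k) σ m with hN
  have hNm : Measurable N := measurable_oppositeBefore_siteSteps (p := p) k σ m
  have hNi : Integrable (fun u => (N u : ℝ)) drivingLaw := integrable_oppositeBefore hp k σ m
  have hpm : Measurable fun u => (4⁻¹ : ℝ) ^ N u :=
    (measurable_of_countable fun n : ℕ => (4⁻¹ : ℝ) ^ n).comp hNm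
  have hp1 : ∀ n : ℕ, (4⁻¹ : ℝ) ^ n ≤ 1 := fun n => pow_le_one₀ (by norm_num) (by norm_num)
  have hpi : Integrable (fun u => (4⁻¹ : ℝ) ^ N u) drivingLaw := by
    refine Integrable.of_bound hpm.aestronglyMeasurable 1 (Eventually.of_forall fun u => ?_)
    rw [Real.norm_of_nonneg (by positivity)]
    exact hp1 _
  have hqi : Integrable (fun u => D * (1 - (4⁻¹ : ℝ) ^ N u)) drivingLaw :=
    ((integrable_const 1).sub hpi).const_mul D
  have hφi : Integrable (fun u => extinctionPotential D (N u)) drivingLaw :=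
    (hNi.const_mul 4).add hqi
  have hlow : 2 * (4⁻¹ : ℝ) ^ m ≤ ∫ u, (4⁻¹ : ℝ) ^ N u ∂drivingLaw := by
    have hms : MeasurableSet {u | N u < m} := hNm (MeasurableSet.of_discrete (s := Set.Iio m))
    have h1 : ∫ u, {u | N u < m}.indicator (fun _ => (4⁻¹ : ℝ) ^ (m - 1)) u ∂drivingLaw =
        2 * (4⁻¹ : ℝ) ^ m := by
      rw [integral_indicator_const _ hms, Measure.real,
        drivingLaw_oppositeBefore_lt hp k σ hm, ENNReal.toReal_ofReal (by norm_num)]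
      obtain ⟨n, rfl⟩ : ∃ n, m = n + 1 := ⟨m - 1, by omega⟩
      simp only [smul_eq_mul, Nat.add_sub_cancel, pow_succ]
      ring
    rw [← h1]
    refine integral_mono ((integrable_const _).indicator hms) hpi fun u => ?_
    by_cases hu : N u < m
    · rw [Set.indicator_of_mem (show u ∈ {u | N u < m} from hu)]
      exact pow_le_pow_of_le_one (by norm_num) (by norm_num) (by omega)
    · rw [Set.indicator_of_notMem (show u ∉ {u | N u < m} from hu)]
      positivity
  have hint : ∫ u, extinctionPotential D (N u) ∂drivingLaw =
      4 * (m - 1 / 2 + meanExcess p m) + D * (1 - ∫ u, (4⁻¹ : ℝ) ^ N u ∂drivingLaw) := by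
    unfold extinctionPotential
    rw [integral_add (hNi.const_mul 4) hqi,
      integral_const_mul, integral_const_mul, integral_sub (integrable_const 1) hpi,
      integral_oppositeBefore hp k σ hm]
    simp
  rw [← ofReal_integral_eq_lintegral_ofReal hφi
    (Eventually.of_forall fun u => extinctionPotential_nonneg hD0 _), ← ENNReal.ofReal_one,
    ← ENNReal.ofReal_add (integral_nonneg fun u => extinctionPotential_nonneg hD0 _) zero_le_one]
  refine ENNReal.ofReal_le_ofReal ?_
  rw [hint, extinctionPotential]
  have h1 := mul_le_mul_of_nonneg_left hlow hD0
  have hpos : (0 : ℝ) < 4⁻¹ ^ m := by positivity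
  rcases lt_or_ge m m₀ with h | h
  · have h2 : 4 * K ≤ D * (4⁻¹ : ℝ) ^ m := by
      have h3 : (1 : ℝ) ≤ 4 ^ m₀ * 4⁻¹ ^ m := by
        rw [inv_pow, ← div_eq_mul_inv, one_le_div (by positivity)]
        exact pow_le_pow_right₀ (by norm_num) h.le
      rw [hD, mul_assoc]
      exact le_mul_of_one_le_right (by positivity) h3
    have := hK' m
    linarith
  · have h2 := hm₀ m h
    have h3 : 0 ≤ D * (4⁻¹ : ℝ) ^ m := by positivity
    linarith

end Moments

/-! ### The chain of edge local times -/

/-- The Markov chain along the sites `k₀, k₀ + σ, k₀ + 2σ, …` which, at the site `k`, turns `z` into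
the number of steps `σ` before the `z`-th step `-σ`, plus one when the site lies strictly on the
side `-σ` of the origin. It describes the local times to one side of the walker. -/
noncomputable def edgeChain (ζ : ℤ → ℕ → ℤˣ) (σ : ℤˣ) (k₀ : ℤ) (z₀ : ℕ) : ℕ → ℕ
  | 0 => z₀
  | i + 1 => oppositeBefore (ζ (k₀ + σ * i)) (-σ) (edgeChain ζ σ k₀ z₀ i) +
      if σ * k₀ + i < 0 then 1 else 0

/-- The number of sites at which `edgeChain` receives an extra unit. -/
def immigrationTime (σ : ℤˣ) (k₀ : ℤ) : ℕ := (-(σ * k₀)).toNat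

lemma lt_immigrationTime_iff (σ : ℤˣ) (k₀ : ℤ) (i : ℕ) :
    i < immigrationTime σ k₀ ↔ σ * k₀ + i < 0 := by
  unfold immigrationTime; omega

/-- The deterministic profile that `edgeChain` follows: slope `1/2` while there is immigration,
slope `-1/2` afterwards, until it reaches `0`. -/
noncomputable def chainProfile (z₀ N i : ℕ) : ℝ := max (z₀ + min (i : ℝ) N - i / 2) 0

lemma measurable_comp_countable {Ω ι β : Type*} [MeasurableSpace Ω] [MeasurableSpace β]
    [Countable ι] [MeasurableSpace ι] [MeasurableSingletonClass ι] {Y : Ω → ι} {f : ι → Ω → β}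
    (hY : Measurable Y) (hf : ∀ n, Measurable (f n)) : Measurable fun ω => f (Y ω) ω :=
  (measurable_from_prod_countable_right (f := fun z : ι × Ω => f z.1 z.2) hf).comp
    (hY.prodMk measurable_id)

lemma measurable_edgeChain {Ω : Type*} [MeasurableSpace Ω] {ζ : Ω → ℤ → ℕ → ℤˣ} {σ : ℤˣ}
    {k₀ : ℤ} {z₀ : ℕ} {i : ℕ}
    (h : ∀ j < i, ∀ t, Measurable fun ω => ζ ω (k₀ + σ * (j : ℕ)) t) :
    Measurable fun ω => edgeChain (ζ ω) σ k₀ z₀ i := by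
  induction i with
  | zero => exact measurable_const
  | succ i ih =>
    simp only [edgeChain]
    refine Measurable.add_const ?_ _
    exact measurable_comp_countable (ih fun j hj => h j (by omega))
      (f := fun n ω => oppositeBefore (ζ ω (k₀ + σ * i)) (-σ) n)
      fun n => measurable_oppositeBefore (h i (by omega)) _ _

section Chain

variable {p : ℤ → ℝ}

lemma measurable_edgeChain_siteSteps (σ : ℤˣ) (k₀ : ℤ) (z₀ i : ℕ) :
    Measurable fun u => edgeChain (siteSteps p u) σ k₀ z₀ i :=
  measurable_edgeChain fun _ _ _ => measurable_siteSteps _ _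

/-- The Markov property of `edgeChain`: fresh driving variables are used at every site. -/
lemma lintegral_edgeChain_succ (σ : ℤˣ) (k₀ : ℤ) (z₀ i : ℕ) (φ : ℕ → ENNReal) :
    ∫⁻ u, φ (edgeChain (siteSteps p u) σ k₀ z₀ (i + 1)) ∂drivingLaw =
      ∫⁻ u, ∫⁻ u', φ (oppositeBefore (siteSteps p u' (k₀ + σ * i)) (-σ)
        (edgeChain (siteSteps p u) σ k₀ z₀ i) + if σ * k₀ + i < 0 then 1 else 0)
          ∂drivingLaw ∂drivingLaw := by
  set S : Set (ℤ × ℕ) := {x | ∃ j < i, x.1 = k₀ + σ * (j : ℕ)} with hS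
  set T : Set (ℤ × ℕ) := {x | x.1 = k₀ + σ * i} with hT
  have hdisj : Disjoint S T := by
    rw [Set.disjoint_left]
    rintro x ⟨j, hj, hx⟩ hx'
    have hx'' : x.1 = k₀ + σ * i := hx'
    rw [hx] at hx''
    have := mul_left_cancel₀ (by simp : (σ : ℤ) ≠ 0) (add_left_cancel hx'')
    omega
  have hYc : Measurable[coordAlg S] fun u : Driving => edgeChain (siteSteps p u) σ k₀ z₀ i :=
    @measurable_edgeChain Driving (coordAlg S) (fun u => siteSteps p u) σ k₀ z₀ i
      fun j hj t => @measurable_siteStep Driving (coordAlg S) p _ t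
        fun t' _ => measurable_coord ⟨j, hj, rfl⟩
  have hVc : Measurable[coordAlg T] fun (u : Driving) (t : ℕ) => u (k₀ + σ * i, t) :=
    @measurable_pi_lambda _ _ _ (coordAlg T) _ _ fun t => measurable_coord rfl
  exact lintegral_indepFun (hYc.mono (coordAlg_le _) le_rfl) (hVc.mono (coordAlg_le _) le_rfl)
    (indepFun_of_coordAlg hdisj hYc hVc)
    (Φ := fun n v => φ (oppositeBefore (siteStep p v) (-σ) n + if σ * k₀ + i < 0 then 1 else 0))
    fun n => (measurable_of_countable fun r => φ (r + if σ * k₀ + i < 0 then 1 else 0)).comp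
      (measurable_oppositeBefore (ζ := fun v => siteStep p v)
        (fun t => measurable_siteStep fun _ _ => measurable_pi_apply _) (-σ) n)

/-- Upper exponential bound for the chain around its profile. -/
lemma exists_lintegral_exp_edgeChain_le (hp : IsRestoring p) {δ : ℝ} (hδ : 0 < δ) :
    ∃ θ > (0 : ℝ), ∃ B ≥ (0 : ℝ), ∀ (σ : ℤˣ) (k₀ : ℤ) (z₀ i : ℕ),
      ∫⁻ u, ENNReal.ofReal (Real.exp (θ * edgeChain (siteSteps p u) σ k₀ z₀ i)) ∂drivingLaw ≤
        ENNReal.ofReal ((1 + i * B) * Real.exp (θ *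
          (chainProfile z₀ (immigrationTime σ k₀) i + δ * i + 1))) := by
  obtain ⟨θ, hθ, B, hB, h⟩ := exists_lintegral_exp_pos_le hp hδ
  refine ⟨θ, hθ, B, hB, fun σ k₀ z₀ i => ?_⟩
  set N := immigrationTime σ k₀ with hN
  induction i with
  | zero =>
    simp only [edgeChain, lintegral_const, measure_univ, mul_one]
    refine ENNReal.ofReal_le_ofReal ?_
    simp only [chainProfile, Nat.cast_zero, zero_mul, add_zero, one_mul, mul_zero, zero_div,
      sub_zero]
    refine Real.exp_le_exp.2 (mul_le_mul_of_nonneg_left ?_ hθ.le)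
    rw [min_eq_left (by positivity)]
    have := le_max_left ((z₀ : ℝ) + 0) 0
    linarith
  | succ i ih =>
    rw [lintegral_edgeChain_succ σ k₀ z₀ i
      (fun n => ENNReal.ofReal (Real.exp (θ * (n : ℝ))))]
    set ε : ℝ := if i < N then 1 else 0 with hε
    have hε' : (((if σ * k₀ + i < 0 then 1 else 0 : ℕ)) : ℝ) = ε := by
      rw [hε, hN]
      by_cases hi : σ * k₀ + i < 0
      · rw [if_pos hi, if_pos ((lt_immigrationTime_iff _ _ _).2 hi)]; simp
      · rw [if_neg hi, if_neg (mt (lt_immigrationTime_iff _ _ _).1 hi)]; simp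
    have hε1 : ε ≤ 1 := by rw [hε]; split_ifs <;> norm_num
    set a : ℝ := Real.exp (θ * (ε - 1 / 2 + δ)) with ha
    set b : ℝ := Real.exp (θ * ε) * B with hb
    have hb0 : 0 ≤ b := by positivity
    have hinner : ∀ u : Driving, ∫⁻ u', ENNReal.ofReal (Real.exp (θ *
        ((oppositeBefore (siteSteps p u' (k₀ + σ * i)) (-σ)
        (edgeChain (siteSteps p u) σ k₀ z₀ i) + if σ * k₀ + i < 0 then 1 else 0 : ℕ) : ℝ)))
          ∂drivingLaw ≤
        ENNReal.ofReal a * ENNReal.ofReal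
          (Real.exp (θ * edgeChain (siteSteps p u) σ k₀ z₀ i)) + ENNReal.ofReal b := by
      intro u
      generalize edgeChain (siteSteps p u) σ k₀ z₀ i = z
      have h1 := h (k₀ + σ * i) (-σ) z
      have h2 : ∀ u' : Driving, ENNReal.ofReal (Real.exp (θ *
        ((oppositeBefore (siteSteps p u' (k₀ + σ * i)) (-σ) z +
          if σ * k₀ + i < 0 then 1 else 0 : ℕ) : ℝ))) =
          ENNReal.ofReal (Real.exp (θ * ε)) * ENNReal.ofReal (Real.exp (θ *
            (oppositeBefore (siteSteps p u' (k₀ + σ * i)) (-σ) z : ℝ))) := by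
        intro u'
        rw [Nat.cast_add, hε', ← ENNReal.ofReal_mul (Real.exp_pos _).le, ← Real.exp_add]
        congr 2; ring
      simp_rw [h2]
      rw [lintegral_const_mul' _ _ ENNReal.ofReal_ne_top]
      refine (mul_le_mul_right h1 _).trans ?_
      rw [← ENNReal.ofReal_mul (Real.exp_pos _).le, ← ENNReal.ofReal_mul (Real.exp_pos _).le,
        ← ENNReal.ofReal_add (by positivity) hb0]
      refine ENNReal.ofReal_le_ofReal (le_of_eq ?_)
      rw [mul_add, ← Real.exp_add, ← Real.exp_add]
      congr 2; ring
    refine (lintegral_mono hinner).trans ?_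
    rw [lintegral_add_right _ measurable_const, lintegral_const_mul' _ _ ENNReal.ofReal_ne_top,
      lintegral_const, measure_univ, mul_one]
    refine (add_le_add (mul_le_mul_right ih _) le_rfl).trans ?_
    rw [← ENNReal.ofReal_mul (Real.exp_pos _).le, ← ENNReal.ofReal_add (by positivity) hb0]
    refine ENNReal.ofReal_le_ofReal ?_
    set E : ℝ := Real.exp (θ * (chainProfile z₀ N (i + 1) + δ * ((i + 1 : ℕ) : ℝ) + 1)) with hE
    have hprof : chainProfile z₀ N i + ε - 1 / 2 ≤ chainProfile z₀ N (i + 1) := by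
      unfold chainProfile
      push_cast
      rcases lt_or_ge i N with hi | hi
      · have h1 : (i : ℝ) + 1 ≤ N := by exact_mod_cast hi
        rw [hε, if_pos hi, min_eq_left (by linarith), min_eq_left h1]
        rw [max_eq_left (by have : (0 : ℝ) ≤ i := by positivity
                            have : (0 : ℝ) ≤ z₀ := by positivity
                            linarith)]
        refine le_max_of_le_left ?_
        linarith
      · have h1 : (N : ℝ) ≤ i := by exact_mod_cast hi
        rw [hε, if_neg (by omega), min_eq_right h1, min_eq_right (by linarith)]
        rcases max_cases ((z₀ : ℝ) + N - i / 2) 0 with ⟨h, _⟩ | ⟨h, _⟩ <;> rw [h]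
        · refine le_max_of_le_left ?_; linarith
        · refine le_max_of_le_right ?_; norm_num
    have hprof0 : 0 ≤ chainProfile z₀ N (i + 1) := le_max_right _ _
    have h1 : a * Real.exp (θ * (chainProfile z₀ N i + δ * i + 1)) ≤ E := by
      rw [ha, ← Real.exp_add, ← mul_add]
      refine Real.exp_le_exp.2 (mul_le_mul_of_nonneg_left ?_ hθ.le)
      push_cast
      linarith
    have h2 : Real.exp (θ * ε) ≤ E := by
      refine Real.exp_le_exp.2 (mul_le_mul_of_nonneg_left ?_ hθ.le)
      have : 0 ≤ δ * ((i + 1 : ℕ) : ℝ) := by positivity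
      linarith
    have h3 : a * ((1 + i * B) * Real.exp (θ * (chainProfile z₀ N i + δ * i + 1))) ≤
        (1 + i * B) * E := by
      rw [mul_left_comm]
      exact mul_le_mul_of_nonneg_left h1 (by positivity)
    have h4 : b ≤ E * B := mul_le_mul_of_nonneg_right h2 hB
    push_cast
    linarith

/-- Lower exponential bound for the chain around its profile. -/
lemma exists_lintegral_exp_neg_edgeChain_le (hp : IsRestoring p) {δ : ℝ} (hδ : 0 < δ) :
    ∃ θ > (0 : ℝ), ∀ (σ : ℤˣ) (k₀ : ℤ) (z₀ i : ℕ),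
      ∫⁻ u, ENNReal.ofReal (Real.exp (-θ * edgeChain (siteSteps p u) σ k₀ z₀ i)) ∂drivingLaw ≤
        ENNReal.ofReal (Real.exp (-θ *
          (z₀ + min (i : ℝ) (immigrationTime σ k₀) - i / 2 - δ * i))) := by
  obtain ⟨θ, hθ, h⟩ := exists_lintegral_exp_neg_le hp hδ
  refine ⟨θ, hθ, fun σ k₀ z₀ i => ?_⟩
  set N := immigrationTime σ k₀ with hN
  induction i with
  | zero => simp [edgeChain]
  | succ i ih =>
    rw [lintegral_edgeChain_succ σ k₀ z₀ i
      (fun n => ENNReal.ofReal (Real.exp (-θ * (n : ℝ))))]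
    set ε : ℝ := if i < N then 1 else 0 with hε
    have hε' : (((if σ * k₀ + i < 0 then 1 else 0 : ℕ)) : ℝ) = ε := by
      rw [hε, hN]
      by_cases hi : σ * k₀ + i < 0
      · rw [if_pos hi, if_pos ((lt_immigrationTime_iff _ _ _).2 hi)]; simp
      · rw [if_neg hi, if_neg (mt (lt_immigrationTime_iff _ _ _).1 hi)]; simp
    set a : ℝ := Real.exp (-θ * (ε - 1 / 2 - δ)) with ha
    have hinner : ∀ u : Driving, ∫⁻ u', ENNReal.ofReal (Real.exp (-θ *
        ((oppositeBefore (siteSteps p u' (k₀ + σ * i)) (-σ)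
        (edgeChain (siteSteps p u) σ k₀ z₀ i) + if σ * k₀ + i < 0 then 1 else 0 : ℕ) : ℝ)))
          ∂drivingLaw ≤
        ENNReal.ofReal a * ENNReal.ofReal
          (Real.exp (-θ * edgeChain (siteSteps p u) σ k₀ z₀ i)) := by
      intro u
      generalize edgeChain (siteSteps p u) σ k₀ z₀ i = z
      have h1 := h (k₀ + σ * i) (-σ) z
      have h2 : ∀ u' : Driving, ENNReal.ofReal (Real.exp (-θ *
        ((oppositeBefore (siteSteps p u' (k₀ + σ * i)) (-σ) z +
          if σ * k₀ + i < 0 then 1 else 0 : ℕ) : ℝ))) =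
          ENNReal.ofReal (Real.exp (-θ * ε)) * ENNReal.ofReal (Real.exp (-θ *
            (oppositeBefore (siteSteps p u' (k₀ + σ * i)) (-σ) z : ℝ))) := by
        intro u'
        rw [Nat.cast_add, hε', ← ENNReal.ofReal_mul (Real.exp_pos _).le, ← Real.exp_add]
        congr 2; ring
      simp_rw [h2]
      rw [lintegral_const_mul' _ _ ENNReal.ofReal_ne_top]
      refine (mul_le_mul_right h1 _).trans ?_
      rw [← ENNReal.ofReal_mul (Real.exp_pos _).le, ← ENNReal.ofReal_mul (Real.exp_pos _).le]
      refine ENNReal.ofReal_le_ofReal (le_of_eq ?_)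
      rw [← Real.exp_add, ← Real.exp_add]
      congr 1; ring
    refine (lintegral_mono hinner).trans ?_
    rw [lintegral_const_mul' _ _ ENNReal.ofReal_ne_top]
    refine (mul_le_mul_right ih _).trans ?_
    rw [← ENNReal.ofReal_mul (Real.exp_pos _).le]
    refine ENNReal.ofReal_le_ofReal (le_of_eq ?_)
    rw [← Real.exp_add]
    congr 1
    have hmin : min (((i + 1 : ℕ)) : ℝ) N = min (i : ℝ) N + ε := by
      push_cast
      rcases lt_or_ge i N with hi | hi
      · have h1 : (i : ℝ) + 1 ≤ N := by exact_mod_cast hi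
        rw [hε, if_pos hi, min_eq_left h1, min_eq_left (by linarith)]
      · have h1 : (N : ℝ) ≤ i := by exact_mod_cast hi
        rw [hε, if_neg (by omega), min_eq_right h1, min_eq_right (by linarith), add_zero]
    rw [hmin]
    push_cast
    ring

lemma edgeChain_eq_zero_of_le {ζ : ℤ → ℕ → ℤˣ} {σ : ℤˣ} {k₀ : ℤ} {z₀ i : ℕ}
    (hi : immigrationTime σ k₀ ≤ i) (h0 : edgeChain ζ σ k₀ z₀ i = 0) {j : ℕ} (hij : i ≤ j) :
    edgeChain ζ σ k₀ z₀ j = 0 := by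
  induction j, hij using Nat.le_induction with
  | base => exact h0
  | succ j hj ih =>
    have : ¬ (σ * k₀ + j < 0) := by
      rw [← lt_immigrationTime_iff]; omega
    rw [edgeChain, ih, oppositeBefore_zero, if_neg this]

/-- After the immigration the chain dies out in a time of the order of its size. -/
lemma exists_drivingLaw_edgeChain_pos_le (hp : IsRestoring p) :
    ∃ K > (0 : ℝ), ∀ (σ : ℤˣ) (k₀ : ℤ) (z₀ i n : ℕ), immigrationTime σ k₀ ≤ i →
      n * drivingLaw {u | 0 < edgeChain (siteSteps p u) σ k₀ z₀ (i + n)} ≤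
        ENNReal.ofReal K * ∫⁻ u, ENNReal.ofReal (edgeChain (siteSteps p u) σ k₀ z₀ i)
          ∂drivingLaw := by
  obtain ⟨D, hD, h⟩ := exists_extinctionPotential hp
  refine ⟨4 + D, by positivity, fun σ k₀ z₀ i n hi => ?_⟩
  set Z : ℕ → Driving → ℕ := fun j u => edgeChain (siteSteps p u) σ k₀ z₀ j with hZ
  have hZm : ∀ j, Measurable (Z j) := fun j => measurable_edgeChain_siteSteps σ k₀ z₀ j
  set Φ : ℕ → ENNReal := fun j => ∫⁻ u, ENNReal.ofReal (extinctionPotential D (Z j u)) ∂drivingLaw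
    with hΦ
  have hstep : ∀ j, immigrationTime σ k₀ ≤ j → Φ (j + 1) + drivingLaw {u | 0 < Z j u} ≤ Φ j := by
    intro j hj
    have hms : MeasurableSet {u | 0 < Z j u} := hZm j (MeasurableSet.of_discrete (s := Set.Ioi 0))
    have hε : ¬ (σ * k₀ + j < 0) := by rw [← lt_immigrationTime_iff]; omega
    simp only [hΦ]
    rw [lintegral_edgeChain_succ σ k₀ z₀ j (fun n => ENNReal.ofReal (extinctionPotential D n)),
      ← lintegral_indicator_one hms,
      ← lintegral_add_right _ (measurable_one.indicator hms)]
    refine lintegral_mono fun u => ?_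
    rw [if_neg hε]
    simp only [add_zero]
    rcases Nat.eq_zero_or_pos (Z j u) with h0 | h0
    · have h1 : edgeChain (siteSteps p u) σ k₀ z₀ j = 0 := h0
      simp [h1, hZ, oppositeBefore_zero, extinctionPotential, Set.indicator]
    · rw [Set.indicator_of_mem (show u ∈ {u | 0 < Z j u} from h0)]
      exact h _ _ _ h0
  have hind : ∀ n : ℕ, Φ (i + n) + n * drivingLaw {u | 0 < Z (i + n) u} ≤ Φ i := by
    intro n
    induction n with
    | zero => simp
    | succ n ih =>
      have h1 : drivingLaw {u | 0 < Z (i + n + 1) u} ≤ drivingLaw {u | 0 < Z (i + n) u} := by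
        refine measure_mono fun u hu => ?_
        by_contra h0
        have h2 : edgeChain (siteSteps p u) σ k₀ z₀ (i + n) = 0 := by
          simpa [hZ] using h0
        have h3 := edgeChain_eq_zero_of_le (by omega) h2 (Nat.le_add_right (i + n) 1)
        have h4 : 0 < edgeChain (siteSteps p u) σ k₀ z₀ (i + n + 1) := hu
        omega
      calc Φ (i + (n + 1)) + ((n + 1 : ℕ) : ENNReal) * drivingLaw {u | 0 < Z (i + (n + 1)) u}
          ≤ Φ (i + n + 1) + ((n + 1 : ℕ) : ENNReal) * drivingLaw {u | 0 < Z (i + n) u} := by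
            rw [← add_assoc]; gcongr
        _ = (Φ (i + n + 1) + drivingLaw {u | 0 < Z (i + n) u}) +
            n * drivingLaw {u | 0 < Z (i + n) u} := by push_cast; ring
        _ ≤ Φ (i + n) + n * drivingLaw {u | 0 < Z (i + n) u} := by
            gcongr; exact hstep _ (by omega)
        _ ≤ _ := ih
  calc _ ≤ Φ i := le_trans le_add_self (hind n)
    _ ≤ ∫⁻ u, ENNReal.ofReal (4 + D) * ENNReal.ofReal (Z i u) ∂drivingLaw := by
        refine lintegral_mono fun u => ?_
        rw [← ENNReal.ofReal_mul (by positivity)]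
        exact ENNReal.ofReal_le_ofReal (extinctionPotential_le hD _)
    _ = _ := lintegral_const_mul' _ _ ENNReal.ofReal_ne_top

end Chain

/-! ### Concentration of the chain around its profile -/

section Chain

variable {p : ℤ → ℝ}

lemma measure_le_div_of_exp {Ω : Type*} [MeasurableSpace Ω] (μ : Measure Ω) {Y : Ω → ℝ}
    (hY : Measurable Y) {c a : ℝ}
    (h : ∫⁻ ω, ENNReal.ofReal (Real.exp (Y ω)) ∂μ ≤ ENNReal.ofReal c) :
    μ {ω | a ≤ Y ω} ≤ ENNReal.ofReal (c * Real.exp (-a)) := by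
  have h1 := mul_meas_ge_le_lintegral (μ := μ)
    (ENNReal.measurable_ofReal.comp (Real.measurable_exp.comp hY)) (ENNReal.ofReal (Real.exp a))
  have h2 : {ω | a ≤ Y ω} ⊆ {ω | ENNReal.ofReal (Real.exp a) ≤
      (ENNReal.ofReal ∘ Real.exp ∘ Y) ω} := fun ω hω =>
    ENNReal.ofReal_le_ofReal (Real.exp_le_exp.2 hω)
  have h3 : ENNReal.ofReal (Real.exp a) * μ {ω | a ≤ Y ω} ≤ ENNReal.ofReal c :=
    (mul_le_mul_right (measure_mono h2) _).trans (h1.trans h)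
  calc μ {ω | a ≤ Y ω} = ENNReal.ofReal (Real.exp (-a)) *
        (ENNReal.ofReal (Real.exp a) * μ {ω | a ≤ Y ω}) := by
        rw [← mul_assoc, ← ENNReal.ofReal_mul (Real.exp_pos _).le, ← Real.exp_add]; simp
    _ ≤ ENNReal.ofReal (Real.exp (-a)) * ENNReal.ofReal c := mul_le_mul_right h3 _
    _ = _ := by rw [← ENNReal.ofReal_mul (Real.exp_pos _).le, mul_comm]

lemma chainProfile_eq_zero {z₀ N i : ℕ} (h : 2 * (z₀ + N) ≤ i) : chainProfile z₀ N i = 0 := by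
  unfold chainProfile
  refine max_eq_right ?_
  have h1 : (2 * (z₀ + N) : ℝ) ≤ i := by exact_mod_cast h
  have h2 := min_le_right (i : ℝ) N
  linarith

/-- The event that `edgeChain` stays within `δ A` of its profile and dies out on time. -/
def FollowsProfile (δ A : ℝ) (z₀ N : ℕ) (Z : ℕ → ℕ) : Prop :=
  (∀ i, |(Z i : ℝ) - chainProfile z₀ N i| ≤ δ * A) ∧
    ∀ i : ℕ, 2 * ((z₀ : ℝ) + N) + δ * A ≤ i → Z i = 0

lemma followsProfile_of_le {ζ : ℤ → ℕ → ℤˣ} {σ : ℤˣ} {k₀ : ℤ} {z₀ n : ℕ} {δ A : ℝ}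
    (hδA : 0 ≤ δ * A) (hn : (n : ℝ) ≤ δ * A)
    (h0 : edgeChain ζ σ k₀ z₀ (2 * (z₀ + immigrationTime σ k₀) + n) = 0)
    (h : ∀ i ≤ 2 * (z₀ + immigrationTime σ k₀) + n, |(edgeChain ζ σ k₀ z₀ i : ℝ) -
      chainProfile z₀ (immigrationTime σ k₀) i| ≤ δ * A) :
    FollowsProfile δ A z₀ (immigrationTime σ k₀) (edgeChain ζ σ k₀ z₀) := by
  have hz : ∀ i, 2 * (z₀ + immigrationTime σ k₀) + n ≤ i → edgeChain ζ σ k₀ z₀ i = 0 :=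
    fun i hi => edgeChain_eq_zero_of_le (by omega) h0 hi
  refine ⟨fun i => ?_, fun i hi => hz i ?_⟩
  · rcases le_total i (2 * (z₀ + immigrationTime σ k₀) + n) with hi | hi
    · exact h i hi
    · rw [hz i hi, chainProfile_eq_zero (by omega)]
      simpa using hδA
  · have : ((2 * (z₀ + immigrationTime σ k₀) + n : ℕ) : ℝ) ≤ i := by push_cast; linarith
    exact_mod_cast this

/-- The chain follows its profile with high probability, uniformly over all chains whose size is of
order `A`. -/
lemma exists_drivingLaw_not_followsProfile_le (hp : IsRestoring p) {C δ γ : ℝ} (hC : 0 < C)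
    (hδ : 0 < δ) (hγ : 0 < γ) :
    ∀ᶠ A : ℝ in atTop, ∀ (σ : ℤˣ) (k₀ : ℤ) (z₀ : ℕ),
      (z₀ + immigrationTime σ k₀ : ℝ) ≤ C * A →
      drivingLaw {u | ¬ FollowsProfile δ A z₀ (immigrationTime σ k₀)
        (edgeChain (siteSteps p u) σ k₀ z₀)} ≤ ENNReal.ofReal γ := by
  obtain ⟨K, hK, hext⟩ := exists_drivingLaw_edgeChain_pos_le hp
  -- `δ₂` makes the extinction bound small, `δ₁` the drift error over the whole time span
  set δ₂ : ℝ := min δ (γ * δ / (8 * K)) with hδ₂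
  have hδ₂0 : 0 < δ₂ := lt_min hδ (by positivity)
  have hδ₂δ : δ₂ ≤ δ := min_le_left _ _
  have hδ₂γ : K * δ₂ * 8 ≤ γ * δ := by
    have := min_le_right δ (γ * δ / (8 * K))
    rw [← hδ₂, le_div_iff₀ (by positivity)] at this
    linarith
  set C₁ : ℝ := 2 * C + δ with hC₁
  have hC₁0 : 0 < C₁ := by positivity
  set δ₁ : ℝ := δ₂ / (2 * C₁) with hδ₁
  have hδ₁0 : 0 < δ₁ := by positivity
  obtain ⟨θ, hθ, B, hB, hup⟩ := exists_lintegral_exp_edgeChain_le hp hδ₁0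
  obtain ⟨θ', hθ', hlow⟩ := exists_lintegral_exp_neg_edgeChain_le hp hδ₁0
  set U : ℝ → ℝ := fun A => (1 + C₁ * A * B) * Real.exp (θ * (1 - δ₂ * A / 2)) with hU
  set W : ℝ → ℝ := fun A => Real.exp (-θ' * (δ₂ * A / 2)) with hW
  have hpoly : ∀ (c : ℝ), 0 < c → ∀ n : ℕ,
      Tendsto (fun A : ℝ => A ^ n * Real.exp (-(c * A))) atTop (𝓝 0) := by
    intro c hc n
    have h1 := (Real.tendsto_pow_mul_exp_neg_atTop_nhds_zero n).comp
      (tendsto_id.const_mul_atTop hc)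
    have h2 := h1.const_mul ((c ^ n)⁻¹)
    rw [mul_zero] at h2
    refine h2.congr fun A => ?_
    simp only [Function.comp_apply, id_eq, mul_pow]
    field_simp
  have hlim : Tendsto (fun A : ℝ => (C₁ * A + 1) * (U A + W A) +
      2 / δ * K / θ * U A) atTop (𝓝 0) := by
    have e0 := hpoly (θ * δ₂ / 2) (by positivity) 0
    have e1 := hpoly (θ * δ₂ / 2) (by positivity) 1
    have e2 := hpoly (θ * δ₂ / 2) (by positivity) 2
    have f0 := hpoly (θ' * δ₂ / 2) (by positivity) 0
    have f1 := hpoly (θ' * δ₂ / 2) (by positivity) 1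
    have h1 := ((((e2.const_mul (C₁ * (C₁ * B) * Real.exp θ)).add
      (e1.const_mul ((C₁ + C₁ * B + 2 / δ * K / θ * (C₁ * B)) * Real.exp θ))).add
      (e0.const_mul ((1 + 2 / δ * K / θ) * Real.exp θ))).add (f1.const_mul C₁)).add f0
    simp only [mul_zero, add_zero] at h1
    refine h1.congr fun A => ?_
    have g1 : Real.exp (θ * (1 - δ₂ * A / 2)) =
        Real.exp θ * Real.exp (-(θ * δ₂ / 2 * A)) := by
      rw [← Real.exp_add]; congr 1; ring
    have g2 : Real.exp (-θ' * (δ₂ * A / 2)) = Real.exp (-(θ' * δ₂ / 2 * A)) := by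
      congr 1; ring
    simp only [hU, hW]
    rw [g1, g2]
    ring
  filter_upwards [hlim.eventually (ge_mem_nhds (half_pos hγ)), eventually_ge_atTop 1,
    eventually_ge_atTop (2 / δ)] with A hA hA1 hAδ σ k₀ z₀ hz
  set N := immigrationTime σ k₀ with hN
  have hA0 : 0 < A := by linarith
  have hδA : 2 ≤ δ * A := by
    rw [div_le_iff₀ hδ] at hAδ; linarith
  set n : ℕ := ⌊δ * A⌋₊ with hn
  have hn1 : (n : ℝ) ≤ δ * A := Nat.floor_le (by positivity)
  have hn2 : δ * A / 2 ≤ n := by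
    have := Nat.lt_floor_add_one (δ * A)
    rw [← hn] at this
    linarith
  set J : ℕ := 2 * (z₀ + N) with hJ
  have hJn : ((J + n : ℕ) : ℝ) ≤ C₁ * A := by
    rw [hJ, hC₁]; push_cast; linarith
  have hi1 : ∀ i ≤ J + n, (i : ℝ) ≤ C₁ * A := fun i hi =>
    le_trans (by exact_mod_cast hi) hJn
  have hi2 : ∀ i ≤ J + n, δ₁ * (i : ℝ) ≤ δ₂ * A / 2 := by
    intro i hi
    have h1 := mul_le_mul_of_nonneg_left (hi1 i hi) hδ₁0.le
    have h2 : δ₁ * (C₁ * A) = δ₂ * A / 2 := by rw [hδ₁]; field_simp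
    linarith
  set Z : ℕ → Driving → ℕ := fun i u => edgeChain (siteSteps p u) σ k₀ z₀ i with hZ
  have hZm : ∀ (i : ℕ), Measurable fun u => (Z i u : ℝ) := fun i =>
    (measurable_of_countable _).comp (measurable_edgeChain_siteSteps σ k₀ z₀ i)
  have hU0 : 0 ≤ U A := by simp only [hU]; positivity
  have hW0 : 0 ≤ W A := by simp only [hW]; positivity
  have hupA : ∀ i ≤ J + n, (1 + i * B) * Real.exp (θ * (chainProfile z₀ N i + δ₁ * i + 1)) *
      Real.exp (-(θ * (chainProfile z₀ N i + δ₂ * A))) ≤ U A := by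
    intro i hi
    rw [mul_assoc, ← Real.exp_add]
    simp only [hU]
    refine mul_le_mul ?_ (Real.exp_le_exp.2 ?_) (Real.exp_pos _).le (by positivity)
    · have := mul_le_mul_of_nonneg_right (hi1 i hi) hB
      linarith
    · rw [← mul_neg, ← mul_add]
      refine mul_le_mul_of_nonneg_left ?_ hθ.le
      have := hi2 i hi
      linarith
  have hbad1 : ∀ i ≤ J + n, drivingLaw {u | chainProfile z₀ N i + δ * A < Z i u} ≤
      ENNReal.ofReal (U A) := by
    intro i hi
    have h1 := measure_le_div_of_exp drivingLaw ((hZm i).const_mul θ)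
      (a := θ * (chainProfile z₀ N i + δ₂ * A)) (hup σ k₀ z₀ i)
    refine (measure_mono fun u hu => ?_).trans (h1.trans (ENNReal.ofReal_le_ofReal (hupA i hi)))
    have hu' : chainProfile z₀ N i + δ * A < Z i u := hu
    have : δ₂ * A ≤ δ * A := by gcongr
    exact mul_le_mul_of_nonneg_left (by linarith) hθ.le
  have hbad2 : ∀ i ≤ J + n, drivingLaw {u | (Z i u : ℝ) < chainProfile z₀ N i - δ * A} ≤
      ENNReal.ofReal (W A) := by
    intro i hi
    set q : ℝ := z₀ + min (i : ℝ) N - i / 2 with hq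
    have h1 := measure_le_div_of_exp drivingLaw ((hZm i).const_mul (-θ'))
      (a := -θ' * (q - δ₂ * A)) (hlow σ k₀ z₀ i)
    refine (measure_mono fun u hu => ?_).trans (h1.trans (ENNReal.ofReal_le_ofReal ?_))
    · have hu' : (Z i u : ℝ) < chainProfile z₀ N i - δ * A := hu
      have h2 : δ₂ * A ≤ δ * A := by gcongr
      have h3 : (Z i u : ℝ) ≤ q - δ₂ * A := by
        have h4 : (0 : ℝ) ≤ Z i u := by positivity
        unfold chainProfile at hu'
        rw [← hq] at hu'
        rcases max_cases q 0 with ⟨h, _⟩ | ⟨h, _⟩ <;> rw [h] at hu' <;> linarith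
      have h5 := mul_le_mul_of_nonneg_left h3 hθ'.le
      show -θ' * (q - δ₂ * A) ≤ -θ' * (Z i u : ℝ)
      linarith
    · rw [← Real.exp_add]
      refine Real.exp_le_exp.2 ?_
      have h2 := mul_le_mul_of_nonneg_left (hi2 i hi) hθ'.le
      rw [hN] at hq
      rw [← hq]
      linarith
  have hmeanJ : ∫⁻ u, ENNReal.ofReal (Z J u) ∂drivingLaw ≤
      ENNReal.ofReal (δ₂ * A + θ⁻¹ * U A) := by
    have h1 : ∀ u, ENNReal.ofReal (Z J u) ≤ ENNReal.ofReal (δ₂ * A) +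
        ENNReal.ofReal (θ⁻¹ * Real.exp (-(θ * (δ₂ * A)))) *
          ENNReal.ofReal (Real.exp (θ * Z J u)) := by
      intro u
      rw [← ENNReal.ofReal_mul (by positivity), ← ENNReal.ofReal_add (by positivity) (by positivity)]
      refine ENNReal.ofReal_le_ofReal ?_
      rw [mul_assoc, ← Real.exp_add]
      have h2 := Real.add_one_le_exp (-(θ * (δ₂ * A)) + θ * Z J u)
      have h3 : θ⁻¹ * (-(θ * (δ₂ * A)) + θ * Z J u) = Z J u - δ₂ * A := by
        field_simp; ring
      have h4 := mul_le_mul_of_nonneg_left (show -(θ * (δ₂ * A)) + θ * Z J u ≤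
        Real.exp (-(θ * (δ₂ * A)) + θ * Z J u) by linarith) (inv_nonneg.2 hθ.le)
      linarith
    refine (lintegral_mono h1).trans ?_
    rw [lintegral_add_left measurable_const, lintegral_const, measure_univ, mul_one,
      lintegral_const_mul' _ _ ENNReal.ofReal_ne_top]
    refine (add_le_add le_rfl (mul_le_mul_right (hup σ k₀ z₀ J) _)).trans ?_
    rw [← ENNReal.ofReal_mul (by positivity), ← ENNReal.ofReal_add (by positivity) (by positivity)]
    refine ENNReal.ofReal_le_ofReal ?_
    have h2 := hupA J (by omega)
    rw [← hN, chainProfile_eq_zero (le_of_eq hJ.symm)] at *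
    rw [zero_add (δ₂ * A)] at h2
    have h3 := mul_le_mul_of_nonneg_left h2 (inv_nonneg.2 hθ.le)
    linarith
  have hbad3 : drivingLaw {u | 0 < Z (J + n) u} ≤
      ENNReal.ofReal (γ / 2 + 2 / δ * K / θ * U A) := by
    have h1 := hext σ k₀ z₀ J n (by omega)
    have h2 := h1.trans (mul_le_mul_right hmeanJ _)
    rw [← ENNReal.ofReal_mul hK.le] at h2
    have hn0 : 0 < (n : ℝ) := by linarith
    have h3 : drivingLaw {u | 0 < Z (J + n) u} ≤
        ENNReal.ofReal (K * (δ₂ * A + θ⁻¹ * U A)) / n := by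
      rw [ENNReal.le_div_iff_mul_le (Or.inl (by exact_mod_cast hn0.ne'))
        (Or.inl (ENNReal.natCast_ne_top n)), mul_comm]
      exact h2
    refine h3.trans ?_
    rw [← ENNReal.ofReal_natCast, ← ENNReal.ofReal_div_of_pos hn0]
    refine ENNReal.ofReal_le_ofReal ?_
    rw [div_le_iff₀ hn0]
    have h4 : K * (δ₂ * A) ≤ γ / 2 * n := by nlinarith
    have h5 : K * (θ⁻¹ * U A) ≤ 2 / δ * K / θ * U A * n := by
      have h6 : 1 ≤ 2 / δ * n := by
        rw [div_mul_eq_mul_div, one_le_div hδ]; nlinarith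
      have h7 : 2 / δ * K / θ * U A * n = K * (θ⁻¹ * U A) * (2 / δ * n) := by
        field_simp
      rw [h7]
      exact le_mul_of_one_le_right (by positivity) h6
    linarith
  have hsub : {u | ¬ FollowsProfile δ A z₀ N (edgeChain (siteSteps p u) σ k₀ z₀)} ⊆
      (⋃ i ∈ Finset.range (J + n + 1), ({u | chainProfile z₀ N i + δ * A < Z i u} ∪
        {u | (Z i u : ℝ) < chainProfile z₀ N i - δ * A})) ∪ {u | 0 < Z (J + n) u} := by
    intro u hu
    by_contra hcon
    simp only [Set.mem_union, Set.mem_iUnion, Finset.mem_range, not_or, not_exists,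
      Set.mem_ofPred_eq, not_lt] at hcon
    refine hu (followsProfile_of_le (by positivity) hn1 (Nat.le_zero.1 hcon.2) fun i hi => ?_)
    have h1 := hcon.1 i (by omega)
    rw [abs_le]
    constructor <;> [linarith [h1.2]; linarith [h1.1]]
  calc _ ≤ _ := measure_mono hsub
    _ ≤ (∑ i ∈ Finset.range (J + n + 1), ENNReal.ofReal (U A + W A)) +
        ENNReal.ofReal (γ / 2 + 2 / δ * K / θ * U A) := by
        refine (measure_union_le _ _).trans (add_le_add ?_ hbad3)
        refine (measure_biUnion_finset_le _ _).trans (Finset.sum_le_sum fun i hi => ?_)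
        rw [Finset.mem_range] at hi
        refine (measure_union_le _ _).trans ?_
        rw [ENNReal.ofReal_add hU0 hW0]
        exact add_le_add (hbad1 i (by omega)) (hbad2 i (by omega))
    _ = ENNReal.ofReal ((J + n + 1 : ℕ) * (U A + W A) + (γ / 2 + 2 / δ * K / θ * U A)) := by
        have hcast : ∀ (r : ℕ) (a b : ℝ), 0 ≤ a → 0 ≤ b →
            (r : ENNReal) * ENNReal.ofReal a + ENNReal.ofReal b = ENNReal.ofReal (r * a + b) := by
          intro r a b ha hb
          rw [ENNReal.ofReal_add (by positivity) hb, ENNReal.ofReal_mul (by positivity),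
            ENNReal.ofReal_natCast]
        rw [Finset.sum_const, Finset.card_range, nsmul_eq_mul]
        exact hcast _ _ _ (by positivity) (by positivity)
    _ ≤ ENNReal.ofReal γ := by
        refine ENNReal.ofReal_le_ofReal ?_
        have h1 : ((J + n + 1 : ℕ) : ℝ) * (U A + W A) ≤ (C₁ * A + 1) * (U A + W A) := by
          refine mul_le_mul_of_nonneg_right ?_ (by positivity)
          push_cast at hJn ⊢
          linarith
        linarith

/-- Every chain dies out almost surely. -/
lemma ae_exists_edgeChain_eq_zero (hp : IsRestoring p) :
    ∀ᵐ u ∂drivingLaw, ∀ (σ : ℤˣ) (k₀ : ℤ) (z₀ : ℕ), ∃ i, immigrationTime σ k₀ ≤ i ∧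
      edgeChain (siteSteps p u) σ k₀ z₀ i = 0 := by
  refine ae_all_iff.2 fun σ => ae_all_iff.2 fun k₀ => ae_all_iff.2 fun z₀ => ?_
  rw [ae_iff, ← le_zero_iff]
  refine ENNReal.le_of_forall_pos_le_add fun γ hγ _ => ?_
  rw [zero_add]
  set C : ℝ := z₀ + immigrationTime σ k₀ + 1 with hC
  have hC0 : 0 < C := by positivity
  obtain ⟨A, hA, hA1⟩ := ((exists_drivingLaw_not_followsProfile_le hp hC0 one_pos
    (NNReal.coe_pos.2 hγ)).and (eventually_ge_atTop 1)).exists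
  have h1 := hA σ k₀ z₀ (by nlinarith)
  rw [ENNReal.ofReal_coe_nnreal] at h1
  refine (measure_mono fun u hu => ?_).trans h1
  intro hf
  refine hu ?_
  obtain ⟨i, hi⟩ := exists_nat_ge (2 * ((z₀ : ℝ) + immigrationTime σ k₀) + 1 * A)
  refine ⟨i, ?_, hf.2 i hi⟩
  have : (immigrationTime σ k₀ : ℝ) ≤ i := by
    have : (0 : ℝ) ≤ z₀ := by positivity
    have : (0 : ℝ) ≤ immigrationTime σ k₀ := by positivity
    linarith
  exact_mod_cast this

end Chain

/-! ### Walks that read prescribed signs at each site -/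

/-- The number of visits of the path `x` to `k` before time `n`. -/
def visits (x : ℕ → ℤ) (n : ℕ) (k : ℤ) : ℕ := ((Finset.range n).filter (fun j => x j = k)).card

/-- The path `x` starts from `0` and takes the step `ζ k t` after its `t`-th visit to the site `k`,
counting visits from zero. -/
def FollowsStacks (ζ : ℤ → ℕ → ℤˣ) (x : ℕ → ℤ) : Prop :=
  x 0 = 0 ∧ ∀ n, x (n + 1) = x n + (ζ (x n) (visits x n (x n)) : ℤ)

lemma visits_succ (x : ℕ → ℤ) (n : ℕ) (k : ℤ) :
    visits x (n + 1) k = visits x n k + if x n = k then 1 else 0 := by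
  unfold visits
  rw [Finset.range_add_one, Finset.filter_insert]
  split_ifs with h
  · rw [Finset.card_insert_of_notMem (by simp)]
  · simp

lemma orientedLocalTime_zero (s : ℤˣ) (x : ℕ → ℤ) (k : ℤ) : orientedLocalTime s x 0 k = 0 := by
  simp [orientedLocalTime]

lemma orientedLocalTime_succ (s : ℤˣ) (x : ℕ → ℤ) (n : ℕ) (k : ℤ) :
    orientedLocalTime s x (n + 1) k =
      orientedLocalTime s x n k + if x n = k ∧ x (n + 1) = k + s then 1 else 0 := by
  unfold orientedLocalTime
  rw [Finset.range_add_one, Finset.filter_insert]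
  split_ifs with h
  · rw [Finset.card_insert_of_notMem (by simp)]
  · simp

lemma units_val_cases (σ : ℤˣ) : (σ : ℤ) = 1 ∨ (σ : ℤ) = -1 := by
  rcases Int.units_eq_one_or σ with rfl | rfl <;> simp

namespace FollowsStacks

variable {ζ : ℤ → ℕ → ℤˣ} {x : ℕ → ℤ}

lemma orientedLocalTime_eq (hx : FollowsStacks ζ x) (s : ℤˣ) (n : ℕ) (k : ℤ) :
    orientedLocalTime s x n k = signCount (ζ k) s (visits x n k) := by
  induction n with
  | zero => simp [orientedLocalTime, visits, signCount_zero]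
  | succ n ih =>
    rw [orientedLocalTime_succ, visits_succ, ih]
    by_cases h : x n = k
    · have h1 : x (n + 1) = k + s ↔ ζ k (visits x n k) = s := by
        rw [hx.2 n, h, add_right_inj, Units.val_inj]
      simp only [h, true_and, if_true, h1]
      rw [signCount_succ]
    · simp [h]

lemma visits_eq (hx : FollowsStacks ζ x) (s : ℤˣ) (n : ℕ) (k : ℤ) :
    visits x n k = orientedLocalTime s x n k + orientedLocalTime (-s) x n k := by
  rw [hx.orientedLocalTime_eq, hx.orientedLocalTime_eq, signCount_add_neg]

end FollowsStacks

/-- The number of steps `-σ` from `k` up to time `n`, counting the pending one if the walker is at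
`k` or beyond it on the side `σ`. -/
def pendingCount (σ : ℤˣ) (x : ℕ → ℤ) (n : ℕ) (k : ℤ) : ℕ :=
  orientedLocalTime (-σ) x n k + if (σ : ℤ) * k ≤ σ * x n then 1 else 0

namespace FollowsStacks

variable {ζ : ℤ → ℕ → ℤˣ} {x : ℕ → ℤ}

/-- Conservation of flow through the edge between `k` and `k + σ`. -/
lemma pendingCount_add (hx : FollowsStacks ζ x) (σ : ℤˣ) (n : ℕ) (k : ℤ) :
    pendingCount σ x n (k + σ) = orientedLocalTime σ x n k + if (σ : ℤ) * k < 0 then 1 else 0 := by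
  induction n with
  | zero =>
    simp only [pendingCount, orientedLocalTime_zero, hx.1, mul_add]
    rcases units_val_cases σ with h | h <;> rw [h] <;> congr 1
  | succ n ih =>
    unfold pendingCount at ih ⊢
    rw [orientedLocalTime_succ, orientedLocalTime_succ, hx.2 n]
    generalize ζ (x n) (visits x n (x n)) = τ
    generalize orientedLocalTime σ x n k = a at *
    generalize orientedLocalTime (-σ) x n (k + σ) = b at *
    rw [Units.val_neg]
    rcases units_val_cases σ with h | h <;> rcases units_val_cases τ with h' | h' <;>
      rw [h] at ih ⊢ <;> rw [h'] <;> split_ifs at ih ⊢ <;> omega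

/-- The last step from a site was taken towards the walker. -/
lemma last_step (hx : FollowsStacks ζ x) (σ : ℤˣ) (n : ℕ) :
    ∀ k : ℤ, (σ : ℤ) * x n < σ * k →
      visits x n k = 0 ∨ ζ k (visits x n k - 1) = -σ := by
  induction n with
  | zero => intro k _; left; simp [visits]
  | succ n ih =>
    intro k hk
    rw [visits_succ]
    by_cases h : x n = k
    · right
      rw [if_pos h, Nat.add_sub_cancel]
      rw [hx.2 n, h] at hk
      rcases Int.units_eq_one_or σ with rfl | rfl <;>
        rcases Int.units_eq_one_or (ζ k (visits x n k)) with h' | h' <;> rw [h'] at hk ⊢ <;>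
        simp at hk ⊢
    · rw [if_neg h, add_zero]
      refine ih k ?_
      rw [hx.2 n] at hk
      rcases units_val_cases σ with h1 | h1 <;>
        rcases units_val_cases (ζ (x n) (visits x n (x n))) with h' | h' <;>
        rw [h1, h'] at hk <;> rw [h1] <;> omega

lemma pendingCount_of_lt (σ : ℤˣ) {n : ℕ} {k : ℤ} (h : (σ : ℤ) * x n < σ * k) :
    pendingCount σ x n k = orientedLocalTime (-σ) x n k := by
  rw [pendingCount, if_neg (by omega), add_zero]

lemma pendingCount_of_le (σ : ℤˣ) {n : ℕ} {k : ℤ} (h : (σ : ℤ) * k ≤ σ * x n) :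
    pendingCount σ x n k = orientedLocalTime (-σ) x n k + 1 := by
  rw [pendingCount, if_pos h]

lemma orientedLocalTime_le_pendingCount (σ : ℤˣ) (n : ℕ) (k : ℤ) :
    orientedLocalTime (-σ) x n k ≤ pendingCount σ x n k := Nat.le_add_right _ _

lemma orientedLocalTime_eq_of_lt (hx : FollowsStacks ζ x) (σ : ℤˣ) {n : ℕ} {k : ℤ}
    (h : (σ : ℤ) * x n < σ * k) :
    orientedLocalTime σ x n k = oppositeBefore (ζ k) (-σ) (pendingCount σ x n k) := by
  rw [pendingCount_of_lt σ h, hx.orientedLocalTime_eq, hx.orientedLocalTime_eq,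
    oppositeBefore_of_last (hx.last_step σ n k h), neg_neg]

lemma orientedLocalTime_eq_of_next (hx : FollowsStacks ζ x) (σ : ℤˣ) {n : ℕ}
    (h : x (n + 1) = x n - σ) :
    orientedLocalTime σ x n (x n) =
      oppositeBefore (ζ (x n)) (-σ) (pendingCount σ x n (x n)) := by
  have h1 : ζ (x n) (visits x n (x n)) = -σ := by
    rw [hx.2 n, sub_eq_add_neg, add_right_inj, ← Units.val_neg, Units.val_inj] at h
    exact h
  rw [pendingCount_of_le σ le_rfl, hx.orientedLocalTime_eq, hx.orientedLocalTime_eq,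
    oppositeBefore_of_next h1, neg_neg]

lemma orientedLocalTime_le (hx : FollowsStacks ζ x) (hζ : ∀ k, IsRecurrent (ζ k)) (σ : ℤˣ)
    (n : ℕ) (k : ℤ) :
    orientedLocalTime σ x n k ≤ oppositeBefore (ζ k) (-σ) (pendingCount σ x n k) := by
  rcases lt_or_ge ((σ : ℤ) * x n) (σ * k) with h | h
  · exact (hx.orientedLocalTime_eq_of_lt σ h).le
  · rw [pendingCount_of_le σ h, hx.orientedLocalTime_eq, hx.orientedLocalTime_eq]
    have := signCount_neg_le_oppositeBefore (hζ k) (-σ) (visits x n k)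
    rwa [neg_neg] at this

lemma sigma_mul_add_mul (σ : ℤˣ) (k : ℤ) (i : ℤ) : (σ : ℤ) * (k + σ * i) = σ * k + i := by
  rcases units_val_cases σ with h | h <;> rw [h] <;> ring

lemma pendingCount_le_edgeChain (hx : FollowsStacks ζ x) (hζ : ∀ k, IsRecurrent (ζ k)) (σ : ℤˣ)
    (n : ℕ) {k₀ : ℤ} {z₀ : ℕ} (h0 : pendingCount σ x n k₀ ≤ z₀) (i : ℕ) :
    pendingCount σ x n (k₀ + σ * i) ≤ edgeChain ζ σ k₀ z₀ i := by
  induction i with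
  | zero => simpa [edgeChain] using h0
  | succ i ih =>
    rw [show k₀ + σ * ((i + 1 : ℕ) : ℤ) = k₀ + σ * i + σ by push_cast; ring,
      hx.pendingCount_add, edgeChain, sigma_mul_add_mul]
    gcongr
    exact (hx.orientedLocalTime_le hζ σ n _).trans (oppositeBefore_mono (hζ _) _ ih)

lemma pendingCount_eq_edgeChain (hx : FollowsStacks ζ x) (σ : ℤˣ) {n : ℕ} {k₀ : ℤ}
    (h0 : (σ : ℤ) * x n < σ * k₀ ∨ (x n = k₀ ∧ x (n + 1) = x n - σ)) (i : ℕ) :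
    pendingCount σ x n (k₀ + σ * i) = edgeChain ζ σ k₀ (pendingCount σ x n k₀) i := by
  induction i with
  | zero => simp [edgeChain]
  | succ i ih =>
    rw [show k₀ + σ * ((i + 1 : ℕ) : ℤ) = k₀ + σ * i + σ by push_cast; ring,
      hx.pendingCount_add, edgeChain, sigma_mul_add_mul, ← ih]
    congr 1
    by_cases h : (σ : ℤ) * x n < σ * (k₀ + σ * i)
    · exact hx.orientedLocalTime_eq_of_lt σ h
    · rw [sigma_mul_add_mul] at h
      rcases h0 with h0 | ⟨h0, h1⟩
      · omega
      · subst h0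
        have hi : i = 0 := by omega
        subst hi
        simpa using hx.orientedLocalTime_eq_of_next σ h1

/-- If the chains on both sides die out, every oriented edge is crossed as often as desired:
otherwise they would bound the total number of steps. -/
lemma exists_le_orientedLocalTime (hx : FollowsStacks ζ x) (hζ : ∀ k, IsRecurrent (ζ k))
    (hdie : ∀ (σ : ℤˣ) (k₀ : ℤ) (z₀ : ℕ), ∃ i, immigrationTime σ k₀ ≤ i ∧
      edgeChain ζ σ k₀ z₀ i = 0) (s : ℤˣ) (j : ℤ) (r : ℕ) :
    ∃ n, r ≤ orientedLocalTime s x n j := by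
  by_contra! hlt
  have hside : ∀ (σ : ℤˣ) (k₀ : ℤ), (∀ n, pendingCount σ x n k₀ ≤ r) →
      (∃ V : ℕ → ℕ, ∀ n i, visits x n (k₀ + σ * (i : ℕ)) ≤ V i) ∧
        ∃ i : ℕ, ∀ n, (σ : ℤ) * x n < σ * k₀ + i := by
    intro σ k₀ h
    have hle := fun n i => hx.pendingCount_le_edgeChain hζ σ n (h n) i
    refine ⟨⟨fun i => edgeChain ζ σ k₀ r (i + 1) + edgeChain ζ σ k₀ r i, fun n i => ?_⟩, ?_⟩
    · rw [hx.visits_eq σ]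
      refine add_le_add ?_ ((orientedLocalTime_le_pendingCount σ n _).trans (hle n i))
      have h1 := hle n (i + 1)
      rw [show k₀ + σ * ((i + 1 : ℕ) : ℤ) = k₀ + σ * i + σ by push_cast; ring,
        hx.pendingCount_add] at h1
      exact le_trans (Nat.le_add_right _ _) h1
    · obtain ⟨i, -, hi⟩ := hdie σ k₀ r
      refine ⟨i, fun n => ?_⟩
      by_contra! hcon
      have h1 := hle n i
      rw [hi, pendingCount_of_le σ (by rw [sigma_mul_add_mul]; exact hcon)] at h1
      omega
  obtain ⟨⟨V₁, hV₁⟩, i₁, hi₁⟩ := hside s (j + s) fun n => by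
    rw [hx.pendingCount_add]
    have := hlt n
    split_ifs <;> omega
  obtain ⟨⟨V₂, hV₂⟩, i₂, hi₂⟩ := hside (-s) j fun n => by
    rw [pendingCount, neg_neg]
    have := hlt n
    split_ifs <;> omega
  -- the walk stays in the window `F`, where each site has a bounded number of visits
  obtain ⟨V, hV⟩ : ∃ V : ℤ → ℕ, ∀ n k, visits x n k ≤ V k := by
    have : ∀ k, ∃ v, ∀ n, visits x n k ≤ v := by
      intro k
      rcases lt_or_ge ((s : ℤ) * j) (s * k) with h | h
      · refine ⟨V₁ (s * k - s * j - 1).toNat, fun n => ?_⟩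
        convert hV₁ n (s * k - s * j - 1).toNat using 2
        rw [Int.toNat_of_nonneg (by omega)]
        rcases units_val_cases s with h' | h' <;> rw [h'] <;> ring
      · refine ⟨V₂ (s * j - s * k).toNat, fun n => ?_⟩
        convert hV₂ n (s * j - s * k).toNat using 2
        rw [Int.toNat_of_nonneg (by omega), Units.val_neg]
        rcases units_val_cases s with h' | h' <;> rw [h'] <;> ring
    choose V hV using this
    exact ⟨V, fun n k => hV k n⟩
  set F : Finset ℤ := Finset.Icc (-(|j| + i₁ + i₂ + 2)) (|j| + i₁ + i₂ + 2) with hF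
  have hxF : ∀ n, x n ∈ F := by
    intro n
    have h1 := hi₁ n
    have h2 := hi₂ n
    rw [hF, Finset.mem_Icc]
    rw [mul_add] at h1
    rw [Units.val_neg] at h2
    have h3 := le_abs_self j
    have h4 := neg_abs_le j
    rcases units_val_cases s with h' | h' <;> rw [h'] at h1 h2 <;> omega
  have hcount : ∀ n, n ≤ ∑ k ∈ F, V k := by
    intro n
    calc n = (Finset.range n).card := (Finset.card_range n).symm
      _ = ∑ k ∈ F, visits x n k :=
        Finset.card_eq_sum_card_fiberwise fun i _ => hxF i
      _ ≤ _ := Finset.sum_le_sum fun k _ => hV n k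
  have := hcount (∑ k ∈ F, V k + 1)
  omega

/-- One of the two chains that describe the local times at the inverse local time `T^s_{j,r}`. -/
def IsSideChain (s : ℤˣ) (j : ℤ) (r : ℕ) (σ : ℤˣ) (k₀ : ℤ) (z₀ : ℕ) : Prop :=
  (σ = s ∧ k₀ = j + s ∧ z₀ = r - 1 + if (s : ℤ) * j < 0 then 1 else 0) ∨
    (σ = -s ∧ k₀ = j ∧ z₀ = r)

/-- The deterministic Ray–Knight description: up to `1`, the stopped local time on an edge is twice
the value of one of the two chains. -/
lemma stoppedLocalTime_eq (hx : FollowsStacks ζ x) {s : ℤˣ} {j : ℤ} {r : ℕ} (hr : 1 ≤ r)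
    (hT : ∃ n, r ≤ orientedLocalTime s x n j) (e : ℤ) :
    ∃ σ k₀ z₀ i, IsSideChain s j r σ k₀ z₀ ∧ |k₀ + σ * (i : ℕ) - e| ≤ 1 ∧
      |(stoppedLocalTime s x j r e : ℤ) - 2 * edgeChain ζ σ k₀ z₀ i| ≤ 1 ∧
      (1 ≤ i → edgeChain ζ σ k₀ z₀ i = 0 → stoppedLocalTime s x j r e = 0) := by
  have hTr : r ≤ orientedLocalTime s x (inverseLocalTime s x j r) j := Nat.sInf_mem hT
  obtain ⟨n, hn⟩ : ∃ n, inverseLocalTime s x j r = n + 1 := by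
    refine Nat.exists_eq_succ_of_ne_zero fun h => ?_
    rw [h, orientedLocalTime_zero] at hTr
    omega
  have hlt : orientedLocalTime s x n j < r := by
    by_contra! hle
    have : inverseLocalTime s x j r ≤ n := Nat.sInf_le hle
    omega
  rw [hn, orientedLocalTime_succ] at hTr
  have hstep : x n = j ∧ x (n + 1) = j + s := by
    by_contra h
    rw [if_neg h] at hTr
    omega
  rw [if_pos hstep] at hTr
  obtain ⟨hxn, hxn1⟩ := hstep
  have hS : stoppedLocalTime s x j r e = edgeLocalTime x (n + 1) e := by
    rw [stoppedLocalTime, hn]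
  have hss : (s : ℤ) * s = 1 := by rcases units_val_cases s with h | h <;> rw [h] <;> norm_num
  -- the two chains
  have hfwd : ∀ i : ℕ, pendingCount s x n (j + s + s * i) =
      edgeChain ζ s (j + s) (r - 1 + if (s : ℤ) * j < 0 then 1 else 0) i := by
    intro i
    rw [hx.pendingCount_eq_edgeChain s (Or.inl (by rw [hxn, mul_add, hss]; omega)),
      hx.pendingCount_add, show orientedLocalTime s x n j = r - 1 by omega]
  have hbwd : ∀ i : ℕ, pendingCount (-s) x n (j + (-s : ℤˣ) * i) = edgeChain ζ (-s) j r i := by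
    intro i
    rw [hx.pendingCount_eq_edgeChain (-s) (Or.inr ⟨hxn, by rw [hxn1, hxn, Units.val_neg]; ring⟩),
      pendingCount_of_le (-s) (by rw [hxn]), neg_neg,
      show orientedLocalTime s x n j + 1 = r by omega]
  -- an edge seen from its end farther from the walker
  have hedge : ∀ (σ : ℤˣ) (k : ℤ), (σ : ℤ) * j < σ * k →
      pendingCount σ x n k = orientedLocalTime (-σ) x n k ∧
      orientedLocalTime σ x n (k - σ) ≤ pendingCount σ x n k ∧
      pendingCount σ x n k ≤ orientedLocalTime σ x n (k - σ) + 1 := by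
    intro σ k h
    refine ⟨pendingCount_of_lt σ (by rwa [hxn]), ?_⟩
    have := hx.pendingCount_add σ n (k - σ)
    rw [sub_add_cancel] at this
    rw [this]
    split_ifs <;> omega
  have hE : edgeLocalTime x (n + 1) e = edgeLocalTime x n e +
      if (s : ℤ) * e = s * j ∧ s = 1 ∨ (s : ℤ) * (e + 1) = s * j ∧ s = -1 then 1 else 0 := by
    unfold edgeLocalTime
    rw [orientedLocalTime_succ, orientedLocalTime_succ, hxn1, hxn]
    rcases Int.units_eq_one_or s with rfl | rfl <;> simp <;> split_ifs <;> omega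
  -- the far end of the edge `e` as seen from the walker
  by_cases hside : (s : ℤ) * j < s * e ∨ (s : ℤ) * j < s * (e + 1)
  · set k : ℤ := if s = 1 then e + 1 else e with hk
    have hk1 : (s : ℤ) * j < s * k := by
      rw [hk]
      rcases Int.units_eq_one_or s with rfl | rfl <;> simp at hside ⊢ <;> omega
    obtain ⟨i, hi⟩ : ∃ i : ℕ, k = j + s + s * i := by
      refine ⟨(s * k - s * j - 1).toNat, ?_⟩
      rw [Int.toNat_of_nonneg (by omega)]
      rcases units_val_cases s with h' | h' <;> rw [h'] <;> ring
    have hedge' := hedge s k hk1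
    have hZ := hfwd i
    rw [← hi] at hZ
    have hE2 : edgeLocalTime x n e = orientedLocalTime s x n (k - s) +
        orientedLocalTime (-s) x n k := by
      unfold edgeLocalTime
      rw [hk]
      rcases Int.units_eq_one_or s with rfl | rfl
      · simp
      · simp [add_comm]
    refine ⟨s, j + s, _, i, Or.inl ⟨rfl, rfl, rfl⟩, ?_, ?_, ?_⟩
    · rw [← hi, hk]; split_ifs <;> simp
    · rw [hS, hE, hE2, ← hZ, abs_le]
      push_cast
      split_ifs <;> omega
    · intro hi1 h0
      rw [hS, hE, hE2, if_neg]
      · omega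
      · intro hcon
        rcases Int.units_eq_one_or s with rfl | rfl <;> simp at hcon hk hi <;> omega
  · set k : ℤ := if s = 1 then e else e + 1 with hk
    have hk1 : ((-s : ℤˣ) : ℤ) * j < (-s : ℤˣ) * k := by
      rw [hk]
      rcases Int.units_eq_one_or s with rfl | rfl <;> simp at hside ⊢ <;> omega
    obtain ⟨i, hi⟩ : ∃ i : ℕ, k = j + (-s : ℤˣ) * i := by
      refine ⟨(((-s : ℤˣ) : ℤ) * k - (-s : ℤˣ) * j).toNat, ?_⟩
      rw [Int.toNat_of_nonneg (by omega)]
      rcases units_val_cases (-s) with h' | h' <;> rw [h'] <;> ring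
    have hedge' := hedge (-s) k hk1
    have hZ := hbwd i
    rw [← hi] at hZ
    have hE2 : edgeLocalTime x n e = orientedLocalTime (-s) x n (k - (-s : ℤˣ)) +
        orientedLocalTime (- -s) x n k := by
      unfold edgeLocalTime
      rw [hk]
      rcases Int.units_eq_one_or s with rfl | rfl
      · simp [add_comm]
      · simp
    have hno : ¬ ((s : ℤ) * e = s * j ∧ s = 1 ∨ (s : ℤ) * (e + 1) = s * j ∧ s = -1) := by
      intro hcon
      rcases Int.units_eq_one_or s with rfl | rfl <;> simp at hcon hside <;> omega
    refine ⟨-s, j, r, i, Or.inr ⟨rfl, rfl, rfl⟩, ?_, ?_, ?_⟩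
    · rw [← hi, hk]; split_ifs <;> simp
    · rw [hS, hE, hE2, ← hZ, if_neg hno, abs_le]
      omega
    · intro hi1 h0
      rw [hS, hE, hE2, if_neg hno]
      omega

end FollowsStacks

/-! ### The walk driven by independent uniform variables -/

/-- Position of the walk that follows the stacks `ζ`, together with the number of visits to each
site so far. -/
def stackState (ζ : ℤ → ℕ → ℤˣ) : ℕ → ℤ × (ℤ → ℕ)
  | 0 => (0, 0)
  | n + 1 => ((stackState ζ n).1 + ζ (stackState ζ n).1 ((stackState ζ n).2 (stackState ζ n).1),
      fun k => (stackState ζ n).2 k + if (stackState ζ n).1 = k then 1 else 0)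

/-- The walk that follows the stacks `ζ`. -/
def stackWalk (ζ : ℤ → ℕ → ℤˣ) (n : ℕ) : ℤ := (stackState ζ n).1

lemma followsStacks_stackWalk (ζ : ℤ → ℕ → ℤˣ) : FollowsStacks ζ (stackWalk ζ) := by
  have h : ∀ n, (stackState ζ n).2 = visits (stackWalk ζ) n := by
    intro n
    induction n with
    | zero => funext k; simp [stackState, visits]
    | succ n ih =>
      funext k
      rw [visits_succ, ← ih]
      rfl
  refine ⟨rfl, fun n => ?_⟩
  rw [← h]
  rfl

lemma measurable_stackState {Ω : Type*} [MeasurableSpace Ω] {ζ : Ω → ℤ → ℕ → ℤˣ}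
    (hζ : ∀ k t, Measurable fun ω => ζ ω k t) (n : ℕ) :
    Measurable fun ω => stackState (ζ ω) n := by
  induction n with
  | zero => exact measurable_const
  | succ n ih =>
    have h1 : Measurable fun ω => (stackState (ζ ω) n).1 := ih.fst
    have h2 : ∀ k, Measurable fun ω => (stackState (ζ ω) n).2 k := fun k =>
      (measurable_pi_apply k).comp ih.snd
    have h3 : Measurable fun ω => (stackState (ζ ω) n).2 (stackState (ζ ω) n).1 :=
      measurable_comp_countable (f := fun k ω => (stackState (ζ ω) n).2 k) h1 h2
    have h4 : Measurable fun ω =>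
        ζ ω (stackState (ζ ω) n).1 ((stackState (ζ ω) n).2 (stackState (ζ ω) n).1) :=
      measurable_comp_countable
        (Y := fun ω => ((stackState (ζ ω) n).1, (stackState (ζ ω) n).2 (stackState (ζ ω) n).1))
        (f := fun (a : ℤ × ℕ) ω => ζ ω a.1 a.2) (h1.prodMk h3) fun a => hζ a.1 a.2
    refine Measurable.prodMk (h1.add ((measurable_of_countable _).comp h4)) ?_
    refine measurable_pi_lambda _ fun k => (h2 k).add (Measurable.ite ?_ measurable_const
      measurable_const)
    exact h1 (measurableSet_singleton k)

lemma measurable_stackWalk_siteSteps (p : ℤ → ℝ) :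
    Measurable fun u : Driving => stackWalk (siteSteps p u) :=
  measurable_pi_lambda _ fun n => (measurable_stackState (fun k t => measurable_siteSteps k t) n).fst

/-! ### The law of the walk is determined by its transition rule -/

/-- The paths that agree with `x` up to time `n`. -/
def pathCylinder (x : ℕ → ℤ) (n : ℕ) : Set (ℕ → ℤ) := {y | ∀ i ≤ n, y i = x i}

lemma measurableSet_pathCylinder (x : ℕ → ℤ) (n : ℕ) : MeasurableSet (pathCylinder x n) := by
  have : pathCylinder x n = ⋂ i, ⋂ (_ : i ≤ n), (fun y : ℕ → ℤ => y i) ⁻¹' {x i} := by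
    ext y; simp [pathCylinder]
  rw [this]
  exact MeasurableSet.iInter fun i => MeasurableSet.iInter fun _ =>
    measurable_pi_apply i (measurableSet_singleton _)

lemma measurableSet_eval_eq (n : ℕ) (k : ℤ) : MeasurableSet {y : ℕ → ℤ | y n = k} := by
  have h : Measurable fun y : ℕ → ℤ => y n := measurable_pi_apply n
  exact h (measurableSet_singleton k)

/-- The transition rule of the self-repelling walk, as a property of a law on path space: given the
path `x` up to time `n`, the step is `s` with probability `p (s d)`, where `d` is the local time
difference. -/
structure HasStepLaw (p : ℤ → ℝ) (μ : Measure (ℕ → ℤ)) : Prop where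
  start : ∀ᵐ y ∂μ, y 0 = 0
  step : ∀ (n : ℕ) (x : ℕ → ℤ) (s : ℤˣ), μ (pathCylinder x n ∩ {y | y (n + 1) = x n + (s : ℤ)}) =
    μ (pathCylinder x n) * ENNReal.ofReal (p (s * localTimeDiff x n))

lemma pathCylinder_succ (x : ℕ → ℤ) (n : ℕ) :
    pathCylinder x (n + 1) = pathCylinder x n ∩ {y | y (n + 1) = x (n + 1)} := by
  ext y
  simp only [pathCylinder, Set.mem_ofPred_eq, Set.mem_inter_iff]
  constructor
  · exact fun h => ⟨fun i hi => h i (by omega), h _ le_rfl⟩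
  · rintro ⟨h1, h2⟩ i hi
    rcases Nat.lt_or_ge i (n + 1) with h | h
    · exact h1 i (by omega)
    · rw [show i = n + 1 by omega]; exact h2

namespace HasStepLaw

variable {p : ℤ → ℝ} {μ ν : Measure (ℕ → ℤ)}

lemma pathCylinder_succ_eq_zero (hp : IsRestoring p) [IsProbabilityMeasure μ]
    (hμ : HasStepLaw p μ) (x : ℕ → ℤ) (n : ℕ) (h : ∀ s : ℤˣ, x (n + 1) ≠ x n + s) :
    μ (pathCylinder x (n + 1)) = 0 := by
  have h1 := hμ.step n x 1
  have h2 := hμ.step n x (-1)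
  set E := pathCylinder x n
  set d := localTimeDiff x n
  have hp2 : ENNReal.ofReal (p ((1 : ℤˣ) * d)) + ENNReal.ofReal (p ((-1 : ℤˣ) * d)) = 1 := by
    rw [← ENNReal.ofReal_add (hp.nonneg _) (hp.nonneg _)]
    simp [hp.symm]
  have hm : ∀ s : ℤˣ, MeasurableSet (E ∩ {y | y (n + 1) = x n + (s : ℤ)}) := fun s =>
    (measurableSet_pathCylinder x n).inter (measurableSet_eval_eq _ _)
  have hdisj1 : Disjoint (E ∩ {y | y (n + 1) = x n + ((1 : ℤˣ) : ℤ)})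
      (E ∩ {y | y (n + 1) = x n + ((-1 : ℤˣ) : ℤ)}) := by
    rw [Set.disjoint_left]
    rintro y ⟨-, hy⟩ ⟨-, hy'⟩
    simp only [Set.mem_ofPred_eq, Units.val_one, Units.val_neg] at hy hy'
    omega
  have hdisj2 : Disjoint (E ∩ {y | y (n + 1) = x n + ((1 : ℤˣ) : ℤ)} ∪
      E ∩ {y | y (n + 1) = x n + ((-1 : ℤˣ) : ℤ)}) (pathCylinder x (n + 1)) := by
    rw [Set.disjoint_left, pathCylinder_succ]
    rintro y (⟨-, hy⟩ | ⟨-, hy⟩) ⟨-, hy'⟩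
    · exact h 1 (hy'.symm.trans hy)
    · exact h (-1) (hy'.symm.trans hy)
  have hle : μ E + μ (pathCylinder x (n + 1)) ≤ μ E + 0 := by
    calc μ E + μ (pathCylinder x (n + 1))
        = μ ((E ∩ {y | y (n + 1) = x n + ((1 : ℤˣ) : ℤ)} ∪
          E ∩ {y | y (n + 1) = x n + ((-1 : ℤˣ) : ℤ)}) ∪ pathCylinder x (n + 1)) := by
          rw [measure_union hdisj2 (measurableSet_pathCylinder _ _), measure_union hdisj1 (hm _),
            h1, h2, ← mul_add, hp2, mul_one]
      _ ≤ μ E := by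
          refine measure_mono ?_
          rw [pathCylinder_succ]
          rintro y ((⟨hy, -⟩ | ⟨hy, -⟩) | ⟨hy, -⟩) <;> exact hy
      _ = μ E + 0 := (add_zero _).symm
  exact le_zero_iff.1 ((ENNReal.add_le_add_iff_left (measure_ne_top _ _)).1 hle)

lemma pathCylinder_eq (hp : IsRestoring p) [IsProbabilityMeasure μ] [IsProbabilityMeasure ν]
    (hμ : HasStepLaw p μ) (hν : HasStepLaw p ν) (x : ℕ → ℤ) (n : ℕ) :
    μ (pathCylinder x n) = ν (pathCylinder x n) := by
  induction n with
  | zero =>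
    have key : ∀ {μ : Measure (ℕ → ℤ)} [IsProbabilityMeasure μ], HasStepLaw p μ →
        μ (pathCylinder x 0) = if x 0 = 0 then 1 else 0 := by
      intro μ _ hμ
      have hnull : μ {y : ℕ → ℤ | ¬y 0 = 0} = 0 := ae_iff.1 hμ.start
      split_ifs with h
      · rw [← prob_compl_eq_zero_iff (measurableSet_pathCylinder x 0)]
        refine measure_mono_null ?_ hnull
        intro y hy h0
        refine hy fun i hi => ?_
        rw [Nat.le_zero.1 hi, h0, h]
      · refine measure_mono_null ?_ hnull
        intro y hy h0
        exact h ((hy 0 le_rfl).symm.trans h0)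
    rw [key hμ, key hν]
  | succ n ih =>
    by_cases h : ∃ s : ℤˣ, x (n + 1) = x n + s
    · obtain ⟨s, hs⟩ := h
      rw [pathCylinder_succ, hs, hμ.step, hν.step, ih]
    · push Not at h
      rw [hμ.pathCylinder_succ_eq_zero hp x n h, hν.pathCylinder_succ_eq_zero hp x n h]

/-- The transition rule determines the law on path space. -/
lemma unique (hp : IsRestoring p) [IsProbabilityMeasure μ] [IsProbabilityMeasure ν]
    (hμ : HasStepLaw p μ) (hν : HasStepLaw p ν) : μ = ν := by
  have hproj : IsProjectiveMeasureFamily fun I : Finset ℕ => μ.map I.restrict :=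
    isProjectiveMeasureFamily_map_restrict (X := fun n (y : ℕ → ℤ) => y n)
      fun n => (measurable_pi_apply n).aemeasurable
  have h1 : IsProjectiveLimit μ fun I : Finset ℕ => μ.map I.restrict := fun I => rfl
  have h2 : IsProjectiveLimit ν fun I : Finset ℕ => μ.map I.restrict := by
    rw [isProjectiveLimit_nat_iff hproj]
    intro n
    refine Measure.ext_of_singleton fun z => ?_
    set x : ℕ → ℤ := fun i => if h : i ≤ n then z ⟨i, Finset.mem_Iic.2 h⟩ else 0 with hx
    have hpre : (Preorder.frestrictLe n : (ℕ → ℤ) → _) ⁻¹' {z} = pathCylinder x n := by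
      ext y
      simp only [Set.mem_preimage, Set.mem_singleton_iff, pathCylinder, Set.mem_ofPred_eq]
      constructor
      · rintro rfl i hi
        simp [hx, hi]
      · intro h
        funext ⟨i, hi⟩
        have hi' := Finset.mem_Iic.1 hi
        have := h i hi'
        simp only [hx, hi', dif_pos] at this
        exact this
    have hmap : ∀ ρ : Measure (ℕ → ℤ), ρ.map (Preorder.frestrictLe n) {z} =
        ρ (pathCylinder x n) := by
      intro ρ
      rw [Measure.map_apply (Preorder.measurable_frestrictLe n) (measurableSet_singleton z), hpre]
    rw [hmap]
    exact (pathCylinder_eq hp hν hμ x n).trans (hmap μ).symm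
  have : ∀ I : Finset ℕ, IsFiniteMeasure (μ.map I.restrict) := fun I => inferInstance
  exact h1.unique h2

end HasStepLaw

lemma localTimeDiff_congr {x y : ℕ → ℤ} {n : ℕ} (h : ∀ i ≤ n, y i = x i) :
    localTimeDiff y n = localTimeDiff x n := by
  have h1 : ∀ s k, orientedLocalTime s y n k = orientedLocalTime s x n k := by
    intro s k
    unfold orientedLocalTime
    congr 1
    refine Finset.filter_congr fun j hj => ?_
    rw [Finset.mem_range] at hj
    rw [h j (by omega), h (j + 1) (by omega)]
  unfold localTimeDiff
  rw [h n le_rfl, h1, h1]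

lemma visits_congr {x y : ℕ → ℤ} {n : ℕ} (h : ∀ i < n, y i = x i) (k : ℤ) :
    visits y n k = visits x n k := by
  unfold visits
  congr 1
  refine Finset.filter_congr fun j hj => ?_
  rw [h j (Finset.mem_range.1 hj)]

section DrivenWalk

variable {p : ℤ → ℝ}

lemma measurableSet_coordAlg_pathCylinder (x : ℕ → ℤ) (n : ℕ) :
    MeasurableSet[coordAlg {a | a.2 < visits x n a.1}]
      {u : Driving | stackWalk (siteSteps p u) ∈ pathCylinder x n} := by
  induction n with
  | zero =>
    have : {u : Driving | stackWalk (siteSteps p u) ∈ pathCylinder x 0} =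
        {_u | 0 = x 0} := by
      ext u
      simp only [pathCylinder, Set.mem_ofPred_eq, Nat.le_zero, forall_eq]
      rw [(followsStacks_stackWalk _).1]
    rw [this]
    exact MeasurableSet.const _
  | succ n ih =>
    have : {u : Driving | stackWalk (siteSteps p u) ∈ pathCylinder x (n + 1)} =
        {u : Driving | stackWalk (siteSteps p u) ∈ pathCylinder x n} ∩
          (fun u => siteSteps p u (x n) (visits x n (x n))) ⁻¹' {s | x (n + 1) = x n + (s : ℤ)} := by
      ext u
      rw [pathCylinder_succ]
      simp only [Set.mem_ofPred_eq, Set.mem_inter_iff, Set.mem_preimage]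
      refine and_congr_right fun h => ?_
      rw [(followsStacks_stackWalk _).2, h n le_rfl, visits_congr fun i hi => h i hi.le, eq_comm]
    rw [this]
    refine MeasurableSet.inter (coordAlg_mono (fun a ha => ?_) _ ih) ?_
    · simp only [Set.mem_ofPred_eq] at ha ⊢
      rw [visits_succ]
      omega
    · refine (@measurable_siteStep Driving (coordAlg _) p (fun u t => u (x n, t)) _
        fun t ht => measurable_coord ?_) (Set.toFinite _).measurableSet
      simp only [Set.mem_ofPred_eq]
      rw [visits_succ]
      simp
      omega

/-- The walk driven by the uniform variables obeys the transition rule, since each step uses a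
variable that the past has not seen. -/
lemma hasStepLaw_stackWalk (hp : IsRestoring p) :
    HasStepLaw p (drivingLaw.map fun u => stackWalk (siteSteps p u)) := by
  have hm := measurable_stackWalk_siteSteps p
  refine ⟨?_, fun n x s => ?_⟩
  · rw [ae_map_iff hm.aemeasurable (measurableSet_eval_eq 0 0)]
    exact Eventually.of_forall fun u => (followsStacks_stackWalk _).1
  · rw [Measure.map_apply hm (measurableSet_pathCylinder x n),
      Measure.map_apply hm ((measurableSet_pathCylinder x n).inter (measurableSet_eval_eq _ _))]
    set d := localTimeDiff x n with hd
    set E : Set Driving := {u | stackWalk (siteSteps p u) ∈ pathCylinder x n} with hE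
    set G : Set unitInterval := {a | (if (a : ℝ) < p d then (1 : ℤˣ) else -1) = s} with hG
    have hlt : MeasurableSet {a : unitInterval | (a : ℝ) < p d} :=
      measurableSet_lt measurable_subtype_coe measurable_const
    have hGm : MeasurableSet G :=
      (Measurable.ite hlt measurable_const measurable_const) (measurableSet_singleton s)
    set c : ℤ × ℕ := (x n, visits x n (x n)) with hc
    have hset : (fun u => stackWalk (siteSteps p u)) ⁻¹'
        (pathCylinder x n ∩ {y | y (n + 1) = x n + (s : ℤ)}) =
        E ∩ (fun u : Driving => u c) ⁻¹' G := by
      ext u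
      simp only [Set.mem_preimage, Set.mem_inter_iff, hE, Set.mem_ofPred_eq, hG]
      refine and_congr_right fun h => ?_
      have hf := followsStacks_stackWalk (siteSteps p u)
      have hdiff : siteDiff p (fun t => u (x n, t)) (visits x n (x n)) = d := by
        rw [hd, ← localTimeDiff_congr h, localTimeDiff, hf.orientedLocalTime_eq,
          hf.orientedLocalTime_eq, siteDiff_eq_signCount_sub, h n le_rfl,
          visits_congr fun i hi => h i hi.le]
      rw [hf.2, h n le_rfl, visits_congr (fun i hi => h i hi.le), add_right_inj, Units.val_inj,
        ← hdiff]
      rfl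
    have hGp : drivingLaw ((fun u : Driving => u c) ⁻¹' G) = ENNReal.ofReal (p (s * d)) := by
      have h1 := drivingLaw_lt c (hp.nonneg d) (hp.le_one d)
      rcases Int.units_eq_one_or s with rfl | rfl
      · have : (fun u : Driving => u c) ⁻¹' G = {u | (u c : ℝ) < p d} := by
          ext u
          simp only [hG, Set.mem_preimage, Set.mem_ofPred_eq]
          split_ifs with h <;> simp [h]
        rw [this, h1]
        simp
      · have : (fun u : Driving => u c) ⁻¹' G = {u | (u c : ℝ) < p d}ᶜ := by
          ext u
          simp only [hG, Set.mem_preimage, Set.mem_ofPred_eq, Set.mem_compl_iff]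
          split_ifs with h <;> simp [h]
        have hms : MeasurableSet {u : Driving | (u c : ℝ) < p d} :=
          measurableSet_lt (measurable_subtype_coe.comp (measurable_pi_apply c)) measurable_const
        rw [this, prob_compl_eq_one_sub hms, h1, ← ENNReal.ofReal_one,
          ← ENNReal.ofReal_sub _ (hp.nonneg d)]
        simp [hp.symm]
    rw [hset, ← hGp]
    have hdisj : Disjoint {a : ℤ × ℕ | a.2 < visits x n a.1} {c} := by
      rw [Set.disjoint_singleton_right]
      simp [hc]
    have hGc : MeasurableSet[coordAlg {c}] ((fun u : Driving => u c) ⁻¹' G) :=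
      (measurable_coord (S := {c}) (Set.mem_singleton c)) hGm
    have hEc : MeasurableSet[coordAlg {a | a.2 < visits x n a.1}] E :=
      measurableSet_coordAlg_pathCylinder x n
    exact (Indep_iff _ _ _).1 (indep_coordAlg hdisj) _ _ hEc hGc

end DrivenWalk

/-! ### The up-probability of the self-repelling walk -/

/-- The probability of a step to the right when the local time difference is `d`. -/
noncomputable def upProb (w : ℤ → ℝ) (d : ℤ) : ℝ := w (-d) / (w d + w (-d))

section UpProb

variable {w : ℤ → ℝ}

lemma add_neg_pos (hw_nonneg : ∀ z, 0 ≤ w z) (hw_zero : 0 < w 0) (hw_mono : Monotone w) (d : ℤ) :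
    0 < w d + w (-d) := by
  rcases le_total 0 d with h | h
  · have := hw_mono h
    have := hw_nonneg (-d)
    linarith
  · have := hw_mono (show 0 ≤ -d by omega)
    have := hw_nonneg d
    linarith

lemma isRestoring_upProb (hw_nonneg : ∀ z, 0 ≤ w z) (hw_zero : 0 < w 0) (hw_mono : Monotone w)
    (hw_nonconst : ∃ a b, w a ≠ w b) : IsRestoring (upProb w) where
  nonneg d := div_nonneg (hw_nonneg _) (add_neg_pos hw_nonneg hw_zero hw_mono d).le
  symm d := by
    have := add_neg_pos hw_nonneg hw_zero hw_mono d
    unfold upProb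
    rw [neg_neg, add_comm (w (-d)), eq_sub_iff_add_eq, ← add_div, div_self this.ne']
  tail := by
    obtain ⟨a, b, hab⟩ := hw_nonconst
    set M : ℕ := a.natAbs + b.natAbs with hM
    have hlt : w (-M) < w M := by
      refine lt_of_le_of_ne (hw_mono (by omega)) fun h => hab ?_
      have h1 : ∀ c : ℤ, -M ≤ c → c ≤ M → w c = w M := fun c h2 h3 =>
        le_antisymm (hw_mono h3) (h ▸ hw_mono h2)
      rw [h1 a (by omega) (by omega), h1 b (by omega) (by omega)]
    refine ⟨w (-M) / (w M + w (-M)), ?_, M, fun d hd => ?_⟩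
    · rw [div_lt_iff₀ (add_neg_pos hw_nonneg hw_zero hw_mono M)]
      linarith
    · unfold upProb
      rw [div_le_div_iff₀ (add_neg_pos hw_nonneg hw_zero hw_mono d)
        (add_neg_pos hw_nonneg hw_zero hw_mono M)]
      have h1 := hw_mono hd
      have h2 := hw_mono (show -d ≤ -M by omega)
      have h3 := hw_nonneg (-d)
      have h4 := hw_nonneg M
      nlinarith [mul_le_mul h2 h1 h4 (hw_nonneg (-M))]

/-- The conditional probabilities in the definition of the walk give the transition rule. -/
lemma hasStepLaw_map {Ω : Type*} [MeasurableSpace Ω] {P : Measure Ω} [IsProbabilityMeasure P]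
    {X : ℕ → Ω → ℤ} (hX : IsSelfRepellingWalk P w X) :
    HasStepLaw (upProb w) (P.map fun ω n => X n ω) := by
  have hm : Measurable fun ω n => X n ω := measurable_pi_lambda _ hX.measurable
  refine ⟨?_, fun n x s => ?_⟩
  · rw [ae_map_iff hm.aemeasurable (measurableSet_eval_eq 0 0)]
    exact hX.start
  · rw [Measure.map_apply hm (measurableSet_pathCylinder x n),
      Measure.map_apply hm ((measurableSet_pathCylinder x n).inter (measurableSet_eval_eq _ _))]
    set ℱ := Filtration.natural X (fun i => (hX.measurable i).stronglyMeasurable) with hℱ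
    set E : Set Ω := (fun ω n => X n ω) ⁻¹' pathCylinder x n with hE
    set S : Set Ω := {ω | X (n + 1) ω = X n ω + (s : ℤ)} with hS
    have hEm : MeasurableSet[ℱ n] E := by
      have : E = ⋂ i, ⋂ (_ : i ≤ n), X i ⁻¹' {x i} := by
        ext ω; simp [hE, pathCylinder]
      rw [this]
      refine MeasurableSet.iInter fun i => MeasurableSet.iInter fun hi => ?_
      exact (le_iSup₂ (f := fun j (_ : j ≤ n) => MeasurableSpace.comap (X j) inferInstance) i hi)
        _ ⟨{x i}, measurableSet_singleton _, rfl⟩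
    have hEm' : MeasurableSet E := ℱ.le n _ hEm
    have hSm : MeasurableSet S := measurableSet_eq_fun (hX.measurable _)
      ((hX.measurable n).add_const _)
    have hset : (fun ω n => X n ω) ⁻¹' (pathCylinder x n ∩ {y | y (n + 1) = x n + (s : ℤ)}) =
        E ∩ S := by
      ext ω
      simp only [Set.mem_preimage, Set.mem_inter_iff, hE, hS, Set.mem_ofPred_eq]
      refine and_congr_right fun h => ?_
      have h' : X n ω = x n := h n le_rfl
      rw [h']
    rw [hset]
    set q := upProb w (s * localTimeDiff x n) with hq
    have hint : Integrable (S.indicator fun _ => (1 : ℝ)) P :=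
      (integrable_const 1).indicator hSm
    have h1 := setIntegral_condExp (ℱ.le n) hint hEm
    have h2 : ∫ ω in E, (P[S.indicator (fun _ => (1 : ℝ)) | ℱ n]) ω ∂P = ∫ _ in E, q ∂P := by
      refine setIntegral_congr_ae hEm' ?_
      filter_upwards [hX.step n s] with ω hω hωE
      rw [hω, localTimeDiff_congr (y := fun i => X i ω) hωE, hq, upProb]
      rcases Int.units_eq_one_or s with rfl | rfl
      · simp
      · simp [add_comm]
    rw [h2, setIntegral_const, setIntegral_indicator hSm, setIntegral_const] at h1
    simp only [smul_eq_mul, mul_one] at h1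
    rw [← ENNReal.ofReal_toReal (measure_ne_top P (E ∩ S)),
      ← ENNReal.ofReal_toReal (measure_ne_top P E), ← ENNReal.ofReal_mul ENNReal.toReal_nonneg]
    exact congrArg ENNReal.ofReal h1.symm

/-- The self-repelling walk has the law of the walk driven by uniform variables. -/
lemma map_eq_map_stackWalk {Ω : Type*} [MeasurableSpace Ω] {P : Measure Ω}
    [IsProbabilityMeasure P] (hp : IsRestoring (upProb w)) {X : ℕ → Ω → ℤ}
    (hX : IsSelfRepellingWalk P w X) {G : Set (ℕ → ℤ)} (hG : MeasurableSet G) :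
    P {ω | (fun n => X n ω) ∈ G} = drivingLaw {u | stackWalk (siteSteps (upProb w) u) ∈ G} := by
  have hm : Measurable fun ω n => X n ω := measurable_pi_lambda _ hX.measurable
  have hm' := measurable_stackWalk_siteSteps (upProb w)
  have h1 : IsProbabilityMeasure (P.map fun ω n => X n ω) :=
    Measure.isProbabilityMeasure_map hm.aemeasurable
  have h2 : IsProbabilityMeasure (drivingLaw.map fun u => stackWalk (siteSteps (upProb w) u)) :=
    Measure.isProbabilityMeasure_map hm'.aemeasurable
  have h := HasStepLaw.unique hp (hasStepLaw_map hX) (hasStepLaw_stackWalk hp)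
  have h3 := congrArg (fun ρ => ρ G) h
  simp only [Measure.map_apply hm hG, Measure.map_apply hm' hG] at h3
  exact h3

end UpProb


/-! ### The triangular profile of the stopped local times -/

/-- Up to the error `δ A`, the local times stopped at `T^s_{j,r}` form the triangle
`e ↦ (|j| - |e| + 2 r)₊`, and they vanish outside a neighbourhood of its base. -/
structure HasTriangularProfile (δ A : ℝ) (s : ℤˣ) (j : ℤ) (r : ℕ) (x : ℕ → ℤ) : Prop where
  abs_sub_le : ∀ e : ℤ,
    |(stoppedLocalTime s x j r e : ℝ) - max (|(j : ℝ)| - |(e : ℝ)| + 2 * r) 0| ≤ δ * A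
  eq_zero : ∀ e : ℤ, |(j : ℝ)| + 2 * r + δ * A ≤ |(e : ℝ)| → stoppedLocalTime s x j r e = 0

lemma measurable_orientedLocalTime (s : ℤˣ) (n : ℕ) (k : ℤ) :
    Measurable fun x : ℕ → ℤ => orientedLocalTime s x n k := by
  induction n with
  | zero => simp only [orientedLocalTime_zero]; exact measurable_const
  | succ n ih =>
    simp only [orientedLocalTime_succ]
    exact ih.add (Measurable.ite ((measurableSet_eval_eq _ _).inter (measurableSet_eval_eq _ _))
      measurable_const measurable_const)

lemma measurable_stoppedLocalTime (s : ℤˣ) (j : ℤ) (r : ℕ) (e : ℤ) :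
    Measurable fun x : ℕ → ℤ => stoppedLocalTime s x j r e := by
  have hT : Measurable fun x : ℕ → ℤ => inverseLocalTime s x j r :=
    measurable_sInf_nat fun n => measurable_orientedLocalTime s n j (measurableSet_Ici (a := r))
  exact measurable_comp_countable (f := fun n x => edgeLocalTime x n e) hT fun n =>
    (measurable_orientedLocalTime _ _ _).add (measurable_orientedLocalTime _ _ _)

lemma measurableSet_exists_le_orientedLocalTime (s : ℤˣ) (j : ℤ) (r : ℕ) :
    MeasurableSet {x : ℕ → ℤ | ∃ n, r ≤ orientedLocalTime s x n j} := by
  have : {x : ℕ → ℤ | ∃ n, r ≤ orientedLocalTime s x n j} =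
      ⋃ n, {x | r ≤ orientedLocalTime s x n j} := by
    ext x; simp
  rw [this]
  exact MeasurableSet.iUnion fun n =>
    measurable_orientedLocalTime s n j (measurableSet_Ici (a := r))

lemma measurableSet_hasTriangularProfile (δ A : ℝ) (s : ℤˣ) (j : ℤ) (r : ℕ) :
    MeasurableSet {x | HasTriangularProfile δ A s j r x} := by
  have : {x | HasTriangularProfile δ A s j r x} =
      ⋂ e : ℤ, {x | |(stoppedLocalTime s x j r e : ℝ) - max (|(j : ℝ)| - |(e : ℝ)| + 2 * r) 0|
        ≤ δ * A ∧ (|(j : ℝ)| + 2 * r + δ * A ≤ |(e : ℝ)| → stoppedLocalTime s x j r e = 0)} := by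
    ext x
    simp only [Set.mem_ofPred_eq, Set.mem_iInter]
    exact ⟨fun h e => ⟨h.1 e, h.2 e⟩, fun h => ⟨fun e => (h e).1, fun e => (h e).2⟩⟩
  rw [this]
  refine MeasurableSet.iInter fun e => ?_
  exact measurable_stoppedLocalTime s j r e (MeasurableSet.of_discrete (s := {m : ℕ |
    |(m : ℝ) - max (|(j : ℝ)| - |(e : ℝ)| + 2 * r) 0| ≤ δ * A ∧
      (|(j : ℝ)| + 2 * r + δ * A ≤ |(e : ℝ)| → m = 0)}))

/-- The profiles of the two chains are the two sides of one triangle. -/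
lemma two_mul_chainProfile (σ : ℤˣ) (k₀ : ℤ) (z₀ i : ℕ) :
    2 * chainProfile z₀ (immigrationTime σ k₀) i =
      max (2 * z₀ + |(k₀ : ℝ)| - |((k₀ + σ * (i : ℕ) : ℤ) : ℝ)|) 0 := by
  have key : 2 * min (i : ℤ) (immigrationTime σ k₀) - i = |k₀| - |k₀ + σ * (i : ℕ)| := by
    unfold immigrationTime
    rcases units_val_cases σ with h | h <;> rw [h] <;> simp only [abs_eq_max_neg] <;> omega
  have key' : 2 * min (i : ℝ) (immigrationTime σ k₀) - i =
      |(k₀ : ℝ)| - |((k₀ + σ * (i : ℕ) : ℤ) : ℝ)| := by exact_mod_cast key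
  unfold chainProfile
  rw [mul_max_of_nonneg _ _ (by norm_num : (0 : ℝ) ≤ 2)]
  congr 1
  · linarith
  · simp

lemma immigrationTime_le (σ : ℤˣ) (k₀ : ℤ) : (immigrationTime σ k₀ : ℤ) ≤ |k₀| := by
  unfold immigrationTime
  rcases units_val_cases σ with h | h <;> rw [h] <;> simp only [abs_eq_max_neg] <;> omega

/-- If both chains follow their profiles, the stopped local times follow the triangle. -/
lemma FollowsStacks.hasTriangularProfile {ζ : ℤ → ℕ → ℤˣ} {x : ℕ → ℤ} (hx : FollowsStacks ζ x)
    {s : ℤˣ} {j : ℤ} {r : ℕ} {δ A : ℝ} (hr : 1 ≤ r) (hδA : 10 ≤ δ * A)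
    (hT : ∃ n, r ≤ orientedLocalTime s x n j)
    (h : ∀ σ k₀ z₀, FollowsStacks.IsSideChain s j r σ k₀ z₀ →
      FollowsProfile (δ / 4) A z₀ (immigrationTime σ k₀) (edgeChain ζ σ k₀ z₀)) :
    HasTriangularProfile δ A s j r x := by
  have hside : ∀ σ k₀ z₀, FollowsStacks.IsSideChain s j r σ k₀ z₀ →
      |k₀ - j| ≤ 1 ∧ (z₀ : ℤ) ≤ r ∧ (r : ℤ) ≤ z₀ + 1 := by
    rintro σ k₀ z₀ (⟨rfl, rfl, rfl⟩ | ⟨rfl, rfl, rfl⟩)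
    · refine ⟨?_, ?_, ?_⟩
      · rcases units_val_cases σ with h | h <;> rw [h] <;> simp
      · split_ifs <;> omega
      · split_ifs <;> omega
    · simp
  refine ⟨fun e => ?_, fun e he => ?_⟩
  · obtain ⟨σ, k₀, z₀, i, hc, h1, h2, -⟩ := hx.stoppedLocalTime_eq hr hT e
    obtain ⟨h3, h4, h5⟩ := hside σ k₀ z₀ hc
    have h6 := (h σ k₀ z₀ hc).1 i
    have h7 := two_mul_chainProfile σ k₀ z₀ i
    set k : ℤ := k₀ + σ * (i : ℕ) with hk
    have h2' : |(stoppedLocalTime s x j r e : ℝ) - 2 * edgeChain ζ σ k₀ z₀ i| ≤ 1 := by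
      exact_mod_cast h2
    have h8 : |((2 * z₀ + |k₀| - |k| : ℤ) : ℝ) - (|j| - |e| + 2 * r : ℤ)| ≤ 4 := by
      have : |(2 * z₀ + |k₀| - |k|) - (|j| - |e| + 2 * r)| ≤ 4 := by
        simp only [abs_eq_max_neg] at h1 h3 ⊢
        omega
      exact_mod_cast this
    have h9 := (abs_max_sub_max_le_abs ((2 * z₀ + |k₀| - |k| : ℤ) : ℝ)
      (|j| - |e| + 2 * r : ℤ) 0).trans h8
    push_cast at h9
    rw [← h7] at h9
    rw [abs_le] at h2' h6 h9 ⊢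
    constructor <;> linarith [h2'.1, h2'.2, h6.1, h6.2, h9.1, h9.2]
  · obtain ⟨σ, k₀, z₀, i, hc, h1, -, h2⟩ := hx.stoppedLocalTime_eq hr hT e
    obtain ⟨h3, h4, h5⟩ := hside σ k₀ z₀ hc
    -- an integer lower bound for `δ A`
    obtain ⟨m, hm⟩ : ∃ m : ℕ, (m : ℝ) ≤ δ * A ∧ δ * A < m + 1 :=
      ⟨⌊δ * A⌋₊, Nat.floor_le (by linarith), Nat.lt_floor_add_one _⟩
    have hm10 : 10 ≤ m := by
      have : (10 : ℝ) < m + 1 := by linarith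
      have : 10 < m + 1 := by exact_mod_cast this
      omega
    have he' : |j| + 2 * r + m ≤ |e| := by
      have : |(j : ℝ)| + 2 * r + m ≤ |(e : ℝ)| := by linarith
      exact_mod_cast this
    have hi : 2 * ((z₀ : ℤ) + immigrationTime σ k₀) + m - 2 ≤ i := by
      unfold immigrationTime
      rcases units_val_cases σ with h' | h' <;> rw [h'] at h1 ⊢ <;>
        simp only [abs_eq_max_neg] at h1 h3 he' ⊢ <;> omega
    have hi' : 2 * ((z₀ : ℝ) + immigrationTime σ k₀) + m - 2 ≤ i := by exact_mod_cast hi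
    refine h2 (by omega) ((h σ k₀ z₀ hc).2 i ?_)
    linarith

/-- Law of large numbers of Ray–Knight type: the walk driven by the uniform variables has a
triangular profile with high probability. -/
lemma exists_drivingLaw_not_hasTriangularProfile_le {p : ℤ → ℝ} (hp : IsRestoring p) {C δ γ : ℝ}
    (hC : 0 < C) (hδ : 0 < δ) (hγ : 0 < γ) :
    ∀ᶠ A : ℝ in atTop, ∀ (s : ℤˣ) (j : ℤ) (r : ℕ), 1 ≤ r → |(j : ℝ)| + r ≤ C * A →
      drivingLaw {u | ¬ HasTriangularProfile δ A s j r (stackWalk (siteSteps p u))} ≤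
        ENNReal.ofReal γ := by
  filter_upwards [exists_drivingLaw_not_followsProfile_le hp (C := C + 1) (δ := δ / 4)
    (γ := γ / 2) (by linarith) (by linarith) (by linarith), eventually_ge_atTop 1,
    eventually_ge_atTop (10 / δ)] with A hA hA1 hAδ s j r hr hjr
  have hδA : 10 ≤ δ * A := by rwa [div_le_iff₀ hδ, mul_comm] at hAδ
  set B : ℤˣ → ℤ → ℕ → Set Driving := fun σ k₀ z₀ =>
    {u | ¬ FollowsProfile (δ / 4) A z₀ (immigrationTime σ k₀) (edgeChain (siteSteps p u) σ k₀ z₀)}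
    with hB
  set z₁ : ℕ := r - 1 + if (s : ℤ) * j < 0 then 1 else 0 with hz₁
  have hz₁r : z₁ ≤ r := by rw [hz₁]; split_ifs <;> omega
  have hbound : ∀ (σ : ℤˣ) (k₀ : ℤ) (z₀ : ℕ), |k₀| ≤ |j| + 1 → z₀ ≤ r →
      drivingLaw (B σ k₀ z₀) ≤ ENNReal.ofReal (γ / 2) := by
    intro σ k₀ z₀ hk hz
    refine hA σ k₀ z₀ ?_
    have h1 := immigrationTime_le σ k₀
    have h2 : (z₀ + immigrationTime σ k₀ : ℤ) ≤ |j| + r + 1 := by omega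
    have h3 : (z₀ + immigrationTime σ k₀ : ℝ) ≤ |(j : ℝ)| + r + 1 := by exact_mod_cast h2
    linarith
  have hsub : ({u | ¬ HasTriangularProfile δ A s j r (stackWalk (siteSteps p u))} : Set Driving)
      ≤ᵐ[drivingLaw] (B s (j + s) z₁ ∪ B (-s) j r : Set Driving) := by
    filter_upwards [ae_isRecurrent hp, ae_exists_edgeChain_eq_zero hp] with u hrec hdie hu
    by_contra hnot
    have hnot' : u ∉ B s (j + s) z₁ ∧ u ∉ B (-s) j r :=
      ⟨fun h => hnot (Or.inl h), fun h => hnot (Or.inr h)⟩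
    simp only [hB, Set.mem_ofPred_eq, not_not] at hnot'
    have hf := followsStacks_stackWalk (siteSteps p u)
    refine hu (hf.hasTriangularProfile hr hδA (hf.exists_le_orientedLocalTime hrec hdie s j r) ?_)
    rintro σ k₀ z₀ (⟨rfl, rfl, rfl⟩ | ⟨rfl, rfl, rfl⟩)
    exacts [hnot'.1, hnot'.2]
  calc drivingLaw {u | ¬ HasTriangularProfile δ A s j r (stackWalk (siteSteps p u))}
      ≤ drivingLaw (B s (j + s) z₁ ∪ B (-s) j r) := measure_mono_ae hsub
    _ ≤ drivingLaw (B s (j + s) z₁) + drivingLaw (B (-s) j r) := measure_union_le _ _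
    _ ≤ ENNReal.ofReal (γ / 2) + ENNReal.ofReal (γ / 2) := by
        refine add_le_add (hbound _ _ _ ?_ hz₁r) (hbound _ _ _ (by omega) le_rfl)
        rcases units_val_cases s with h | h <;> rw [h] <;> simp only [abs_eq_max_neg] <;> omega
    _ = ENNReal.ofReal γ := by
        rw [← ENNReal.ofReal_add (by linarith) (by linarith)]; congr 1; ring

/-! ### Rescaling -/

namespace HasTriangularProfile

variable {δ A : ℝ} {s : ℤˣ} {j : ℤ} {r : ℕ} {x : ℕ → ℤ}

lemma pos_of_lt (h : HasTriangularProfile δ A s j r x) {e : ℤ}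
    (he : |(e : ℝ)| < |(j : ℝ)| + 2 * r - δ * A) : 0 < stoppedLocalTime s x j r e := by
  by_contra! h0
  have h1 := h.abs_sub_le e
  rw [Nat.le_zero.1 h0] at h1
  have h2 := le_max_left (|(j : ℝ)| - |(e : ℝ)| + 2 * r) 0
  have h3 := neg_le_of_abs_le h1
  push_cast at h3
  linarith

lemma lt_of_pos (h : HasTriangularProfile δ A s j r x) {e : ℤ}
    (he : 0 < stoppedLocalTime s x j r e) : |(e : ℝ)| < |(j : ℝ)| + 2 * r + δ * A := by
  by_contra! h0
  exact he.ne' (h.eq_zero e h0)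

lemma abs_edge_le (h : HasTriangularProfile δ A s j r x) {k : ℤ}
    (hk : 0 < stoppedLocalTime s x j r k) : |k| ≤ ⌈|(j : ℝ)| + 2 * r + δ * A⌉ := by
  have : ((|k| : ℤ) : ℝ) ≤ ⌈|(j : ℝ)| + 2 * r + δ * A⌉ := by
    rw [Int.cast_abs]
    exact (h.lt_of_pos hk).le.trans (Int.le_ceil _)
  exact_mod_cast this

lemma exists_edge (h2 : δ * A + 2 ≤ |(j : ℝ)| + 2 * r) :
    ∃ k : ℤ, |(j : ℝ)| + 2 * r - δ * A - 2 ≤ k ∧ |(k : ℝ)| < |(j : ℝ)| + 2 * r - δ * A := by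
  have h3 := Int.floor_le (|(j : ℝ)| + 2 * r - δ * A - 1)
  have h4 := Int.lt_floor_add_one (|(j : ℝ)| + 2 * r - δ * A - 1)
  have h5 : (0 : ℝ) ≤ ⌊|(j : ℝ)| + 2 * r - δ * A - 1⌋ :=
    Int.cast_nonneg (Int.floor_nonneg.2 (by linarith))
  refine ⟨⌊|(j : ℝ)| + 2 * r - δ * A - 1⌋, by linarith, ?_⟩
  rw [abs_of_nonneg h5]
  linarith

lemma abs_rightmostEdge_sub_le (h : HasTriangularProfile δ A s j r x)
    (h2 : δ * A + 2 ≤ |(j : ℝ)| + 2 * r) :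
    |(rightmostEdge s x j r : ℝ) - (|(j : ℝ)| + 2 * r)| ≤ δ * A + 2 := by
  obtain ⟨k, hk1, hk2⟩ := exists_edge h2
  have hmem : k ∈ {k : ℤ | 0 < stoppedLocalTime s x j r k} := h.pos_of_lt hk2
  have hbdd : BddAbove {k : ℤ | 0 < stoppedLocalTime s x j r k} :=
    ⟨_, fun m hm => (le_abs_self m).trans (h.abs_edge_le hm)⟩
  have h3 : (k : ℝ) ≤ rightmostEdge s x j r := by exact_mod_cast le_csSup hbdd hmem
  have h4 := h.lt_of_pos (Int.csSup_mem ⟨k, hmem⟩ hbdd : 0 < stoppedLocalTime s x j r _)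
  have h5 : (rightmostEdge s x j r : ℝ) < |(j : ℝ)| + 2 * r + δ * A :=
    (le_abs_self _).trans_lt h4
  rw [abs_le]
  constructor <;> linarith

lemma abs_leftmostEdge_add_le (h : HasTriangularProfile δ A s j r x)
    (h2 : δ * A + 2 ≤ |(j : ℝ)| + 2 * r) :
    |(leftmostEdge s x j r : ℝ) + (|(j : ℝ)| + 2 * r)| ≤ δ * A + 2 := by
  obtain ⟨k, hk1, hk2⟩ := exists_edge h2
  have hmem : -k ∈ {k : ℤ | 0 < stoppedLocalTime s x j r k} :=
    h.pos_of_lt (by rwa [Int.cast_neg, abs_neg])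
  have hbdd : BddBelow {k : ℤ | 0 < stoppedLocalTime s x j r k} :=
    ⟨_, fun m hm => neg_le_of_abs_le (h.abs_edge_le hm)⟩
  have h3 : (leftmostEdge s x j r : ℝ) ≤ -k := by exact_mod_cast csInf_le hbdd hmem
  have h4 := h.lt_of_pos (Int.csInf_mem ⟨-k, hmem⟩ hbdd : 0 < stoppedLocalTime s x j r _)
  have h5 : -(|(j : ℝ)| + 2 * r + δ * A) < (leftmostEdge s x j r : ℝ) := (abs_lt.1 h4).1
  rw [abs_le]
  constructor <;> linarith

end HasTriangularProfile

lemma abs_abs_floor_sub_le {A : ℝ} (hA : 0 < A) (y : ℝ) : |(|(⌊A * y⌋ : ℝ)| - A * |y|)| ≤ 1 := by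
  rw [← abs_of_pos hA, ← abs_mul, abs_of_pos hA]
  refine (abs_abs_sub_abs_le _ _).trans ?_
  rw [abs_le]
  constructor <;> linarith [Int.floor_le (A * y), Int.lt_floor_add_one (A * y)]

lemma abs_inv_mul_sub_le {A a b c : ℝ} (hA : 0 < A) (h : |a - A * b| ≤ c) :
    |A⁻¹ * a - b| ≤ A⁻¹ * c := by
  have : A⁻¹ * a - b = A⁻¹ * (a - A * b) := by field_simp
  rw [this, abs_mul, abs_of_pos (inv_pos.2 hA)]
  exact mul_le_mul_of_nonneg_left h (inv_pos.2 hA).le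

section Rescaled

variable {δ A : ℝ} {s : ℤˣ} {x h : ℝ} {X : ℕ → ℤ}

lemma abs_floor_sum_sub_le (hA : 0 < A) (hh : 0 < h) :
    |(|(⌊A * x⌋ : ℝ)| + 2 * ⌊A * h⌋₊) - A * (|x| + 2 * h)| ≤ 3 := by
  have h1 := abs_abs_floor_sub_le hA x
  have h2 := Nat.floor_le (mul_pos hA hh).le
  have h3 := Nat.lt_floor_add_one (A * h)
  rw [abs_le] at h1 ⊢
  constructor <;> linarith [h1.1, h1.2]

lemma abs_rescaled_stoppedLocalTime_sub_le (hA : 0 < A) (hh : 0 < h)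
    (H : HasTriangularProfile δ A s ⌊A * x⌋ ⌊A * h⌋₊ X) (y : ℝ) :
    |A⁻¹ * (stoppedLocalTime s X ⌊A * x⌋ ⌊A * h⌋₊ ⌊A * y⌋ : ℝ) - max (|x| - |y| + 2 * h) 0| ≤
      A⁻¹ * (δ * A + 5) := by
  refine abs_inv_mul_sub_le hA ?_
  have h1 := abs_floor_sum_sub_le (x := x) hA hh
  have h2 := abs_abs_floor_sub_le hA y
  have h3 := H.abs_sub_le ⌊A * y⌋
  have h4 : |(|(⌊A * x⌋ : ℝ)| - |(⌊A * y⌋ : ℝ)| + 2 * ⌊A * h⌋₊) - A * (|x| - |y| + 2 * h)| ≤ 5 := by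
    rw [abs_le] at h1 h2 ⊢
    constructor <;> linarith [h1.1, h1.2, h2.1, h2.2]
  have h5 := (abs_max_sub_max_le_abs _ _ 0).trans h4
  rw [mul_max_of_nonneg _ _ hA.le, mul_zero]
  rw [abs_le] at h3 h5 ⊢
  constructor <;> linarith [h3.1, h3.2, h5.1, h5.2]

lemma add_two_le_abs_floor_add (hA : 0 < A) (hδh : δ ≤ h) (hAh : 4 ≤ A * h) :
    δ * A + 2 ≤ |(⌊A * x⌋ : ℝ)| + 2 * ⌊A * h⌋₊ := by
  have h1 := Nat.lt_floor_add_one (A * h)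
  have h2 := abs_nonneg (⌊A * x⌋ : ℝ)
  have h3 := mul_le_mul_of_nonneg_right hδh hA.le
  linarith

lemma abs_rescaled_rightmostEdge_sub_le (hA : 0 < A) (hh : 0 < h)
    (H : HasTriangularProfile δ A s ⌊A * x⌋ ⌊A * h⌋₊ X) (hδh : δ ≤ h) (hAh : 4 ≤ A * h) :
    |A⁻¹ * (rightmostEdge s X ⌊A * x⌋ ⌊A * h⌋₊ : ℝ) - (|x| + 2 * h)| ≤ A⁻¹ * (δ * A + 5) := by
  refine abs_inv_mul_sub_le hA ?_
  have h1 := abs_floor_sum_sub_le (x := x) hA hh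
  have h2 := H.abs_rightmostEdge_sub_le (add_two_le_abs_floor_add hA hδh hAh)
  rw [abs_le] at h1 h2 ⊢
  constructor <;> linarith [h1.1, h1.2, h2.1, h2.2]

lemma abs_rescaled_leftmostEdge_sub_le (hA : 0 < A) (hh : 0 < h)
    (H : HasTriangularProfile δ A s ⌊A * x⌋ ⌊A * h⌋₊ X) (hδh : δ ≤ h) (hAh : 4 ≤ A * h) :
    |A⁻¹ * (leftmostEdge s X ⌊A * x⌋ ⌊A * h⌋₊ : ℝ) - (-|x| - 2 * h)| ≤ A⁻¹ * (δ * A + 5) := by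
  refine abs_inv_mul_sub_le hA ?_
  have h1 := abs_floor_sum_sub_le (x := x) hA hh
  have h2 := H.abs_leftmostEdge_add_le (add_two_le_abs_floor_add hA hδh hAh)
  rw [abs_le] at h1 h2 ⊢
  constructor <;> linarith [h1.1, h1.2, h2.1, h2.2]

end Rescaled

lemma ennreal_edist_zero_right (a : ENNReal) : edist a 0 = a := by
  induction a with
  | top => exact (ENNReal.edist_eq_top_iff _ _).2 ⟨ENNReal.top_ne_zero, Or.inl rfl⟩
  | coe a =>
    have h : edist (a : ENNReal) 0 = edist a 0 := rfl
    rw [h, edist_nndist, NNReal.nndist_zero_eq_val']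

lemma exists_pos_ofReal_lt {ε : ENNReal} (hε : 0 < ε) : ∃ γ : ℝ, 0 < γ ∧ ENNReal.ofReal γ < ε := by
  obtain ⟨q, hq0, hq⟩ := ENNReal.lt_iff_exists_nnreal_btwn.1 hε
  exact ⟨q, by exact_mod_cast hq0, by simpa using hq⟩

/-- Convergence in measure from a deterministic estimate on events of probability tending to `1`. -/
lemma tendstoInMeasure_of_events {Ω E : Type*} [MeasurableSpace Ω] {P : Measure Ω} [EDist E]
    {f : ℝ → Ω → E} {g : Ω → E} {G : ℝ → ℝ → Set Ω} {h : ℝ} (hh : 0 < h)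
    (hG : ∀ δ, 0 < δ → Tendsto (fun A => P (G δ A)ᶜ) atTop (𝓝 0))
    (hfg : ∀ δ A, 0 < A → δ ≤ h → 4 ≤ A * h → ∀ ω ∈ G δ A,
      edist (f A ω) (g ω) ≤ ENNReal.ofReal (A⁻¹ * (δ * A + 5))) :
    TendstoInMeasure P f atTop g := by
  intro ε hε
  obtain ⟨ε', hε', hlt⟩ := exists_pos_ofReal_lt hε
  set δ := min (ε' / 2) h with hδ
  have hδ0 : 0 < δ := lt_min (by linarith) hh
  refine tendsto_of_tendsto_of_tendsto_of_le_of_le' tendsto_const_nhds (hG δ hδ0)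
    (Eventually.of_forall fun _ => zero_le) ?_
  filter_upwards [eventually_gt_atTop 0, eventually_ge_atTop (4 / h),
    eventually_ge_atTop (10 / ε')] with A hA hA1 hA2
  refine measure_mono fun ω hω hωG => ?_
  have h1 := hfg δ A hA (min_le_right _ _) (by rwa [div_le_iff₀ hh] at hA1) ω hωG
  have h2 : A⁻¹ * (δ * A + 5) ≤ ε' := by
    rw [div_le_iff₀ hε'] at hA2
    have h3 := mul_le_mul_of_nonneg_right (min_le_left (ε' / 2) h) hA.le
    rw [inv_mul_le_iff₀ hA]
    linarith
  exact absurd (lt_of_le_of_lt (h1.trans (ENNReal.ofReal_le_ofReal h2)) hlt) (not_lt.2 hω)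

/-- The self-repelling walk itself has a triangular profile with high probability. -/
lemma tendsto_not_hasTriangularProfile {Ω : Type*} [MeasurableSpace Ω] {P : Measure Ω}
    [IsProbabilityMeasure P] {w : ℤ → ℝ} (hp : IsRestoring (upProb w)) {X : ℕ → Ω → ℤ}
    (hX : IsSelfRepellingWalk P w X) (s : ℤˣ) (x : ℝ) {h : ℝ} (hh : 0 < h) {δ : ℝ} (hδ : 0 < δ) :
    Tendsto (fun A : ℝ =>
      P {ω | HasTriangularProfile δ A s ⌊A * x⌋ ⌊A * h⌋₊ fun n => X n ω}ᶜ) atTop (𝓝 0) := by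
  rw [ENNReal.tendsto_nhds_zero]
  intro ε hε
  obtain ⟨γ, hγ, hlt⟩ := exists_pos_ofReal_lt hε
  filter_upwards [exists_drivingLaw_not_hasTriangularProfile_le hp (C := |x| + 1 + h) (δ := δ)
    (by positivity) hδ hγ, eventually_ge_atTop 1, eventually_ge_atTop (1 / h)] with A hA hA1 hAh
  rw [div_le_iff₀ hh] at hAh
  have hr : 1 ≤ ⌊A * h⌋₊ := Nat.one_le_floor_iff _ |>.2 hAh
  have h1 := hA s ⌊A * x⌋ ⌊A * h⌋₊ hr (by
    have h2 := abs_le.1 (abs_abs_floor_sub_le (show 0 < A by linarith) x)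
    have h3 := Nat.floor_le (show 0 ≤ A * h by linarith)
    linarith [h2.2])
  have h2 := map_eq_map_stackWalk hp hX
    (measurableSet_hasTriangularProfile δ A s ⌊A * x⌋ ⌊A * h⌋₊).compl
  exact h2.le.trans (h1.trans hlt.le)

/-- The inverse local times are almost surely finite. -/
lemma ae_exists_le_orientedLocalTime {Ω : Type*} [MeasurableSpace Ω] {P : Measure Ω}
    [IsProbabilityMeasure P] {w : ℤ → ℝ} (hp : IsRestoring (upProb w)) {X : ℕ → Ω → ℤ}
    (hX : IsSelfRepellingWalk P w X) (s : ℤˣ) (j : ℤ) (r : ℕ) :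
    ∀ᵐ ω ∂P, ∃ n : ℕ, r ≤ orientedLocalTime s (fun i => X i ω) n j := by
  have h1 := map_eq_map_stackWalk hp hX (measurableSet_exists_le_orientedLocalTime s j r).compl
  refine h1.trans (ae_iff.1 ?_)
  filter_upwards [ae_isRecurrent hp, ae_exists_edgeChain_eq_zero hp] with u hrec hdie
  exact (followsStacks_stackWalk _).exists_le_orientedLocalTime hrec hdie s j r

end SelfRepellingWalk

theorem theorem1 {Ω : Type*} [MeasurableSpace Ω] (P : Measure Ω) [IsProbabilityMeasure P]
    (w : ℤ → ℝ) (hw_nonneg : ∀ z, 0 ≤ w z) (hw_zero : 0 < w 0) (hw_mono : Monotone w)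
    (hw_nonconst : ∃ a b, w a ≠ w b)
    (X : ℕ → Ω → ℤ) (hX : IsSelfRepellingWalk P w X)
    (s : ℤˣ) (x h : ℝ) (hh : 0 < h) :
    (∀ A : ℝ, 0 < A →
      ∀ᵐ ω ∂P, ∃ n : ℕ, ⌊A * h⌋₊ ≤ orientedLocalTime s (fun i => X i ω) n ⌊A * x⌋) ∧
    TendstoInMeasure P
      (fun (A : ℝ) ω => A⁻¹ * (leftmostEdge s (fun i => X i ω) ⌊A * x⌋ ⌊A * h⌋₊ : ℝ))
      atTop (fun _ => -|x| - 2 * h) ∧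
    TendstoInMeasure P
      (fun (A : ℝ) ω => A⁻¹ * (rightmostEdge s (fun i => X i ω) ⌊A * x⌋ ⌊A * h⌋₊ : ℝ))
      atTop (fun _ => |x| + 2 * h) ∧
    TendstoInMeasure P
      (fun (A : ℝ) ω => ⨆ y : ℝ,
        ‖A⁻¹ * (stoppedLocalTime s (fun i => X i ω) ⌊A * x⌋ ⌊A * h⌋₊ ⌊A * y⌋ : ℝ)
          - max (|x| - |y| + 2 * h) 0‖ₑ)
      atTop (fun _ => 0) := by
  have hp := SelfRepellingWalk.isRestoring_upProb hw_nonneg hw_zero hw_mono hw_nonconst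
  have hG := fun (δ : ℝ) (hδ : 0 < δ) =>
    SelfRepellingWalk.tendsto_not_hasTriangularProfile hp hX s x hh hδ
  refine ⟨fun A _ => SelfRepellingWalk.ae_exists_le_orientedLocalTime hp hX s _ _,
    SelfRepellingWalk.tendstoInMeasure_of_events hh hG fun δ A hA hδ hAh ω hω => ?_,
    SelfRepellingWalk.tendstoInMeasure_of_events hh hG fun δ A hA hδ hAh ω hω => ?_,
    SelfRepellingWalk.tendstoInMeasure_of_events hh hG fun δ A hA hδ hAh ω hω => ?_⟩
  · rw [edist_dist, Real.dist_eq]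
    exact ENNReal.ofReal_le_ofReal
      (SelfRepellingWalk.abs_rescaled_leftmostEdge_sub_le hA hh hω hδ hAh)
  · rw [edist_dist, Real.dist_eq]
    exact ENNReal.ofReal_le_ofReal
      (SelfRepellingWalk.abs_rescaled_rightmostEdge_sub_le hA hh hω hδ hAh)
  · rw [SelfRepellingWalk.ennreal_edist_zero_right]
    refine iSup_le fun y => ?_
    rw [Real.enorm_eq_ofReal_abs]
    exact ENNReal.ofReal_le_ofReal
      (SelfRepellingWalk.abs_rescaled_stoppedLocalTime_sub_le hA hh hω y)
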